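/- Let $(\zeta_i)_{i\ge 0}$ be i.i.d. random vectors with values in $\mathbb Z^2$ on a probability space $(\Omega,\mathbb P)$, with $\mathbb E\|\zeta_0\|^2<\infty$, $\mathbb E\,\zeta_0=0$, and aperiodic: the support $\mathcal S=\{\ell:\mathbb P(\zeta_0=\ell)>0\}$ generates the group $\mathbb Z^2$. Put $Z_0=0$, $Z_n=\zeta_0+\dots+\zeta_{n-1}$. For finite sets $I,J$ of nonnegative integers and $p\in\mathbb Z^2$ let $V(\omega,I,J,p)=\#\{(u,v)\in I\times J: Z_u(\omega)-Z_v(\omega)=p\}$, and $V_n(\omega,p)=V(\omega,[0,n[,[0,n[,p)$. Let $\theta$ denote the shift of the sequence $(\zeta_i)$, so that $V_m(\theta^b\omega,p)$ is the quantity $V_m(\cdot,p)$ computed for the walk with increments $(\zeta_{b+i})_{i\ge0}$. For real $0\le a\le b$, $[na,nb]$ denotes the set of integers $k$ with $\lfloor na\rfloor\le k\le\lfloor nb\rfloor$; $\mathbb T^2=(\mathbb R/\mathbb Z)^2$ carries its Haar probability measure. There is a constant $C_0\in(0,\infty)$ with $\mathbb E[V_n(\cdot,0)]\sim C_0\,n\ln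 n$ (and $C_0=(\pi\sqrt{\det\Sigma})^{-1}$, where $\Sigma$ is the covariance matrix of $\zeta_0$, if $\mathcal S-\mathcal S$ generates $\mathbb Z^2$) such that for $\mathbb P$-a.e. $\omega$ all of the following hold. 1. For all $0<A<B<C<D<1$ and $p\in\mathbb Z^2$, $$\int_{\mathbb T^2}\Bigl(\sum_{v\in[nA,nB]}e^{2\pi i\langle Z_v(\omega),u\rangle}\Bigr)\Bigl(\sum_{w\in[nC,nD]}e^{-2\pi i\langle Z_w(\omega),u\rangle}\Bigr)e^{-2\pi i\langle p,u\rangle}\,du=o(n\log n)\qquad(n\to\infty),$$ and this integral equals $V(\omega,[nA,nB],[nC,nD],p)$; more generally, with arbitrary finite sets of times $I,J$ in place of the two blocks, the integral equals $V(\omega,I,J,p)$. 2. For all $A\in(0,1)$, $B=1-A$, and $p\in\mathbb Z^2$, $$\lim_n\frac{V_{\lfloor nB\rfloor}(\theta^{\lfloor nA\rfloor}\omega,p)}{C_0\lfloor nB\rfloor\ln\lfloor nB\rfloor}=\lim_n\frac{V(\omega,[nA,n],[nA,n],p)}{C_0\,nB\ln n}=1,$$ $$V(\omega,[1,nA],[nA,n],p)+V(\omega,[nA,n],[1,nA],p)=o(n\log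 n),$$ where $[1,nA]$ denotes $\{1,\dots,\lfloor nA\rfloor\}$. 3. For every action $(T^\ell)_{\ell\in\mathbb Z^2}$ of $\mathbb Z^2$ by measure preserving transformations of a probability space $(E,\mu)$, every real $f\in L^2(E,\mu)$ having a continuous spectral density $\varphi_f$ (a continuous function on $\mathbb T^2$ with $\int_{\mathbb T^2}\varphi_f(t)e^{-2\pi i\langle\ell,t\rangle}dt=\int_E f(T^\ell x)f(x)\,d\mu(x)$ for all $\ell\in\mathbb Z^2$), every subdivision $0=t_0<t_1<\dots<t_s=1$ and all real $a_1,\dots,a_s$, $$(C_0\,n\ln n)^{-1}\,\Bigl\|\sum_{j=1}^s a_j\sum_{k\in[nt_{j-1},nt_j]}f\circ T^{Z_k(\omega)}\Bigr\|_{L^2(\mu)}^2\longrightarrow\varphi_f(0)\sum_{j=1}^s a_j^2\,(t_j-t_{j-1}).$$ -/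

import Mathlib

open MeasureTheory ProbabilityTheory Filter Topology Asymptotics

noncomputable section

/-- The lattice `ℤ²`. -/
abbrev Lattice2 : Type := Fin 2 → ℤ

/-- The 2-dimensional torus `(ℝ / ℤ)²`. -/
abbrev Torus2 : Type := UnitAddTorus (Fin 2)

/-- The path `Z₀ = 0`, `Z_n = z₀ + ⋯ + z_{n-1}` with increments `z`. -/
def walk (z : ℕ → Lattice2) (n : ℕ) : Lattice2 := ∑ i ∈ Finset.range n, z i

/-- The `b`-th power of the shift acting on sequences of increments. -/
def shiftBy (b : ℕ) (z : ℕ → Lattice2) : ℕ → Lattice2 := fun i => z (b + i)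

/-- The number of pairs `(u, v) ∈ I × J` with `Z_u - Z_v = p`. -/
def crossCount (z : ℕ → Lattice2) (I J : Finset ℕ) (p : Lattice2) : ℕ :=
  ((I ×ˢ J).filter fun uv => walk z uv.1 - walk z uv.2 = p).card

/-- The number of pairs `0 ≤ u, v < n` with `Z_u - Z_v = p`. -/
def selfCount (z : ℕ → Lattice2) (n : ℕ) (p : Lattice2) : ℕ :=
  crossCount z (Finset.range n) (Finset.range n) p

/-- The integral over the torus of
`(∑_{u ∈ I} e^{2πi⟨Z_u, t⟩}) (∑_{v ∈ J} e^{-2πi⟨Z_v, t⟩}) e^{-2πi⟨p, t⟩}`.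
Here `UnitAddTorus.mFourier ℓ t = e^{2πi⟨ℓ, t⟩}`, and `UnitAddTorus.mFourierCoeff g p` is the
integral of `g(t) e^{-2πi⟨p, t⟩}` for the Haar probability measure. -/
def crossIntegral (z : ℕ → Lattice2) (I J : Finset ℕ) (p : Lattice2) : ℂ :=
  UnitAddTorus.mFourierCoeff (fun t : Torus2 =>
    (∑ u ∈ I, UnitAddTorus.mFourier (walk z u) t) *
      (∑ v ∈ J, UnitAddTorus.mFourier (-(walk z v)) t)) p

/-- The time block `[n a, n b]`, with integer parts of the end points. -/
def timeBlock (n : ℕ) (a b : ℝ) : Finset ℕ := Finset.Icc ⌊(n : ℝ) * a⌋₊ ⌊(n : ℝ) * b⌋₊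

section Law

variable {Ω : Type*} [MeasurableSpace Ω]

/-- The support `{ℓ : P(ζ = ℓ) > 0}` of the law of a lattice-valued random vector. -/
def stepSupport (P : Measure Ω) (ζ : Ω → Lattice2) : Set Lattice2 :=
  {l | 0 < P {ω | ζ ω = l}}

/-- The support of the step generates `ℤ²`. -/
def Aperiodic (P : Measure Ω) (ζ : Ω → Lattice2) : Prop :=
  AddSubgroup.closure (stepSupport P ζ) = ⊤

/-- The differences of elements of the support of the step generate `ℤ²`. -/
def StronglyAperiodic (P : Measure Ω) (ζ : Ω → Lattice2) : Prop :=
  AddSubgroup.closure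
    {d : Lattice2 | ∃ l ∈ stepSupport P ζ, ∃ l' ∈ stepSupport P ζ, d = l - l'} = ⊤

/-- The covariance matrix of a centered step. -/
def stepCov (P : Measure Ω) (ζ : Ω → Lattice2) : Matrix (Fin 2) (Fin 2) ℝ :=
  Matrix.of fun i j => ∫ ω, (ζ ω i : ℝ) * (ζ ω j : ℝ) ∂P

end Law

section Dynamics

variable {E : Type*} [MeasurableSpace E] [AddAction Lattice2 E]

/-- `φ` is a continuous spectral density of `f` for the action `T^ℓ x = ℓ +ᵥ x` of `ℤ²`:
for every `ℓ`, the Fourier coefficient `∫ φ(t) e^{-2πi⟨ℓ, t⟩} dt` is the correlation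
`⟨T^ℓ f, f⟩ = ∫ f(T^ℓ x) f(x) dμ(x)`. -/
def IsContSpectralDensity (μ : Measure E) (f : E → ℝ) (φ : C(Torus2, ℝ)) : Prop :=
  ∀ l : Lattice2, UnitAddTorus.mFourierCoeff (fun t : Torus2 => (φ t : ℂ)) l =
    ((∫ x, f (l +ᵥ x) * f x ∂μ : ℝ) : ℂ)

/-- The weighted block sum `∑_j a_j ∑_{k ∈ [n t_{j-1}, n t_j]} T^{Z_k} f`. -/
def blockSum (z : ℕ → Lattice2) (f : E → ℝ) {s : ℕ} (a : Fin s → ℝ) (t : Fin (s + 1) → ℝ)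
    (n : ℕ) (x : E) : ℝ :=
  ∑ j : Fin s, a j * ∑ k ∈ timeBlock n (t j.castSucc) (t j.succ), f (walk z k +ᵥ x)

end Dynamics

end

/-! By orthogonality of characters every integral in the statement counts pairs of times, so the
theorem is about intersection counts of the walk: their mean, their variance, almost sure
convergence, and finally a weak convergence argument on the torus.

Mean. With `Φ` the characteristic function of the step, the resolvent `∑ (1-ε)^k P(Z_k = p)` is the
torus integral of `e^{-2πi⟨p,t⟩} / (1 - (1-ε)Φ(t))`. Near the origin the denominator is close to `ε
+ Q(t)`, with `Q(t) = 2π² E⟨X,t⟩²` for a step `X`; since the area of `{Q ≤ s}` is linear in `s`, the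
integral is `κ log(1/ε) + O(1)` up to a small relative error, with `κ = (2π √det Σ)⁻¹`. Away from
the origin aperiodicity gives `Φ ≠ 1`, which is enough: the case `|Φ| = 1` does no harm to the
resolvent. Three affinely independent atoms give `P(Z_k = q) ≤ C/(k+1)`, and under this bound Abel
sums at `ε = 1/n` differ from partial sums by `O(1)`. Hence `∑_{k<n} P(Z_k = p) ∼ κ log n`, and the
mean count is asymptotic to `2κ n log n`: the two orders of the times give the factor 2
(`IsIIDSteps.tendsto_meanCount`).

Variance. Cut a block in two halves. Their own counts are independent, and the second moment of the
number of pairs across the cut is bounded by a constant times the product of the two lengths, by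
splitting two such pairs into independent increments (`IsIIDSteps.integral_bridgeCount_sq_le`).
Induction on the length gives variance `O(n²)`, against a squared mean of order `n² log² n`.

Almost sure limit. At scales `2^j` the normalized variances are `O(1/j²)`, hence summable, for all
blocks with end points `a 2^j`, `b 2^j`. Counts are monotone in the block, so a fine dyadic grid
transfers the limit to every block `[x_n, y_n)` with `x_n ∼ An`, `y_n ∼ Bn`, and the limit is
proportional to `B - A` (`IsIIDSteps.ae_hasBlockAsymptotics`). The rest is deterministic. As the
limit is additive in the block, pairs in two different blocks are negligible by subtraction
(`HasBlockAsymptotics.tendsto_splitCount`).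

Spectral part. The squared norm of a block sum is the integral of the spectral density against a
nonnegative trigonometric polynomial whose Fourier coefficients are weighted intersection counts.
After normalization all these coefficients have the same limit, so the measures converge weakly to a
multiple of the point mass at `0` (`tendsto_trigFunctional`). The null set concerns the path only,
so it serves all dynamical systems at once. -/

noncomputable section

set_option linter.unusedSectionVars false

open UnitAddTorus

/-! ### Fourier analysis on the torus -/

/-- The Haar probability measure of the torus. -/
def torusHaar : Measure Torus2 := Measure.pi fun _ => AddCircle.haarAddCircle

instance : IsProbabilityMeasure torusHaar := by unfold torusHaar; infer_instance

instance : Measure.IsAddHaarMeasure torusHaar := by unfold torusHaar; infer_instance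

lemma mFourierCoeff_eq_integral_torusHaar (f : Torus2 → ℂ) (p : Lattice2) :
    mFourierCoeff f p = ∫ t, mFourier (-p) t * f t ∂torusHaar := rfl

lemma norm_mFourier_apply (p : Lattice2) (t : Torus2) : ‖mFourier p t‖ = 1 := by
  simp only [mFourier, ContinuousMap.coe_mk, norm_prod, fourier_apply, Circle.norm_coe,
    Finset.prod_const_one]

lemma integral_mFourier (p : Lattice2) :
    ∫ t, mFourier p t ∂torusHaar = if p = 0 then 1 else 0 := by
  split_ifs with h
  · subst h; simp [mFourier_zero]
  · obtain ⟨i, hi⟩ := Function.ne_iff.mp h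
    have h1 : ∫ t, mFourier p t ∂torusHaar
        = ∏ i, ∫ x, fourier (p i) x ∂AddCircle.haarAddCircle :=
      integral_fintype_prod_eq_prod (fun i (x : UnitAddCircle) => fourier (p i) x)
    rw [h1]
    refine Finset.prod_eq_zero (Finset.mem_univ i) ?_
    have h2 := (orthonormal_iff_ite.mp (orthonormal_fourier (T := (1 : ℝ)))) 0 (p i)
    rw [ContinuousMap.inner_toLp, if_neg (fun h => hi h.symm)] at h2
    simpa using h2

lemma integrable_of_continuous_torusHaar {f : Torus2 → ℂ} (hf : Continuous f) :
    Integrable f torusHaar :=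
  hf.integrable_of_hasCompactSupport (HasCompactSupport.of_compactSpace f)

/-- Expanding the product gives one character per pair of times; it integrates to 1 when its
frequency `Z_u - Z_v - p` vanishes and to 0 otherwise. -/
lemma crossIntegral_eq_crossCount (z : ℕ → Lattice2) (I J : Finset ℕ) (p : Lattice2) :
    crossIntegral z I J p = (crossCount z I J p : ℂ) := by
  have h : ∀ t : Torus2, mFourier (-p) t * ((∑ u ∈ I, mFourier (walk z u) t) *
      (∑ v ∈ J, mFourier (-(walk z v)) t)) =
      ∑ uv ∈ I ×ˢ J, mFourier (walk z uv.1 - walk z uv.2 - p) t := by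
    intro t
    rw [Finset.sum_mul_sum, ← Finset.sum_product', Finset.mul_sum]
    refine Finset.sum_congr rfl fun uv _ => ?_
    rw [← mFourier_add, ← mFourier_add]
    congr 2
    abel
  rw [crossIntegral, mFourierCoeff_eq_integral_torusHaar]
  simp_rw [h]
  rw [integral_finsetSum _ fun uv _ =>
    integrable_of_continuous_torusHaar (mFourier _).continuous]
  simp_rw [integral_mFourier, sub_eq_zero, crossCount, Finset.card_filter]
  push_cast
  rfl

/-! ### Increments of the walk -/

/-- The increment `z_u + ⋯ + z_{v-1}` between the times `u` and `v`. -/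
def increment (z : ℕ → Lattice2) (u v : ℕ) : Lattice2 := ∑ i ∈ Finset.Ico u v, z i

lemma walk_sub_walk (z : ℕ → Lattice2) {u v : ℕ} (h : u ≤ v) :
    walk z v - walk z u = increment z u v :=
  (Finset.sum_Ico_eq_sub z h).symm

lemma increment_add (z : ℕ → Lattice2) {u v w : ℕ} (huv : u ≤ v) (hvw : v ≤ w) :
    increment z u v + increment z v w = increment z u w :=
  Finset.sum_Ico_consecutive z huv hvw

/-! ### Characteristic function of the walk and Fourier inversion -/

section Law

variable {Ω : Type*} [MeasurableSpace Ω]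

/-- The characteristic function of a lattice-valued random vector, as a function on the torus. -/
def latticeCharFun (P : Measure Ω) (X : Ω → Lattice2) (t : Torus2) : ℂ :=
  ∫ ω, mFourier (X ω) t ∂P

/-- The random vectors `ζ i` are independent and identically distributed. -/
structure IsIIDSteps (P : Measure Ω) (ζ : ℕ → Ω → Lattice2) : Prop where
  measurable : ∀ i, Measurable (ζ i)
  iIndepFun : iIndepFun ζ P
  identDistrib : ∀ i, IdentDistrib (ζ i) (ζ 0) P P

lemma measurable_latticeFun_torus {f : Lattice2 × Torus2 → ℂ}
    (hf : ∀ l, Continuous fun t => f (l, t)) : Measurable f :=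
  measurable_from_prod_countable_right fun l => (hf l).measurable

variable {P : Measure Ω} [IsProbabilityMeasure P] {ζ : ℕ → Ω → Lattice2}

lemma integrable_mFourier_comp {X : Ω → Lattice2} (hX : Measurable X) (t : Torus2) :
    Integrable (fun ω => mFourier (X ω) t) P := by
  refine Integrable.of_bound (C := 1) ?_ (ae_of_all _ fun ω => (norm_mFourier_apply _ _).le)
  exact ((measurable_of_countable fun l => mFourier l t).comp hX).aestronglyMeasurable

lemma norm_latticeCharFun_le (X : Ω → Lattice2) (t : Torus2) : ‖latticeCharFun P X t‖ ≤ 1 := by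
  refine (norm_integral_le_integral_norm _).trans ?_
  simp [norm_mFourier_apply]

lemma continuous_latticeCharFun {X : Ω → Lattice2} (hX : Measurable X) :
    Continuous (latticeCharFun P X) := by
  refine continuous_of_dominated (bound := fun _ => 1) (fun t => ?_) (fun t => ?_)
    (integrable_const _) ?_
  · exact (integrable_mFourier_comp hX t).1
  · exact ae_of_all _ fun ω => (norm_mFourier_apply _ _).le
  · exact ae_of_all _ fun ω => (mFourier (X ω)).continuous

lemma measurable_increment_iSup (S : Set ℕ) {u v : ℕ} (h : ∀ i, u ≤ i → i < v → i ∈ S) :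
    Measurable[⨆ i ∈ S, MeasurableSpace.comap (ζ i) inferInstance]
      (fun ω => increment (fun i => ζ i ω) u v) := by
  unfold increment
  refine Finset.measurable_fun_sum _ fun i hi => ?_
  rw [Finset.mem_Ico] at hi
  refine Measurable.mono (comap_measurable (ζ i)) ?_ le_rfl
  exact le_iSup₂_of_le i (h i hi.1 hi.2) le_rfl

/-- Every later independence statement is reduced to this one, by exhibiting disjoint sets of step
indices with respect to which the variables are measurable. -/
lemma IsIIDSteps.indep_iSup (h : IsIIDSteps P ζ) {S T : Set ℕ} (hST : Disjoint S T) :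
    Indep (⨆ i ∈ S, MeasurableSpace.comap (ζ i) inferInstance)
      (⨆ i ∈ T, MeasurableSpace.comap (ζ i) inferInstance) P :=
  indep_iSup_of_disjoint (fun i => (h.measurable i).comap_le) h.iIndepFun hST

lemma IsIIDSteps.measurable_increment (h : IsIIDSteps P ζ) (u v : ℕ) :
    Measurable (fun ω => increment (fun i => ζ i ω) u v) :=
  Finset.measurable_fun_sum _ fun i _ => h.measurable i

lemma indepFun_of_measurable_of_indep {α β : Type*} [MeasurableSpace α] [MeasurableSpace β]
    {m₁ m₂ : MeasurableSpace Ω} (h : Indep m₁ m₂ P) {X : Ω → α} {Y : Ω → β}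
    (hX : Measurable[m₁] X) (hY : Measurable[m₂] Y) : IndepFun X Y P := by
  rw [IndepFun_iff_Indep]
  exact indep_of_indep_of_le_left (indep_of_indep_of_le_right h hY.comap_le) hX.comap_le

lemma IsIIDSteps.integral_mFourier_increment (h : IsIIDSteps P ζ) (u k : ℕ) (t : Torus2) :
    ∫ ω, mFourier (increment (fun i => ζ i ω) u (u + k)) t ∂P = latticeCharFun P (ζ 0) t ^ k := by
  induction k with
  | zero => simp [increment, mFourier_zero]
  | succ k ih =>
    have h1 : ∀ ω, mFourier (increment (fun i => ζ i ω) u (u + (k + 1))) t =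
        mFourier (increment (fun i => ζ i ω) u (u + k)) t * mFourier (ζ (u + k) ω) t := by
      intro ω
      rw [← mFourier_add, increment, ← add_assoc, Finset.sum_Ico_succ_top (by omega)]
      rfl
    have hind : IndepFun (fun ω => increment (fun i => ζ i ω) u (u + k)) (ζ (u + k)) P := by
      refine indepFun_of_measurable_of_indep
        (h.indep_iSup (S := {i | i < u + k}) (T := {u + k}) ?_)
        (measurable_increment_iSup _ fun i _ hi => hi) ?_
      · simp
      · exact Measurable.mono (comap_measurable (ζ (u + k)))
          (le_iSup₂_of_le (u + k) rfl le_rfl) le_rfl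
    have hm : Measurable fun l : Lattice2 => mFourier l t := measurable_of_countable _
    simp_rw [h1]
    have h2 := (hind.comp hm hm).integral_mul_eq_mul_integral
      (integrable_mFourier_comp (h.measurable_increment _ _) t).1
      (integrable_mFourier_comp (h.measurable _) t).1
    simp only [Function.comp_def, Pi.mul_apply] at h2
    have h3 : ∫ ω, mFourier (ζ (u + k) ω) t ∂P = latticeCharFun P (ζ 0) t :=
      ((h.identDistrib (u + k)).comp hm).integral_eq
    refine h2.trans ?_
    rw [ih, h3, pow_succ]

lemma prob_eq_integral_mFourier {X : Ω → Lattice2} (hX : Measurable X) (q : Lattice2) :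
    (P.real {ω | X ω = q} : ℂ) = ∫ t, ∫ ω, mFourier (X ω - q) t ∂P ∂torusHaar := by
  have h1 : Measurable fun z : Lattice2 × Torus2 => mFourier (z.1 - q) z.2 :=
    measurable_latticeFun_torus fun l => (mFourier (l - q)).continuous
  have h2 : Measurable fun z : Torus2 × Ω => (X z.2, z.1) :=
    (hX.comp measurable_snd).prodMk measurable_fst
  have hmeas : Measurable fun z : Torus2 × Ω => mFourier (X z.2 - q) z.1 := by
    have h3 := h1.comp h2
    simp only [Function.comp_def] at h3
    exact h3
  have hint : Integrable (Function.uncurry fun (t : Torus2) (ω : Ω) => mFourier (X ω - q) t)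
      (torusHaar.prod P) :=
    Integrable.of_bound (C := 1) hmeas.aestronglyMeasurable
      (ae_of_all _ fun z => (norm_mFourier_apply _ _).le)
  rw [integral_integral_swap hint]
  simp_rw [integral_mFourier, sub_eq_zero]
  have hq : MeasurableSet {ω | X ω = q} := hX (measurableSet_singleton q)
  rw [← integral_indicator_one hq, ← integral_complex_ofReal]
  congr 1 with ω
  by_cases hω : X ω = q <;> simp [hω]

/-- Fourier inversion for the law of an increment of the walk. -/
lemma IsIIDSteps.prob_increment_eq (h : IsIIDSteps P ζ) (u k : ℕ) (q : Lattice2) :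
    (P.real {ω | increment (fun i => ζ i ω) u (u + k) = q} : ℂ) =
      ∫ t, mFourier (-q) t * latticeCharFun P (ζ 0) t ^ k ∂torusHaar := by
  rw [prob_eq_integral_mFourier (h.measurable_increment u (u + k))]
  congr 1 with t
  rw [← h.integral_mFourier_increment u k t, ← integral_const_mul]
  congr 1 with ω
  rw [← mFourier_add, neg_add_eq_sub]

/-- Taking absolute values removes `q` from the inversion formula, so bounds on `|Φ|` give estimates
uniform in the target point. -/
lemma IsIIDSteps.prob_increment_le (h : IsIIDSteps P ζ) (u k : ℕ) (q : Lattice2) :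
    P.real {ω | increment (fun i => ζ i ω) u (u + k) = q} ≤
      ∫ t, ‖latticeCharFun P (ζ 0) t‖ ^ k ∂torusHaar := by
  have h1 := congrArg norm (h.prob_increment_eq u k q)
  rw [Complex.norm_real, Real.norm_of_nonneg measureReal_nonneg] at h1
  rw [h1]
  refine (norm_integral_le_integral_norm _).trans (le_of_eq ?_)
  simp [norm_mFourier_apply]

end Law

/-! ### Non-degeneracy of the support -/

section NonDegenerate

variable {Ω : Type*} [MeasurableSpace Ω] {P : Measure Ω} [IsProbabilityMeasure P]
  {X : Ω → Lattice2}

lemma ae_mem_stepSupport (P : Measure Ω) (X : Ω → Lattice2) : ∀ᵐ ω ∂P, X ω ∈ stepSupport P X := by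
  have h : ∀ l : Lattice2, ∀ᵐ ω ∂P, X ω = l → l ∈ stepSupport P X := by
    intro l
    by_cases hl : l ∈ stepSupport P X
    · exact ae_of_all _ fun _ _ => hl
    · have h0 : P {ω | X ω = l} = 0 := by simpa [stepSupport] using hl
      filter_upwards [measure_eq_zero_iff_ae_notMem.mp h0] with ω hω h1
      exact absurd h1 hω
  filter_upwards [ae_all_iff.mpr h] with ω hω using hω _ rfl

lemma integrable_coord (hX : Measurable X)
    (hmoment : ∀ i : Fin 2, Integrable (fun ω => (X ω i : ℝ) ^ 2) P) (i : Fin 2) :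
    Integrable (fun ω => (X ω i : ℝ)) P := by
  have hm : Measurable fun ω => (X ω i : ℝ) :=
    (measurable_of_countable (fun l : Lattice2 => (l i : ℝ))).comp hX
  exact ((memLp_two_iff_integrable_sq hm.aestronglyMeasurable).mpr (hmoment i)).integrable
    (by norm_num)

/-- An affine function that vanishes on the support of an aperiodic centered step is zero. -/
lemma linear_eq_zero_of_const_on_stepSupport (hint : ∀ i : Fin 2, Integrable (fun ω => (X ω i : ℝ)) P)
    (hcentered : ∀ i : Fin 2, ∫ ω, (X ω i : ℝ) ∂P = 0) (haper : Aperiodic P X) {a b c : ℝ}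
    (h : ∀ l ∈ stepSupport P X, a * (l 0 : ℝ) + b * (l 1 : ℝ) = c) : a = 0 ∧ b = 0 := by
  -- Integrating the relation gives `c = 0` by centering; the function is then a homomorphism whose
  -- kernel contains a generating set.
  have hc : c = 0 := by
    have h1 : ∫ ω, (a * (X ω 0 : ℝ) + b * (X ω 1 : ℝ)) ∂P = ∫ _, c ∂P :=
      integral_congr_ae (by
        filter_upwards [ae_mem_stepSupport P X] with ω hω using h _ hω)
    rw [integral_add ((hint 0).const_mul a) ((hint 1).const_mul b), integral_const_mul,
      integral_const_mul, hcentered, hcentered] at h1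
    simpa using h1.symm
  subst hc
  let f : Lattice2 →+ ℝ :=
    { toFun := fun l => a * (l 0 : ℝ) + b * (l 1 : ℝ)
      map_zero' := by simp
      map_add' := fun x y => by simp only [Pi.add_apply, Int.cast_add]; ring }
  have hker : AddSubgroup.closure (stepSupport P X) ≤ f.ker :=
    (AddSubgroup.closure_le _).mpr fun l hl => h l hl
  rw [Aperiodic] at haper
  rw [haper] at hker
  have h0 : f ![1, 0] = 0 := hker (AddSubgroup.mem_top _)
  have h1 : f ![0, 1] = 0 := hker (AddSubgroup.mem_top _)
  exact ⟨by simpa [f] using h0, by simpa [f] using h1⟩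

/-- The determinant of two lattice vectors. -/
def latticeDet (d e : Lattice2) : ℤ := d 0 * e 1 - d 1 * e 0

/-- Otherwise, for any two points of the support, the whole support lies on a line directed by their
difference. A nontrivial affine relation on the support being impossible, that difference is zero.
The support then has at most one point, and the constancy of the first coordinate is again such a
relation. -/
lemma exists_latticeDet_ne_zero (hint : ∀ i : Fin 2, Integrable (fun ω => (X ω i : ℝ)) P)
    (hcentered : ∀ i : Fin 2, ∫ ω, (X ω i : ℝ) ∂P = 0) (haper : Aperiodic P X) :
    ∃ l₀ ∈ stepSupport P X, ∃ l₁ ∈ stepSupport P X, ∃ l₂ ∈ stepSupport P X,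
      latticeDet (l₁ - l₀) (l₂ - l₀) ≠ 0 := by
  by_contra! hcon
  have heq : ∀ l₀ ∈ stepSupport P X, ∀ l₁ ∈ stepSupport P X, l₁ = l₀ := by
    intro l₀ h₀ l₁ h₁
    have h := linear_eq_zero_of_const_on_stepSupport hint hcentered haper
      (a := -((l₁ - l₀) 1 : ℤ)) (b := ((l₁ - l₀) 0 : ℤ))
      (c := -((l₁ - l₀) 1 : ℤ) * (l₀ 0 : ℝ) + ((l₁ - l₀) 0 : ℤ) * (l₀ 1 : ℝ)) (by
        intro l hl
        have h2 : ((latticeDet (l₁ - l₀) (l - l₀) : ℤ) : ℝ) = 0 := by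
          rw [hcon l₀ h₀ l₁ h₁ l hl]; simp
        simp only [latticeDet, Pi.sub_apply] at h2 ⊢
        push_cast at h2 ⊢
        linarith)
    obtain ⟨h1, h2⟩ := h
    have h1' : (l₁ - l₀) 1 = 0 := by exact_mod_cast neg_eq_zero.mp h1
    have h2' : (l₁ - l₀) 0 = 0 := by exact_mod_cast h2
    have h3 : l₁ - l₀ = 0 := by
      ext i; fin_cases i
      · exact h2'
      · exact h1'
    exact sub_eq_zero.mp h3
  have hc : ∃ c : ℝ, ∀ l ∈ stepSupport P X, 1 * (l 0 : ℝ) + 0 * (l 1 : ℝ) = c := by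
    by_cases hne : (stepSupport P X).Nonempty
    · obtain ⟨l₀, h₀⟩ := hne
      exact ⟨1 * (l₀ 0 : ℝ) + 0 * (l₀ 1 : ℝ), fun l hl => by rw [heq l₀ h₀ l hl]⟩
    · exact ⟨0, fun l hl => absurd ⟨l, hl⟩ hne⟩
  obtain ⟨c, hc⟩ := hc
  exact one_ne_zero (linear_eq_zero_of_const_on_stepSupport hint hcentered haper hc).1

end NonDegenerate

/-! ### Surjective endomorphisms of the torus -/

section Endomorphism

/-- The endomorphism `t ↦ (⟨d, t⟩, ⟨e, t⟩)` of the torus. -/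
def torusHom (d e : Lattice2) : Torus2 →+ Torus2 where
  toFun t := ![d 0 • t 0 + d 1 • t 1, e 0 • t 0 + e 1 • t 1]
  map_zero' := by ext i; fin_cases i <;> simp
  map_add' x y := by
    ext i; fin_cases i <;> simp only [Pi.add_apply, smul_add, Fin.zero_eta, Fin.mk_one,
      Matrix.cons_val_zero, Matrix.cons_val_one] <;> abel

lemma continuous_torusHom (d e : Lattice2) : Continuous (torusHom d e) := by
  refine continuous_pi fun i => ?_
  fin_cases i
  · exact ((continuous_apply 0).zsmul _).add ((continuous_apply 1).zsmul _)
  · exact ((continuous_apply 0).zsmul _).add ((continuous_apply 1).zsmul _)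

lemma surjective_torusHom {d e : Lattice2} (h : latticeDet d e ≠ 0) :
    Function.Surjective (torusHom d e) := by
  intro s
  obtain ⟨x, hx⟩ := QuotientAddGroup.mk_surjective (s 0)
  obtain ⟨y, hy⟩ := QuotientAddGroup.mk_surjective (s 1)
  have hD : ((latticeDet d e : ℤ) : ℝ) ≠ 0 := by exact_mod_cast h
  have hDe : ((latticeDet d e : ℤ) : ℝ) = d 0 * e 1 - d 1 * e 0 := by
    simp [latticeDet]
  -- Cramer's rule, applied to real lifts of the target where division by the determinant makes
  -- sense.
  refine ⟨![(((e 1 * x - d 1 * y) / latticeDet d e : ℝ) : UnitAddCircle),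
    (((d 0 * y - e 0 * x) / latticeDet d e : ℝ) : UnitAddCircle)], ?_⟩
  ext i
  fin_cases i
  · change d 0 • (((e 1 * x - d 1 * y) / latticeDet d e : ℝ) : UnitAddCircle) +
      d 1 • (((d 0 * y - e 0 * x) / latticeDet d e : ℝ) : UnitAddCircle) = s 0
    rw [← hx, ← AddCircle.coe_zsmul, ← AddCircle.coe_zsmul, ← AddCircle.coe_add]
    congr 1
    simp only [zsmul_eq_mul]
    field_simp
    rw [hDe]; ring
  · change e 0 • (((e 1 * x - d 1 * y) / latticeDet d e : ℝ) : UnitAddCircle) +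
      e 1 • (((d 0 * y - e 0 * x) / latticeDet d e : ℝ) : UnitAddCircle) = s 1
    rw [← hy, ← AddCircle.coe_zsmul, ← AddCircle.coe_zsmul, ← AddCircle.coe_add]
    congr 1
    simp only [zsmul_eq_mul]
    field_simp
    rw [hDe]; ring

/-- A continuous surjective endomorphism of a compact group carries Haar measure to Haar measure.
This makes `⟨d, t⟩` and `⟨e, t⟩` independent uniform coordinates. -/
lemma measurePreserving_torusHom {d e : Lattice2} (h : latticeDet d e ≠ 0) :
    MeasurePreserving (torusHom d e) torusHaar torusHaar :=
  (torusHom d e).measurePreserving (continuous_torusHom d e) (surjective_torusHom h) (by simp)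

lemma fourier_one_torusHom_zero (d e : Lattice2) (t : Torus2) :
    fourier 1 (torusHom d e t 0) = mFourier d t := by
  simp [torusHom, mFourier, fourier_apply, AddCircle.toCircle_add]

lemma fourier_one_torusHom_one (d e : Lattice2) (t : Torus2) :
    fourier 1 (torusHom d e t 1) = mFourier e t := by
  simp [torusHom, mFourier, fourier_apply, AddCircle.toCircle_add]

end Endomorphism

/-! ### A Gaussian bound on the circle -/

section CircleIntegral

/-- `exp (-a (1 - |cos (π x)|))` on the circle. -/
def circleBump (a : ℝ) (x : UnitAddCircle) : ℝ :=
  Real.exp (-a * (1 - ‖1 + fourier 1 x‖ / 2))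

lemma continuous_circleBump (a : ℝ) : Continuous (circleBump a) := by
  unfold circleBump; fun_prop

lemma circleBump_pow (a : ℝ) (k : ℕ) (x : UnitAddCircle) :
    circleBump a x ^ k = circleBump (k * a) x := by
  rw [circleBump, circleBump, ← Real.exp_nat_mul]; congr 1; ring

/-- Here `|1 + e^{2πix}| = 2 cos(πx)`, and `cos y ≤ 1 - (2/π²) y²` on `[-π, π]` turns the exponent
into a Gaussian one. -/
lemma circleBump_coe_le {a : ℝ} (ha : 0 ≤ a) {x : ℝ} (hx : |x| ≤ 1 / 2) :
    circleBump a (x : UnitAddCircle) ≤ Real.exp (-(2 * a) * x ^ 2) := by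
  have h1 : ‖1 + fourier 1 (x : UnitAddCircle)‖ = 2 * |Real.cos (Real.pi * x)| := by
    rw [fourier_coe_apply]
    have h2 : (1 : ℂ) + Complex.exp (2 * Real.pi * Complex.I * (1 : ℤ) * x / (1 : ℝ)) =
        Complex.exp ((Real.pi * x : ℝ) * Complex.I) * (2 * Real.cos (Real.pi * x) : ℝ) := by
      push_cast
      rw [Complex.cos, mul_div_cancel₀ _ (two_ne_zero), mul_add, ← Complex.exp_add,
        ← Complex.exp_add, add_comm]
      congr 1
      · congr 1; simp; ring
      · simp
    rw [h2, norm_mul, Complex.norm_exp_ofReal_mul_I, one_mul, Complex.norm_real, norm_mul]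
    simp
  have hcos : 0 ≤ Real.cos (Real.pi * x) := by
    have := abs_le.mp hx
    apply Real.cos_nonneg_of_neg_pi_div_two_le_of_le <;> nlinarith [Real.pi_pos]
  have hq := Real.cos_le_one_sub_mul_cos_sq (x := Real.pi * x) (by
    rw [abs_mul, abs_of_pos Real.pi_pos]; nlinarith [Real.pi_pos])
  have hq2 : 2 / Real.pi ^ 2 * (Real.pi * x) ^ 2 = 2 * x ^ 2 := by
    field_simp
  rw [hq2] at hq
  rw [circleBump, h1, abs_of_nonneg hcos]
  apply Real.exp_le_exp.mpr
  nlinarith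

lemma integral_circleBump_le {a : ℝ} (ha : 0 < a) :
    ∫ x, circleBump a x ∂AddCircle.haarAddCircle ≤ √(Real.pi / (2 * a)) := by
  have hv : (volume : Measure UnitAddCircle) = AddCircle.haarAddCircle := by
    rw [AddCircle.volume_eq_smul_haarAddCircle]; simp
  rw [← hv, ← AddCircle.integral_preimage 1 (-1 / 2)]
  rw [← integral_gaussian]
  have hint := integrable_exp_neg_mul_sq (b := 2 * a) (by positivity)
  refine le_trans ?_ (setIntegral_le_integral (s := Set.Ioc (-1 / 2 : ℝ) (-1 / 2 + 1)) hint
    (ae_of_all _ fun x => (Real.exp_pos _).le))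
  refine setIntegral_mono_on ?_ hint.integrableOn measurableSet_Ioc fun x hx => ?_
  · refine Integrable.of_bound (C := 1) ?_ ?_
    · exact ((continuous_circleBump a).comp (AddCircle.continuous_mk' 1)).aestronglyMeasurable
    · refine ae_of_all _ fun x => ?_
      rw [circleBump, Real.norm_of_nonneg (Real.exp_pos _).le, Real.exp_le_one_iff]
      have : ‖1 + fourier 1 (x : UnitAddCircle)‖ ≤ 2 := by
        refine (norm_add_le _ _).trans ?_
        rw [fourier_apply, Circle.norm_coe, norm_one]; norm_num
      nlinarith
  · refine circleBump_coe_le ha.le (abs_le.mpr ⟨by linarith [hx.1], by linarith [hx.2]⟩)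

end CircleIntegral

/-! ### Uniform decay of powers of the characteristic function -/

section LocalBound

variable {Ω : Type*} [MeasurableSpace Ω] {P : Measure Ω} [IsProbabilityMeasure P]
  {X : Ω → Lattice2}

/-- The law is `q` times the counting measure of `s` plus a positive remainder of mass `1 - |s| q`,
whose Fourier transform is at most its mass. -/
lemma norm_latticeCharFun_le_of_mass (hX : Measurable X) {s : Finset Lattice2} {q : ℝ} (hq : 0 < q)
    (hs : ∀ l ∈ s, q ≤ P.real {ω | X ω = l}) (t : Torus2) :
    ‖latticeCharFun P X t‖ ≤ 1 - s.card * q + q * ‖∑ l ∈ s, mFourier l t‖ := by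
  set w : Lattice2 → ℝ := fun l => P.real {ω | X ω = l} with hw
  -- The density of the extracted part with respect to the law: it takes exactly mass `q` from each
  -- atom in `s`.
  set r : Lattice2 → ℝ := fun l => if l ∈ s then q / w l else 0 with hr
  have hr0 : ∀ l, 0 ≤ r l := fun l => by
    simp only [hr]; split_ifs
    · exact div_nonneg hq.le measureReal_nonneg
    · exact le_rfl
  have hr1 : ∀ l, r l ≤ 1 := fun l => by
    simp only [hr]; split_ifs with h
    · exact div_le_one_of_le₀ (hs l h) measureReal_nonneg
    · exact zero_le_one
  have hrX : Measurable fun ω => r (X ω) := (measurable_of_countable r).comp hX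
  have hrint : Integrable (fun ω => r (X ω)) P :=
    Integrable.of_bound (C := 1) hrX.aestronglyMeasurable
      (ae_of_all _ fun ω => by rw [Real.norm_of_nonneg (hr0 _)]; exact hr1 _)
  have hsum : ∀ g : Lattice2 → ℂ, ∫ ω, (r (X ω) : ℂ) * g (X ω) ∂P = q * ∑ l ∈ s, g l := by
    intro g
    have h1 : ∀ ω, (r (X ω) : ℂ) * g (X ω) =
        ∑ l ∈ s, Set.indicator {ω | X ω = l} (fun _ => ((q / w l : ℝ) : ℂ) * g l) ω := by
      intro ω
      by_cases h : X ω ∈ s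
      · rw [Finset.sum_eq_single_of_mem _ h]
        · simp [hr, h]
        · intro l _ hl
          simp [Ne.symm hl]
      · rw [Finset.sum_eq_zero]
        · simp [hr, h]
        · intro l hl
          have : X ω ≠ l := fun h' => h (h' ▸ hl)
          simp [this]
    simp_rw [h1]
    have hm : ∀ l, MeasurableSet {ω | X ω = l} := fun l => hX (measurableSet_singleton l)
    rw [integral_finsetSum _ fun l _ => (integrable_const _).indicator (hm l), Finset.mul_sum]
    refine Finset.sum_congr rfl fun l hl => ?_
    rw [integral_indicator_const _ (hm l), Complex.real_smul, ← mul_assoc, ← Complex.ofReal_mul]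
    congr 2
    have : 0 < P.real {ω | X ω = l} := hq.trans_le (hs l hl)
    simp only [hw]
    field_simp
  have hsplit : latticeCharFun P X t = ∫ ω, ((1 - r (X ω) : ℝ) : ℂ) * mFourier (X ω) t ∂P +
      q * ∑ l ∈ s, mFourier l t := by
    rw [← hsum fun l => mFourier l t, ← integral_add]
    · rw [latticeCharFun]
      congr 1 with ω
      push_cast; ring
    · refine (integrable_mFourier_comp hX t).bdd_mul (c := 1) ?_ (ae_of_all _ fun ω => ?_)
      · exact (Complex.measurable_ofReal.comp (measurable_const.sub hrX)).aestronglyMeasurable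
      · rw [Complex.norm_real, Real.norm_of_nonneg (by linarith [hr1 (X ω)])]
        linarith [hr0 (X ω)]
    · refine (integrable_mFourier_comp hX t).bdd_mul (c := 1) ?_ (ae_of_all _ fun ω => ?_)
      · exact (Complex.measurable_ofReal.comp hrX).aestronglyMeasurable
      · rw [Complex.norm_real, Real.norm_of_nonneg (hr0 (X ω))]
        exact hr1 (X ω)
  rw [hsplit]
  refine (norm_add_le _ _).trans (add_le_add ?_ ?_)
  · refine (norm_integral_le_integral_norm _).trans ?_
    have h2 : ∀ ω, ‖((1 - r (X ω) : ℝ) : ℂ) * mFourier (X ω) t‖ = 1 - r (X ω) := by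
      intro ω
      rw [norm_mul, norm_mFourier_apply, mul_one, Complex.norm_real,
        Real.norm_of_nonneg (by linarith [hr1 (X ω)])]
    simp_rw [h2]
    rw [integral_sub (integrable_const _) hrint]
    have h3 := hsum fun _ => 1
    simp only [mul_one] at h3
    rw [integral_complex_ofReal] at h3
    have h4 : ∫ ω, r (X ω) ∂P = s.card * q := by
      have : ((∫ ω, r (X ω) ∂P : ℝ) : ℂ) = ((s.card * q : ℝ) : ℂ) := by
        rw [h3]; simp [mul_comm]
      exact_mod_cast this
    rw [h4]; simp
  · rw [norm_mul, Complex.norm_real, Real.norm_of_nonneg hq.le]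

/-- Extracting mass `q` at each of the three atoms bounds the modulus by `1 - q(1 - A/2) - q(1 -
B/2)`, where `A` and `B` are the moduli of `1 + e^{2πi⟨l_k - l₀, t⟩}` for `k = 1, 2`; then `1 + x ≤
e^x`. -/
lemma norm_latticeCharFun_le_circleBump (hX : Measurable X) {l₀ l₁ l₂ : Lattice2}
    (hdet : latticeDet (l₁ - l₀) (l₂ - l₀) ≠ 0) {q : ℝ} (hq : 0 < q)
    (h₀ : q ≤ P.real {ω | X ω = l₀}) (h₁ : q ≤ P.real {ω | X ω = l₁})
    (h₂ : q ≤ P.real {ω | X ω = l₂}) (t : Torus2) :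
    ‖latticeCharFun P X t‖ ≤ circleBump q (torusHom (l₁ - l₀) (l₂ - l₀) t 0) *
      circleBump q (torusHom (l₁ - l₀) (l₂ - l₀) t 1) := by
  have h10 : l₁ ≠ l₀ := by rintro rfl; simp [latticeDet] at hdet
  have h20 : l₂ ≠ l₀ := by rintro rfl; simp [latticeDet] at hdet
  have h21 : l₂ ≠ l₁ := by rintro rfl; exact hdet (by rw [latticeDet]; ring)
  have h := norm_latticeCharFun_le_of_mass (P := P) hX (s := {l₀, l₁, l₂}) hq (by
    simp only [Finset.mem_insert, Finset.mem_singleton]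
    rintro l (rfl | rfl | rfl) <;> assumption) t
  have hcard : ({l₀, l₁, l₂} : Finset Lattice2).card = 3 := by
    rw [Finset.card_eq_three]
    exact ⟨l₀, l₁, l₂, h10.symm, h20.symm, h21.symm, rfl⟩
  have hsum : ∑ l ∈ ({l₀, l₁, l₂} : Finset Lattice2), mFourier l t =
      mFourier l₀ t + (mFourier l₁ t + mFourier l₂ t) := by
    rw [Finset.sum_insert (by simp [h10.symm, h20.symm]), Finset.sum_pair h21.symm]
  have hfac : ∀ l : Lattice2, mFourier l t = mFourier l₀ t * mFourier (l - l₀) t := by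
    intro l; rw [← mFourier_add]; simp
  have hn : ∀ l : Lattice2, ‖mFourier l₀ t + mFourier l t‖ = ‖1 + mFourier (l - l₀) t‖ := by
    intro l
    rw [hfac l, ← mul_one_add, norm_mul, norm_mFourier_apply, one_mul]
  rw [hcard, hsum] at h
  have hb : ‖mFourier l₀ t + (mFourier l₁ t + mFourier l₂ t)‖ ≤
      1 + ‖1 + mFourier (l₁ - l₀) t‖ / 2 + ‖1 + mFourier (l₂ - l₀) t‖ / 2 := by
    rw [← hn, ← hn]
    have h12 : ‖mFourier l₁ t + mFourier l₂ t‖ ≤ 2 := by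
      refine (norm_add_le _ _).trans ?_
      rw [norm_mFourier_apply, norm_mFourier_apply]; norm_num
    -- Half the sum over the three pairs; the pair without `l₀` is bounded trivially by 2.
    have hdec : mFourier l₀ t + (mFourier l₁ t + mFourier l₂ t) =
        (1 / 2 : ℝ) • ((mFourier l₁ t + mFourier l₂ t) + ((mFourier l₀ t + mFourier l₁ t) +
        (mFourier l₀ t + mFourier l₂ t))) := by
      rw [Complex.real_smul]; push_cast; ring
    rw [hdec, norm_smul, Real.norm_of_nonneg (by norm_num)]
    have := norm_add₃_le (a := mFourier l₁ t + mFourier l₂ t) (b := mFourier l₀ t + mFourier l₁ t)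
      (c := mFourier l₀ t + mFourier l₂ t)
    rw [add_assoc] at this
    linarith
  rw [circleBump, circleBump, ← Real.exp_add, fourier_one_torusHom_zero, fourier_one_torusHom_one]
  refine le_trans ?_ (Real.add_one_le_exp _)
  push_cast at h
  nlinarith

lemma integral_circleBump_torus (a : ℝ) :
    ∫ t : Torus2, circleBump a (t 0) * circleBump a (t 1) ∂torusHaar =
      (∫ x, circleBump a x ∂AddCircle.haarAddCircle) ^ 2 := by
  have h := integral_fintype_prod_eq_prod (μ := fun _ : Fin 2 => AddCircle.haarAddCircle (T := 1))
    (fun (_ : Fin 2) (x : UnitAddCircle) => circleBump a x)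
  simp only [Fin.prod_univ_two] at h
  rw [sq]
  exact h

/-- The uniform bound `O(1/k)` for the integral of the `k`-th power of the characteristic
function of an aperiodic centered step. -/
lemma exists_integral_norm_latticeCharFun_pow_le (hX : Measurable X)
    (hint : ∀ i : Fin 2, Integrable (fun ω => (X ω i : ℝ)) P)
    (hcentered : ∀ i : Fin 2, ∫ ω, (X ω i : ℝ) ∂P = 0) (haper : Aperiodic P X) :
    ∃ C : ℝ, 0 < C ∧ ∀ k : ℕ,
      ∫ t, ‖latticeCharFun P X t‖ ^ k ∂torusHaar ≤ C / (k + 1) := by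
  obtain ⟨l₀, h₀, l₁, h₁, l₂, h₂, hdet⟩ := exists_latticeDet_ne_zero hint hcentered haper
  have hpos : ∀ l ∈ stepSupport P X, 0 < P.real {ω | X ω = l} := fun l hl =>
    ENNReal.toReal_pos (ne_of_gt hl) (measure_ne_top _ _)
  set q := min (P.real {ω | X ω = l₀}) (min (P.real {ω | X ω = l₁}) (P.real {ω | X ω = l₂}))
  have hq : 0 < q := lt_min (hpos _ h₀) (lt_min (hpos _ h₁) (hpos _ h₂))
  have hb := norm_latticeCharFun_le_circleBump hX hdet hq (min_le_left _ _)
    ((min_le_right _ _).trans (min_le_left _ _)) ((min_le_right _ _).trans (min_le_right _ _))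
  -- The summand 1 covers `k = 0`. For `k ≥ 1` the Gaussian bound gives `π / (2kq)`, and `k + 1 ≤
  -- 2k`.
  refine ⟨1 + Real.pi / q, by positivity, fun k => ?_⟩
  rcases Nat.eq_zero_or_pos k with rfl | hk
  · simp; positivity
  have hk' : (1 : ℝ) ≤ k := by exact_mod_cast hk
  have hmp := measurePreserving_torusHom hdet
  set D := torusHom (l₁ - l₀) (l₂ - l₀) with hD
  have hcont : Continuous fun t : Torus2 =>
      circleBump (k * q) (t 0) * circleBump (k * q) (t 1) :=
    ((continuous_circleBump _).comp (continuous_apply 0)).mul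
      ((continuous_circleBump _).comp (continuous_apply 1))
  have h1 : ∫ t, ‖latticeCharFun P X t‖ ^ k ∂torusHaar ≤
      ∫ t, circleBump (k * q) (D t 0) * circleBump (k * q) (D t 1) ∂torusHaar := by
    refine integral_mono ?_ ?_ fun t => ?_
    · exact ((continuous_latticeCharFun hX).norm.pow k).integrable_of_hasCompactSupport
        (HasCompactSupport.of_compactSpace _)
    · exact (hcont.comp (continuous_torusHom _ _)).integrable_of_hasCompactSupport
        (HasCompactSupport.of_compactSpace _)
    · simp only
      rw [← circleBump_pow, ← circleBump_pow, ← mul_pow]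
      exact pow_le_pow_left₀ (norm_nonneg _) (hb t) k
  have h2 : ∫ t, circleBump (k * q) (D t 0) * circleBump (k * q) (D t 1) ∂torusHaar =
      ∫ t : Torus2, circleBump (k * q) (t 0) * circleBump (k * q) (t 1) ∂torusHaar := by
    rw [← hmp.map_eq, integral_map hmp.measurable.aemeasurable hcont.aestronglyMeasurable]
    rw [hmp.map_eq]
  rw [h2, integral_circleBump_torus] at h1
  refine h1.trans ?_
  have h3 := integral_circleBump_le (a := k * q) (by positivity)
  have h4 : 0 ≤ ∫ x, circleBump (k * q) x ∂AddCircle.haarAddCircle :=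
    integral_nonneg fun x => (Real.exp_pos _).le
  refine (pow_le_pow_left₀ h4 h3 2).trans ?_
  rw [Real.sq_sqrt (by positivity), div_le_div_iff₀ (by positivity) (by positivity)]
  have : (1 + Real.pi / q) * (2 * (k * q)) = 2 * k * q + 2 * k * Real.pi := by
    field_simp
  rw [this]
  nlinarith [Real.pi_pos, mul_pos (show (0 : ℝ) < k by linarith) hq]

end LocalBound

/-! ### Positive definite binary quadratic forms -/

section QuadraticForm

/-- The binary quadratic form `a x² + 2 b x y + c y²`. -/
def quadForm (a b c : ℝ) (t : Fin 2 → ℝ) : ℝ := a * t 0 ^ 2 + 2 * b * t 0 * t 1 + c * t 1 ^ 2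

lemma continuous_quadForm (a b c : ℝ) : Continuous (quadForm a b c) := by
  unfold quadForm; fun_prop

variable {a b c : ℝ}

/-- Determinant over trace is below the smallest eigenvalue: by Cayley–Hamilton, trace times form
minus determinant times `|t|²` is the squared length of the image of `t` under the matrix of the
form. -/
lemma sq_norm_le_quadForm (ha : 0 < a) (hdet : 0 < a * c - b ^ 2) (t : Fin 2 → ℝ) :
    (a * c - b ^ 2) / (a + c) * ‖t‖ ^ 2 ≤ quadForm a b c t := by
  have hc : 0 < c := by
    by_contra! h
    nlinarith [sq_nonneg b, mul_nonneg ha.le (neg_nonneg.mpr h)]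
  have h1 : (a * c - b ^ 2) / (a + c) * (t 0 ^ 2 + t 1 ^ 2) ≤ quadForm a b c t := by
    rw [div_mul_eq_mul_div, div_le_iff₀ (by positivity), quadForm]
    nlinarith [sq_nonneg (a * t 0 + b * t 1), sq_nonneg (b * t 0 + c * t 1)]
  refine le_trans (mul_le_mul_of_nonneg_left ?_ (by positivity)) h1
  have h2 : ‖t‖ ≤ √(t 0 ^ 2 + t 1 ^ 2) := by
    rw [pi_norm_le_iff_of_nonneg (Real.sqrt_nonneg _)]
    intro i
    fin_cases i
    · exact Real.abs_le_sqrt (by simp; positivity)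
    · exact Real.abs_le_sqrt (by simp; positivity)
  calc ‖t‖ ^ 2 ≤ √(t 0 ^ 2 + t 1 ^ 2) ^ 2 := pow_le_pow_left₀ (norm_nonneg _) h2 2
    _ = t 0 ^ 2 + t 1 ^ 2 := Real.sq_sqrt (by positivity)

lemma quadForm_nonneg (ha : 0 < a) (hdet : 0 < a * c - b ^ 2) (t : Fin 2 → ℝ) :
    0 ≤ quadForm a b c t := by
  have hc : 0 < c := by
    by_contra! h
    nlinarith [sq_nonneg b, mul_nonneg ha.le (neg_nonneg.mpr h)]
  exact le_trans (by positivity) (sq_norm_le_quadForm ha hdet t)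

lemma volume_disc {s : ℝ} (hs : 0 ≤ s) :
    volume {x : Fin 2 → ℝ | x 0 ^ 2 + x 1 ^ 2 ≤ s} = ENNReal.ofReal (Real.pi * s) := by
  have h1 : {x : Fin 2 → ℝ | x 0 ^ 2 + x 1 ^ 2 ≤ s} =
      (WithLp.toLp 2) ⁻¹' (Metric.closedBall (0 : EuclideanSpace ℝ (Fin 2)) (√s)) := by
    ext x
    simp only [Set.mem_ofPred_eq, Set.mem_preimage, mem_closedBall_zero_iff,
      EuclideanSpace.norm_eq, Fin.sum_univ_two, Real.norm_eq_abs, sq_abs]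
    exact (Real.sqrt_le_sqrt_iff hs).symm
  rw [h1, (PiLp.volume_preserving_toLp (Fin 2)).measure_preimage
    measurableSet_closedBall.nullMeasurableSet, EuclideanSpace.volume_closedBall_fin_two,
    ← ENNReal.ofReal_pow (Real.sqrt_nonneg _), Real.sq_sqrt hs, ← ENNReal.ofReal_mul hs, mul_comm]

lemma volume_quadForm_le (ha : 0 < a) (hdet : 0 < a * c - b ^ 2) {s : ℝ} (hs : 0 ≤ s) :
    volume {t | quadForm a b c t ≤ s} =
      ENNReal.ofReal (Real.pi / √(a * c - b ^ 2) * s) := by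
  -- Cholesky factor: the form at `t` is the squared Euclidean length of `M t`, so its sublevel sets
  -- are preimages of discs.
  set M : Matrix (Fin 2) (Fin 2) ℝ := !![√a, b / √a; 0, √((a * c - b ^ 2) / a)] with hM
  have hsa : 0 < √a := Real.sqrt_pos.mpr ha
  have hdetM : M.det = √(a * c - b ^ 2) := by
    rw [hM, Matrix.det_fin_two_of, mul_zero, sub_zero, ← Real.sqrt_mul ha.le]
    congr 1
    field_simp
  have hpos : 0 < √(a * c - b ^ 2) := Real.sqrt_pos.mpr hdet
  have hlin : LinearMap.det (Matrix.toLin' M) = √(a * c - b ^ 2) := by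
    rw [LinearMap.det_toLin', hdetM]
  have hpre : {t | quadForm a b c t ≤ s} =
      (Matrix.toLin' M) ⁻¹' {x : Fin 2 → ℝ | x 0 ^ 2 + x 1 ^ 2 ≤ s} := by
    ext t
    have h0 : Matrix.toLin' M t 0 = √a * t 0 + b / √a * t 1 := by
      simp [hM, Matrix.mulVec, dotProduct]
    have h1 : Matrix.toLin' M t 1 = √((a * c - b ^ 2) / a) * t 1 := by
      simp [hM, Matrix.mulVec, dotProduct]
    simp only [Set.mem_ofPred_eq, Set.mem_preimage]
    rw [h0, h1, mul_pow, Real.sq_sqrt (by positivity)]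
    have h2 : quadForm a b c t =
        (√a * t 0 + b / √a * t 1) ^ 2 + (a * c - b ^ 2) / a * t 1 ^ 2 := by
      rw [quadForm, add_sq, mul_pow, mul_pow, div_pow, Real.sq_sqrt ha.le]
      field_simp
      ring
    rw [h2]
  rw [hpre, Measure.addHaar_preimage_linearMap _ (by rw [hlin]; exact hpos.ne'), volume_disc hs,
    hlin, abs_of_pos (inv_pos.mpr hpos), ← ENNReal.ofReal_mul (inv_pos.mpr hpos).le]
  congr 1
  ring

/-- In dimension two the area of a sublevel set is linear in the level, so the image measure has
constant density. Integrals of functions of the form become integrals over an interval. -/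
lemma map_quadForm_restrict (ha : 0 < a) (hdet : 0 < a * c - b ^ 2) {r : ℝ} (hr : 0 ≤ r) :
    Measure.map (quadForm a b c) (volume.restrict {t | quadForm a b c t ≤ r}) =
      ENNReal.ofReal (Real.pi / √(a * c - b ^ 2)) • volume.restrict (Set.Icc 0 r) := by
  have hm := (continuous_quadForm a b c).measurable
  have hfin : IsFiniteMeasure (volume.restrict {t | quadForm a b c t ≤ r}) :=
    ⟨by rw [Measure.restrict_apply_univ, volume_quadForm_le ha hdet hr]; exact ENNReal.ofReal_lt_top⟩
  have hk : 0 ≤ Real.pi / √(a * c - b ^ 2) := by positivity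
  refine Measure.ext_of_Iic _ _ fun s => ?_
  rw [Measure.map_apply hm measurableSet_Iic,
    Measure.restrict_apply (hm measurableSet_Iic), Measure.smul_apply,
    Measure.restrict_apply measurableSet_Iic, smul_eq_mul]
  have h1 : quadForm a b c ⁻¹' Set.Iic s ∩ {t | quadForm a b c t ≤ r} =
      {t | quadForm a b c t ≤ min s r} := by
    ext t; simp
  have h2 : Set.Iic s ∩ Set.Icc 0 r = Set.Icc 0 (min s r) := by
    ext x; simp only [Set.mem_inter_iff, Set.mem_Iic, Set.mem_Icc, le_min_iff]; tauto
  rw [h1, h2, Real.volume_Icc, sub_zero]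
  by_cases hs : 0 ≤ min s r
  · rw [volume_quadForm_le ha hdet hs, ENNReal.ofReal_mul hk]
  · have h3 : {t | quadForm a b c t ≤ min s r} = ∅ := by
      ext t
      simp only [Set.mem_ofPred_eq, Set.mem_empty_iff_false, iff_false, not_le]
      exact (not_le.mp hs).trans_le (quadForm_nonneg ha hdet t)
    rw [h3, measure_empty, ENNReal.ofReal_of_nonpos (not_le.mp hs).le, mul_zero]

/-- The origin of the logarithm: the image measure turns this into `∫₀^r ds / (ε + s)`. -/
lemma integral_inv_add_quadForm (ha : 0 < a) (hdet : 0 < a * c - b ^ 2) {r ε : ℝ} (hr : 0 ≤ r)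
    (hε : 0 < ε) :
    ∫ t in {t | quadForm a b c t ≤ r}, (ε + quadForm a b c t)⁻¹ =
      Real.pi / √(a * c - b ^ 2) * Real.log ((ε + r) / ε) := by
  have hm := (continuous_quadForm a b c).measurable
  have hk : 0 ≤ Real.pi / √(a * c - b ^ 2) := by positivity
  have hmeas : Measurable fun s : ℝ => (ε + s)⁻¹ := by fun_prop
  rw [← integral_map (f := fun s => (ε + s)⁻¹) hm.aemeasurable hmeas.aestronglyMeasurable,
    map_quadForm_restrict ha hdet hr, integral_smul_measure, ENNReal.toReal_ofReal hk, smul_eq_mul,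
    integral_Icc_eq_integral_Ioc, ← intervalIntegral.integral_of_le hr,
    intervalIntegral.integral_comp_add_left (fun s => s⁻¹) ε, add_zero,
    integral_inv_of_pos hε (by positivity)]

lemma integrableOn_inv_add_quadForm (ha : 0 < a) (hdet : 0 < a * c - b ^ 2) {r ε : ℝ} (hr : 0 ≤ r)
    (hε : 0 < ε) :
    IntegrableOn (fun t => (ε + quadForm a b c t)⁻¹) {t | quadForm a b c t ≤ r} := by
  have hm := (continuous_quadForm a b c).measurable
  refine Measure.integrableOn_of_bounded (M := ε⁻¹) ?_ ?_ (ae_of_all _ fun t => ?_)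
  · rw [volume_quadForm_le ha hdet hr]; exact ENNReal.ofReal_ne_top
  · exact ((measurable_const.add hm).inv).aestronglyMeasurable
  · have := quadForm_nonneg ha hdet t
    rw [Real.norm_of_nonneg (by positivity)]
    exact inv_anti₀ hε (by linarith)

end QuadraticForm

/-! ### Second order expansion of the characteristic function -/

section Taylor

/-- The point of the torus with the given real coordinates. -/
def toTorus (t : Fin 2 → ℝ) : Torus2 := fun i => (t i : UnitAddCircle)

lemma continuous_toTorus : Continuous toTorus :=
  continuous_pi fun i => (AddCircle.continuous_mk' 1).comp (continuous_apply i)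

/-- The pairing `⟨l, t⟩`. -/
def latticePairing (l : Lattice2) (t : Fin 2 → ℝ) : ℝ := l 0 * t 0 + l 1 * t 1

lemma mFourier_toTorus (l : Lattice2) (t : Fin 2 → ℝ) :
    mFourier l (toTorus t) = Complex.exp ((2 * Real.pi * latticePairing l t : ℝ) * Complex.I) := by
  simp only [mFourier, ContinuousMap.coe_mk, toTorus, Fin.prod_univ_two]
  rw [fourier_coe_apply, fourier_coe_apply, ← Complex.exp_add]
  congr 1
  simp only [latticePairing]
  push_cast
  ring

lemma abs_latticePairing_le (l : Lattice2) (t : Fin 2 → ℝ) :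
    |latticePairing l t| ≤ (|(l 0 : ℝ)| + |(l 1 : ℝ)|) * ‖t‖ := by
  rw [latticePairing, add_mul]
  refine (abs_add_le _ _).trans (add_le_add ?_ ?_)
  · rw [abs_mul]; exact mul_le_mul_of_nonneg_left (norm_le_pi_norm t 0) (abs_nonneg _)
  · rw [abs_mul]; exact mul_le_mul_of_nonneg_left (norm_le_pi_norm t 1) (abs_nonneg _)

/-- The remainder of the second order expansion of `exp (i x)`. -/
def expRemainder (x : ℝ) : ℂ :=
  Complex.exp (x * Complex.I) - 1 - x * Complex.I + (x ^ 2 / 2 : ℝ)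

lemma norm_expRemainder_le_cube {x : ℝ} (hx : |x| ≤ 1) : ‖expRemainder x‖ ≤ |x| ^ 3 := by
  have hn : ‖(x : ℂ) * Complex.I‖ = |x| := by simp
  have h := Complex.exp_bound (x := x * Complex.I) (by rw [hn]; exact hx) (n := 3) (by norm_num)
  rw [hn] at h
  have h1 : expRemainder x = Complex.exp (x * Complex.I) -
      ∑ m ∈ Finset.range 3, (x * Complex.I) ^ m / (m.factorial : ℂ) := by
    simp only [expRemainder, Finset.sum_range_succ, Finset.sum_range_zero, mul_pow,
      Complex.I_sq, Nat.factorial]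
    push_cast
    ring
  rw [h1]
  refine h.trans ?_
  have : (0 : ℝ) ≤ |x| ^ 3 := by positivity
  norm_num [Nat.factorial]
  linarith

/-- Only second moments are available, so the cubic bound cannot be integrated. This global bound
provides the domination, and the cubic one the pointwise limit. -/
lemma norm_expRemainder_le_sq (x : ℝ) : ‖expRemainder x‖ ≤ 4 * x ^ 2 := by
  rcases le_or_gt |x| 1 with hx | hx
  · refine (norm_expRemainder_le_cube hx).trans ?_
    rw [pow_succ, sq_abs]
    nlinarith [sq_nonneg x, abs_nonneg x]
  · have h1 : ‖expRemainder x‖ ≤ 1 + 1 + |x| + x ^ 2 / 2 := by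
      unfold expRemainder
      refine (norm_add_le _ _).trans (add_le_add ((norm_sub_le _ _).trans (add_le_add
        ((norm_sub_le _ _).trans (add_le_add ?_ ?_)) ?_)) ?_)
      · rw [Complex.norm_exp_ofReal_mul_I]
      · simp
      · simp
      · rw [Complex.norm_real, Real.norm_of_nonneg (by positivity)]
    have h2 : x ^ 2 = |x| ^ 2 := (sq_abs x).symm
    nlinarith

variable {Ω : Type*} [MeasurableSpace Ω] {P : Measure Ω} [IsProbabilityMeasure P]
  {X : Ω → Lattice2}

/-- The quadratic form `2π² E⟨X, t⟩²`. -/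
def stepForm (P : Measure Ω) (X : Ω → Lattice2) : (Fin 2 → ℝ) → ℝ :=
  quadForm (2 * Real.pi ^ 2 * stepCov P X 0 0) (2 * Real.pi ^ 2 * stepCov P X 0 1)
    (2 * Real.pi ^ 2 * stepCov P X 1 1)

lemma integrable_coord_mul (hX : Measurable X)
    (hmoment : ∀ i : Fin 2, Integrable (fun ω => (X ω i : ℝ) ^ 2) P) (i j : Fin 2) :
    Integrable (fun ω => (X ω i : ℝ) * (X ω j : ℝ)) P := by
  have hm : ∀ i, Measurable fun ω => (X ω i : ℝ) := fun i =>
    (measurable_of_countable (fun l : Lattice2 => (l i : ℝ))).comp hX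
  have hL : ∀ i, MemLp (fun ω => (X ω i : ℝ)) 2 P := fun i =>
    (memLp_two_iff_integrable_sq (hm i).aestronglyMeasurable).mpr (hmoment i)
  exact (hL i).integrable_mul (hL j)

lemma integrable_latticePairing_sq (hX : Measurable X)
    (hmoment : ∀ i : Fin 2, Integrable (fun ω => (X ω i : ℝ) ^ 2) P) (t : Fin 2 → ℝ) :
    Integrable (fun ω => latticePairing (X ω) t ^ 2) P := by
  have h1 : ∀ ω, latticePairing (X ω) t ^ 2 = t 0 ^ 2 * ((X ω 0 : ℝ) * (X ω 0 : ℝ)) +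
      2 * t 0 * t 1 * ((X ω 0 : ℝ) * (X ω 1 : ℝ)) + t 1 ^ 2 * ((X ω 1 : ℝ) * (X ω 1 : ℝ)) := by
    intro ω; rw [latticePairing]; ring
  simp_rw [h1]
  have hI := integrable_coord_mul hX hmoment
  exact (((hI 0 0).const_mul _).add ((hI 0 1).const_mul _)).add ((hI 1 1).const_mul _)

lemma integral_latticePairing_sq (hX : Measurable X)
    (hmoment : ∀ i : Fin 2, Integrable (fun ω => (X ω i : ℝ) ^ 2) P) (t : Fin 2 → ℝ) :
    ∫ ω, latticePairing (X ω) t ^ 2 ∂P =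
      quadForm (stepCov P X 0 0) (stepCov P X 0 1) (stepCov P X 1 1) t := by
  have h1 : ∀ ω, latticePairing (X ω) t ^ 2 = t 0 ^ 2 * ((X ω 0 : ℝ) * (X ω 0 : ℝ)) +
      2 * t 0 * t 1 * ((X ω 0 : ℝ) * (X ω 1 : ℝ)) + t 1 ^ 2 * ((X ω 1 : ℝ) * (X ω 1 : ℝ)) := by
    intro ω; rw [latticePairing]; ring
  simp_rw [h1]
  have hI := integrable_coord_mul hX hmoment
  have hI2 : Integrable (fun ω => t 0 ^ 2 * ((X ω 0 : ℝ) * (X ω 0 : ℝ)) +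
      2 * t 0 * t 1 * ((X ω 0 : ℝ) * (X ω 1 : ℝ))) P :=
    ((hI 0 0).const_mul _).add ((hI 0 1).const_mul _)
  rw [integral_add hI2 ((hI 1 1).const_mul _), integral_add ((hI 0 0).const_mul _) ((hI 0 1).const_mul _), integral_const_mul,
    integral_const_mul, integral_const_mul]
  simp only [quadForm, stepCov, Matrix.of_apply]
  ring

lemma stepForm_eq (hX : Measurable X)
    (hmoment : ∀ i : Fin 2, Integrable (fun ω => (X ω i : ℝ) ^ 2) P) (t : Fin 2 → ℝ) :
    stepForm P X t = 2 * Real.pi ^ 2 * ∫ ω, latticePairing (X ω) t ^ 2 ∂P := by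
  rw [integral_latticePairing_sq hX hmoment, stepForm, quadForm, quadForm]; ring

/-- Centering kills the first order term, and the second order term is the quadratic form. -/
lemma latticeCharFun_toTorus_sub (hX : Measurable X)
    (hmoment : ∀ i : Fin 2, Integrable (fun ω => (X ω i : ℝ) ^ 2) P)
    (hcentered : ∀ i : Fin 2, ∫ ω, (X ω i : ℝ) ∂P = 0) (t : Fin 2 → ℝ) :
    1 - latticeCharFun P X (toTorus t) - stepForm P X t =
      -∫ ω, expRemainder (2 * Real.pi * latticePairing (X ω) t) ∂P := by
  have hI := integrable_coord hX hmoment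
  have hpair : Integrable (fun ω => latticePairing (X ω) t) P :=
    ((hI 0).mul_const _).add ((hI 1).mul_const _)
  have hpair0 : ∫ ω, latticePairing (X ω) t ∂P = 0 := by
    have : ∫ ω, latticePairing (X ω) t ∂P = ∫ ω, (X ω 0 : ℝ) * t 0 + (X ω 1 : ℝ) * t 1 ∂P := rfl
    rw [this, integral_add ((hI 0).mul_const _) ((hI 1).mul_const _), integral_mul_const,
      integral_mul_const, hcentered, hcentered]
    simp
  have hsq := integrable_latticePairing_sq hX hmoment t
  have hF := integrable_mFourier_comp (P := P) hX (toTorus t)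
  have h1 : ∀ ω, expRemainder (2 * Real.pi * latticePairing (X ω) t) =
      mFourier (X ω) (toTorus t) - 1 - (2 * Real.pi * Complex.I) * (latticePairing (X ω) t : ℂ) +
        (2 * Real.pi ^ 2 : ℂ) * ((latticePairing (X ω) t ^ 2 : ℝ) : ℂ) := by
    intro ω
    rw [mFourier_toTorus, expRemainder]
    push_cast
    ring
  simp_rw [h1]
  have hF1 : Integrable (fun ω => mFourier (X ω) (toTorus t) - 1) P := hF.sub (integrable_const _)
  have hp1 : Integrable (fun ω => (2 * Real.pi * Complex.I) * (latticePairing (X ω) t : ℂ)) P :=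
    hpair.ofReal.const_mul _
  have hF2 : Integrable (fun ω => mFourier (X ω) (toTorus t) - 1 -
      (2 * Real.pi * Complex.I) * (latticePairing (X ω) t : ℂ)) P := hF1.sub hp1
  have hs1 : Integrable (fun ω => (2 * Real.pi ^ 2 : ℂ) *
      ((latticePairing (X ω) t ^ 2 : ℝ) : ℂ)) P := hsq.ofReal.const_mul _
  rw [integral_add hF2 hs1, integral_sub hF1 hp1, integral_sub hF (integrable_const _), integral_const_mul,
    integral_const_mul, integral_complex_ofReal, integral_complex_ofReal, hpair0,
    stepForm_eq hX hmoment, latticeCharFun]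
  simp
  ring

/-- Dominated convergence for the remainder divided by `‖t‖²`. At `t = 0` the quotient is 0 by the
convention on division, so the full neighbourhood filter is allowed. -/
lemma tendsto_latticeCharFun_remainder (hX : Measurable X)
    (hmoment : ∀ i : Fin 2, Integrable (fun ω => (X ω i : ℝ) ^ 2) P)
    (hcentered : ∀ i : Fin 2, ∫ ω, (X ω i : ℝ) ∂P = 0) :
    Tendsto (fun t => ‖1 - latticeCharFun P X (toTorus t) - stepForm P X t‖ / ‖t‖ ^ 2)
      (𝓝 0) (𝓝 0) := by
  set B : Ω → ℝ := fun ω => |(X ω 0 : ℝ)| + |(X ω 1 : ℝ)| with hB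
  have hB0 : ∀ ω, 0 ≤ B ω := fun ω => by positivity
  have hx : ∀ t ω, |2 * Real.pi * latticePairing (X ω) t| ≤ 2 * Real.pi * B ω * ‖t‖ := by
    intro t ω
    rw [abs_mul, abs_of_pos Real.two_pi_pos, mul_assoc (2 * Real.pi)]
    exact mul_le_mul_of_nonneg_left (abs_latticePairing_le _ _) Real.two_pi_pos.le
  have hmeas : ∀ t, Measurable fun ω => expRemainder (2 * Real.pi * latticePairing (X ω) t) :=
    fun t => (measurable_of_countable
      (fun l : Lattice2 => expRemainder (2 * Real.pi * latticePairing l t))).comp hX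
  have hlim : Tendsto (fun t : Fin 2 → ℝ =>
      ∫ ω, ‖expRemainder (2 * Real.pi * latticePairing (X ω) t)‖ / ‖t‖ ^ 2 ∂P) (𝓝 0)
      (𝓝 (∫ _, (0 : ℝ) ∂P)) := by
    refine tendsto_integral_filter_of_dominated_convergence
      (fun ω => 4 * (2 * Real.pi) ^ 2 * (2 * ((X ω 0 : ℝ) ^ 2 + (X ω 1 : ℝ) ^ 2))) ?_ ?_ ?_ ?_
    · exact Eventually.of_forall fun t => ((hmeas t).norm.div_const _).aestronglyMeasurable
    · refine Eventually.of_forall fun t => ae_of_all _ fun ω => ?_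
      rw [Real.norm_of_nonneg (by positivity)]
      refine div_le_of_le_mul₀ (by positivity) (by positivity) ?_
      refine (norm_expRemainder_le_sq _).trans ?_
      rw [← sq_abs]
      have h2 : |2 * Real.pi * latticePairing (X ω) t| ^ 2 ≤ (2 * Real.pi * B ω * ‖t‖) ^ 2 :=
        pow_le_pow_left₀ (abs_nonneg _) (hx t ω) 2
      have h3 : B ω ^ 2 ≤ 2 * ((X ω 0 : ℝ) ^ 2 + (X ω 1 : ℝ) ^ 2) := by
        rw [← sq_abs (X ω 0 : ℝ), ← sq_abs (X ω 1 : ℝ), hB]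
        nlinarith [sq_nonneg (|(X ω 0 : ℝ)| - |(X ω 1 : ℝ)|)]
      calc 4 * |2 * Real.pi * latticePairing (X ω) t| ^ 2
          ≤ 4 * (2 * Real.pi * B ω * ‖t‖) ^ 2 := by linarith
        _ = 4 * (2 * Real.pi) ^ 2 * B ω ^ 2 * ‖t‖ ^ 2 := by ring
        _ ≤ _ := by gcongr
    · exact (((hmoment 0).add (hmoment 1)).const_mul 2).const_mul _
    · refine ae_of_all _ fun ω => ?_
      have hz : Tendsto (fun t : Fin 2 → ℝ => (2 * Real.pi * B ω) ^ 3 * ‖t‖) (𝓝 0) (𝓝 0) := by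
        have := (continuous_norm (E := Fin 2 → ℝ)).tendsto 0
        simpa using this.const_mul ((2 * Real.pi * B ω) ^ 3)
      have hsmall : ∀ᶠ t : Fin 2 → ℝ in 𝓝 0, 2 * Real.pi * B ω * ‖t‖ < 1 := by
        have := ((continuous_norm (E := Fin 2 → ℝ)).tendsto 0).const_mul (2 * Real.pi * B ω)
        rw [norm_zero, mul_zero] at this
        exact this.eventually_lt_const one_pos
      refine squeeze_zero' (Eventually.of_forall fun t => by positivity) ?_ hz
      filter_upwards [hsmall] with t ht
      refine div_le_of_le_mul₀ (by positivity) (by have := hB0 ω; positivity) ?_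
      refine (norm_expRemainder_le_cube ((hx t ω).trans ht.le)).trans ?_
      refine (pow_le_pow_left₀ (abs_nonneg _) (hx t ω) 3).trans (le_of_eq ?_)
      ring
  rw [integral_zero] at hlim
  refine squeeze_zero (fun t => by positivity) (fun t => ?_) hlim
  rw [latticeCharFun_toTorus_sub hX hmoment hcentered, norm_neg, integral_div]
  gcongr
  exact norm_integral_le_integral_norm _

lemma stepCov_pos (hX : Measurable X)
    (hmoment : ∀ i : Fin 2, Integrable (fun ω => (X ω i : ℝ) ^ 2) P)
    (hcentered : ∀ i : Fin 2, ∫ ω, (X ω i : ℝ) ∂P = 0) (haper : Aperiodic P X) :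
    0 < stepCov P X 0 0 ∧ 0 < stepCov P X 0 0 * stepCov P X 1 1 - stepCov P X 0 1 ^ 2 := by
  have hpos : ∀ t : Fin 2 → ℝ, t ≠ 0 →
      0 < quadForm (stepCov P X 0 0) (stepCov P X 0 1) (stepCov P X 1 1) t := by
    intro t ht
    rw [← integral_latticePairing_sq hX hmoment]
    refine lt_of_le_of_ne (integral_nonneg fun ω => sq_nonneg _) fun h0 => ht ?_
    rw [eq_comm, integral_eq_zero_iff_of_nonneg (fun ω => sq_nonneg _)
      (integrable_latticePairing_sq hX hmoment t)] at h0
    have hS : ∀ l ∈ stepSupport P X, t 0 * (l 0 : ℝ) + t 1 * (l 1 : ℝ) = 0 := by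
      intro l hl
      by_contra hne
      have hl' : 0 < P {ω | X ω = l} := hl
      refine hl'.ne' (measure_mono_null (fun ω (hω : X ω = l) => ?_) (ae_iff.mp h0))
      intro h1
      apply hne
      have h2 : latticePairing (X ω) t = 0 := by simpa using h1
      rw [hω, latticePairing] at h2
      linarith
    obtain ⟨h1, h2⟩ := linear_eq_zero_of_const_on_stepSupport (integrable_coord hX hmoment)
      hcentered haper hS
    ext i; fin_cases i
    · exact h1
    · exact h2
  have h0 : 0 < stepCov P X 0 0 := by
    have := hpos ![1, 0] (fun h => by simpa using congrFun h 0)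
    simpa [quadForm] using this
  refine ⟨h0, ?_⟩
  -- At this vector the form equals `Σ₀₀` times the determinant.
  have h1 := hpos ![stepCov P X 0 1, -stepCov P X 0 0] (fun h => by
    have := congrFun h 1
    simp at this
    exact h0.ne' this)
  simp only [quadForm, Matrix.cons_val_zero, Matrix.cons_val_one] at h1
  by_contra! h
  nlinarith [mul_nonneg h0.le (neg_nonneg.mpr h)]

/-- An average of unit complex numbers equals 1 only if almost all of them do. The character is then
1 on the support, hence on the group it generates, so `t` is an integer vector, and the only one in
the cube is 0. -/
lemma latticeCharFun_toTorus_ne_one (hX : Measurable X) (haper : Aperiodic P X) {t : Fin 2 → ℝ}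
    (ht : ∀ i, |t i| ≤ 1 / 2) (h0 : t ≠ 0) : latticeCharFun P X (toTorus t) ≠ 1 := by
  intro h1
  apply h0
  have hF := integrable_mFourier_comp (P := P) hX (toTorus t)
  have hFre : Integrable (fun ω => (mFourier (X ω) (toTorus t)).re) P := hF.re
  have hre : ∫ ω, (1 - (mFourier (X ω) (toTorus t)).re) ∂P = 0 := by
    rw [integral_sub (integrable_const _) hFre]
    have : ∫ ω, (mFourier (X ω) (toTorus t)).re ∂P = 1 := by
      have := integral_re hF
      simp only [RCLike.re_to_complex] at this
      rw [this]
      change (latticeCharFun P X (toTorus t)).re = 1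
      rw [h1]; rfl
    rw [this]; simp
  have hle : ∀ ω, (mFourier (X ω) (toTorus t)).re ≤ 1 := fun ω =>
    (Complex.re_le_norm _).trans (norm_mFourier_apply _ _).le
  rw [integral_eq_zero_iff_of_nonneg (fun ω => sub_nonneg.mpr (hle ω))
    ((integrable_const _).sub hFre)] at hre
  have hone : ∀ z : ℂ, ‖z‖ = 1 → z.re = 1 → z = 1 := by
    intro z hz hzre
    have h2 : ‖z‖ ^ 2 = z.re ^ 2 + z.im ^ 2 := by
      rw [← Complex.normSq_eq_norm_sq, Complex.normSq_apply]; ring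
    rw [hz, hzre] at h2
    have him : z.im = 0 := by nlinarith [sq_nonneg z.im]
    exact Complex.ext hzre him
  have hS : ∀ l ∈ stepSupport P X, mFourier l (toTorus t) = 1 := by
    intro l hl
    by_contra hne
    have hl' : 0 < P {ω | X ω = l} := hl
    refine hl'.ne' (measure_mono_null (fun ω (hω : X ω = l) => ?_) (ae_iff.mp hre))
    intro h2
    have h3 : (mFourier (X ω) (toTorus t)).re = 1 := by
      simp only [Pi.zero_apply] at h2; linarith
    rw [hω] at h3
    exact hne (hone _ (norm_mFourier_apply _ _) h3)
  let H : AddSubgroup Lattice2 :=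
    { carrier := {l | mFourier l (toTorus t) = 1}
      zero_mem' := by simp [mFourier_zero]
      add_mem' := fun {a b} ha hb => by
        simp only [Set.mem_ofPred_eq] at ha hb ⊢
        rw [mFourier_add, ha, hb, one_mul]
      neg_mem' := fun {a} ha => by
        simp only [Set.mem_ofPred_eq] at ha ⊢
        rw [mFourier_neg, ha, map_one] }
  have hH : AddSubgroup.closure (stepSupport P X) ≤ H := (AddSubgroup.closure_le _).mpr hS
  rw [Aperiodic] at haper
  rw [haper] at hH
  ext i
  have h4 : mFourier (Pi.single i 1) (toTorus t) = 1 := hH (AddSubgroup.mem_top _)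
  rw [mFourier_single, fourier_one] at h4
  have h5 : toTorus t i = 0 := by
    apply AddCircle.injective_toCircle (one_ne_zero (α := ℝ))
    rw [AddCircle.toCircle_zero]
    exact Circle.ext h4
  obtain ⟨n, hn⟩ := (AddCircle.coe_eq_zero_iff 1).mp h5
  have hn' : (n : ℝ) = t i := by simpa using hn
  have h6 := ht i
  rw [← hn'] at h6
  have h7 : |n| < 1 := by
    have : |(n : ℝ)| < 1 := by linarith
    exact_mod_cast this
  rw [Int.abs_lt_one_iff] at h7
  rw [← hn', h7]; simp

end Taylor

/-! ### Logarithmic singularity of the resolvent -/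

section Resolvent

lemma integral_torusHaar_eq (f : Torus2 → ℂ) :
    ∫ t, f t ∂torusHaar =
      ∫ x in {x : Fin 2 → ℝ | ∀ i, x i ∈ Set.Ioc (-1 / 2 : ℝ) (-1 / 2 + 1)}, f (toTorus x) :=
  UnitAddTorus.integral_preimage f fun _ => -1 / 2

/-- As `2η ≤ 1/2`, the denominator satisfies `|z| ≥ m/2`; the numerator error is at most `3ηm`,
whence the constant 6. -/
lemma norm_div_sub_inv_le {e z : ℂ} {m η : ℝ} (hm : 0 < m) (hη : η ≤ 1 / 4) (he : ‖e - 1‖ ≤ η)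
    (hz : ‖z - m‖ ≤ 2 * η * m) : ‖e / z - (m : ℂ)⁻¹‖ ≤ 6 * η * m⁻¹ := by
  have hη0 : 0 ≤ η := (norm_nonneg _).trans he
  have hzn : m / 2 ≤ ‖z‖ := by
    have h1 : ‖(m : ℂ)‖ - ‖z‖ ≤ ‖(m : ℂ) - z‖ := norm_sub_norm_le _ _
    rw [Complex.norm_real, Real.norm_of_nonneg hm.le, norm_sub_rev] at h1
    nlinarith
  have hz0 : z ≠ 0 := by rw [← norm_pos_iff]; linarith
  have hm0 : (m : ℂ) ≠ 0 := by exact_mod_cast hm.ne'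
  have h2 : e / z - (m : ℂ)⁻¹ = ((e - 1) * m - (z - m)) / (z * m) := by field_simp; ring
  rw [h2, norm_div, norm_mul, Complex.norm_real, Real.norm_of_nonneg hm.le,
    div_le_iff₀ (by positivity)]
  have h3 : ‖(e - 1) * m - (z - m)‖ ≤ 3 * η * m := by
    refine (norm_sub_le _ _).trans ?_
    rw [norm_mul, Complex.norm_real, Real.norm_of_nonneg hm.le]
    nlinarith
  refine h3.trans ?_
  have h4 : 6 * η * m⁻¹ * (‖z‖ * m) = 6 * η * ‖z‖ := by field_simp
  rw [h4]
  nlinarith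

variable {Ω : Type*} [MeasurableSpace Ω] {P : Measure Ω} [IsProbabilityMeasure P]
  {X : Ω → Lattice2}

/-- The constant `(2π √(det Σ))⁻¹`. -/
def greenConst (P : Measure Ω) (X : Ω → Lattice2) : ℝ :=
  (2 * Real.pi * √(stepCov P X).det)⁻¹

lemma stepCov_det (P : Measure Ω) (X : Ω → Lattice2) :
    (stepCov P X).det = stepCov P X 0 0 * stepCov P X 1 1 - stepCov P X 0 1 ^ 2 := by
  have : stepCov P X 1 0 = stepCov P X 0 1 := by
    simp only [stepCov, Matrix.of_apply]
    congr 1 with ω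
    ring
  rw [Matrix.det_fin_two, this]
  ring

/-- The step is centered with finite second moments, and aperiodic. -/
structure IsCenteredAperiodic (P : Measure Ω) (X : Ω → Lattice2) : Prop where
  measurable : Measurable X
  moment : ∀ i : Fin 2, Integrable (fun ω => (X ω i : ℝ) ^ 2) P
  centered : ∀ i : Fin 2, ∫ ω, (X ω i : ℝ) ∂P = 0
  aperiodic : Aperiodic P X

variable (h : IsCenteredAperiodic P X)
include h

lemma IsCenteredAperiodic.form_pos :
    0 < 2 * Real.pi ^ 2 * stepCov P X 0 0 ∧ 0 < (2 * Real.pi ^ 2 * stepCov P X 0 0) *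
      (2 * Real.pi ^ 2 * stepCov P X 1 1) - (2 * Real.pi ^ 2 * stepCov P X 0 1) ^ 2 := by
  obtain ⟨h1, h2⟩ := stepCov_pos h.measurable h.moment h.centered h.aperiodic
  refine ⟨by positivity, ?_⟩
  have h3 : (2 * Real.pi ^ 2 * stepCov P X 0 0) * (2 * Real.pi ^ 2 * stepCov P X 1 1) -
      (2 * Real.pi ^ 2 * stepCov P X 0 1) ^ 2 = (2 * Real.pi ^ 2) ^ 2 *
      (stepCov P X 0 0 * stepCov P X 1 1 - stepCov P X 0 1 ^ 2) := by ring
  rw [h3]; positivity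

lemma IsCenteredAperiodic.det_pos : 0 < (stepCov P X).det := by
  rw [stepCov_det]
  exact (stepCov_pos h.measurable h.moment h.centered h.aperiodic).2

lemma IsCenteredAperiodic.greenConst_pos : 0 < greenConst P X := by
  have := Real.sqrt_pos.mpr h.det_pos
  have := Real.pi_pos
  unfold greenConst; positivity

lemma IsCenteredAperiodic.pi_div_sqrt_eq :
    Real.pi / √((2 * Real.pi ^ 2 * stepCov P X 0 0) * (2 * Real.pi ^ 2 * stepCov P X 1 1) -
      (2 * Real.pi ^ 2 * stepCov P X 0 1) ^ 2) = greenConst P X := by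
  have h3 : (2 * Real.pi ^ 2 * stepCov P X 0 0) * (2 * Real.pi ^ 2 * stepCov P X 1 1) -
      (2 * Real.pi ^ 2 * stepCov P X 0 1) ^ 2 = (2 * Real.pi ^ 2) ^ 2 * (stepCov P X).det := by
    rw [stepCov_det]; ring
  have := Real.sqrt_pos.mpr h.det_pos
  rw [h3, Real.sqrt_mul (by positivity), Real.sqrt_sq (by positivity), greenConst]
  field_simp

lemma IsCenteredAperiodic.stepForm_nonneg (t : Fin 2 → ℝ) : 0 ≤ stepForm P X t :=
  quadForm_nonneg h.form_pos.1 h.form_pos.2 t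

lemma IsCenteredAperiodic.exists_sq_norm_le :
    ∃ c : ℝ, 0 < c ∧ ∀ t, c * ‖t‖ ^ 2 ≤ stepForm P X t := by
  obtain ⟨h1, h2⟩ := h.form_pos
  refine ⟨_, ?_, sq_norm_le_quadForm h1 h2⟩
  have hc : 0 < 2 * Real.pi ^ 2 * stepCov P X 1 1 := by
    by_contra! hc
    nlinarith [sq_nonneg (2 * Real.pi ^ 2 * stepCov P X 0 1), mul_nonneg h1.le (neg_nonneg.mpr hc)]
  positivity

/-- Write `Q` for the form. The denominator differs from `ε + Q` by the Taylor remainder, at most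
`ηQ` on a small ellipse, and by the cross term `εQ ≤ ηQ`. This is the relative error `2η` of
`norm_div_sub_inv_le`. -/
lemma IsCenteredAperiodic.exists_near (p : Lattice2) {η : ℝ} (hη : 0 < η) (hη' : η ≤ 1 / 4) :
    ∃ r : ℝ, 0 < r ∧ (∀ t, stepForm P X t ≤ r → ∀ i, |t i| < 1 / 2) ∧
      ∀ t, stepForm P X t ≤ r → ∀ ε : ℝ, 0 < ε → ε ≤ η →
        ‖mFourier (-p) (toTorus t) / (1 - (1 - ε : ℝ) * latticeCharFun P X (toTorus t)) -
          ((ε + stepForm P X t : ℝ) : ℂ)⁻¹‖ ≤ 6 * η * (ε + stepForm P X t)⁻¹ := by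
  obtain ⟨c, hc, hform⟩ := h.exists_sq_norm_le
  have hev1 : ∀ᶠ t in 𝓝 (0 : Fin 2 → ℝ),
      ‖1 - latticeCharFun P X (toTorus t) - stepForm P X t‖ / ‖t‖ ^ 2 < η * c :=
    (tendsto_latticeCharFun_remainder h.measurable h.moment h.centered).eventually_lt_const
      (by positivity)
  have hev2 : ∀ᶠ t in 𝓝 (0 : Fin 2 → ℝ), ‖mFourier (-p) (toTorus t) - 1‖ < η := by
    have hcont : Continuous fun t => ‖mFourier (-p) (toTorus t) - 1‖ :=
      (((mFourier (-p)).continuous.comp continuous_toTorus).sub continuous_const).norm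
    have h0 := hcont.tendsto 0
    have h1 : ‖mFourier (-p) (toTorus 0) - 1‖ = 0 := by
      rw [mFourier_toTorus]; simp [latticePairing]
    rw [h1] at h0
    exact h0.eventually_lt_const hη
  obtain ⟨δ, hδ, hball⟩ := Metric.eventually_nhds_iff.mp (hev1.and hev2)
  set d := min δ (1 / 2) with hd
  have hd0 : 0 < d := lt_min hδ (by norm_num)
  have hnorm : ∀ t, stepForm P X t ≤ c * d ^ 2 / 2 → ‖t‖ < d := by
    intro t ht
    have h1 : c * ‖t‖ ^ 2 < c * d ^ 2 := (hform t).trans_lt (ht.trans_lt (by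
      have : 0 < c * d ^ 2 := by positivity
      linarith))
    exact lt_of_pow_lt_pow_left₀ 2 hd0.le (lt_of_mul_lt_mul_left h1 hc.le)
  refine ⟨c * d ^ 2 / 2, by positivity, fun t ht i => ?_, fun t ht ε hε hεη => ?_⟩
  · exact ((norm_le_pi_norm t i).trans_lt (hnorm t ht)).trans_le (min_le_right _ _)
  · obtain ⟨h1, h2⟩ := hball (y := t) (by
      rw [dist_zero_right]; exact (hnorm t ht).trans_le (min_le_left _ _))
    have hQ := h.stepForm_nonneg t
    refine norm_div_sub_inv_le (by positivity) hη' h2.le ?_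
    have h3 : ‖1 - latticeCharFun P X (toTorus t) - stepForm P X t‖ ≤ η * stepForm P X t := by
      by_cases ht0 : t = 0
      · subst ht0
        have h5 : latticeCharFun P X (toTorus 0) = 1 := by
          simp [latticeCharFun, mFourier_toTorus, latticePairing]
        have h6 : stepForm P X 0 = 0 := by simp [stepForm, quadForm]
        rw [h5, h6]; simp
      · rw [div_lt_iff₀ (by have := norm_pos_iff.mpr ht0; positivity)] at h1
        nlinarith [hform t]
    have h4 : (1 - (1 - ε : ℝ) * latticeCharFun P X (toTorus t)) - ((ε + stepForm P X t : ℝ) : ℂ) =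
        (1 - ε : ℝ) * (1 - latticeCharFun P X (toTorus t) - stepForm P X t) -
          (ε * stepForm P X t : ℝ) := by
      push_cast; ring
    rw [h4]
    refine (norm_sub_le _ _).trans ?_
    rw [norm_mul, Complex.norm_real, Complex.norm_real, Real.norm_of_nonneg (by linarith),
      Real.norm_of_nonneg (by positivity)]
    have h7 : (1 - ε) * ‖1 - latticeCharFun P X (toTorus t) - stepForm P X t‖ ≤
        η * stepForm P X t := by
      refine le_trans ?_ h3
      exact mul_le_of_le_one_left (norm_nonneg _) (by linarith)
    nlinarith

/-- Compactness in `(x, t)` jointly makes the bound uniform as `ε → 0`. Since `|Φ| ≤ 1`, an equality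
`xΦ(t) = 1` forces `x = 1` and `Φ(t) = 1`, which is excluded off the origin even though `|Φ| = 1`
may occur there. -/
lemma IsCenteredAperiodic.exists_far {r : ℝ} (hr : 0 < r) :
    ∃ m : ℝ, 0 < m ∧ ∀ t, (∀ i, |t i| ≤ 1 / 2) → r ≤ stepForm P X t → ∀ x : ℝ, 0 ≤ x → x ≤ 1 →
      m ≤ ‖1 - x * latticeCharFun P X (toTorus t)‖ := by
  set K : Set (ℝ × (Fin 2 → ℝ)) := Set.Icc 0 1 ×ˢ
    (Set.Icc (fun _ => -(1 / 2)) (fun _ => 1 / 2) ∩ {t | r ≤ stepForm P X t}) with hK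
  have hKc : IsCompact K := isCompact_Icc.prod
    (isCompact_Icc.inter_right (isClosed_le continuous_const (continuous_quadForm _ _ _)))
  have hmem : ∀ t : Fin 2 → ℝ, (∀ i, |t i| ≤ 1 / 2) → r ≤ stepForm P X t → ∀ x : ℝ, 0 ≤ x →
      x ≤ 1 → (x, t) ∈ K := fun t ht hrt x hx0 hx1 =>
    ⟨⟨hx0, hx1⟩, ⟨⟨fun i => (abs_le.mp (ht i)).1, fun i => (abs_le.mp (ht i)).2⟩, hrt⟩⟩
  rcases K.eq_empty_or_nonempty with he | hne
  · refine ⟨1, one_pos, fun t ht hrt x hx0 hx1 => ?_⟩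
    have := hmem t ht hrt x hx0 hx1
    rw [he] at this
    exact absurd this (Set.notMem_empty _)
  have hcont : Continuous fun z : ℝ × (Fin 2 → ℝ) =>
      ‖1 - (z.1 : ℂ) * latticeCharFun P X (toTorus z.2)‖ :=
    (continuous_const.sub ((Complex.continuous_ofReal.comp continuous_fst).mul
      ((continuous_latticeCharFun h.measurable).comp
        (continuous_toTorus.comp continuous_snd)))).norm
  obtain ⟨z, hz, hmin⟩ := hKc.exists_isMinOn hne hcont.continuousOn
  refine ⟨_, ?_, fun t ht hrt x hx0 hx1 => hmin (hmem t ht hrt x hx0 hx1)⟩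
  obtain ⟨⟨hx0, hx1⟩, ⟨ht1, ht2⟩, hrt⟩ := hz
  rw [norm_pos_iff]
  intro h0
  have h1 : (z.1 : ℂ) * latticeCharFun P X (toTorus z.2) = 1 := (sub_eq_zero.mp h0).symm
  have hΦ := norm_latticeCharFun_le (P := P) X (toTorus z.2)
  have h2 := congrArg norm h1
  rw [norm_mul, Complex.norm_real, Real.norm_of_nonneg hx0, norm_one] at h2
  have h3 : z.1 = 1 := le_antisymm hx1 (by
    calc (1 : ℝ) = z.1 * ‖latticeCharFun P X (toTorus z.2)‖ := h2.symm
      _ ≤ z.1 * 1 := mul_le_mul_of_nonneg_left hΦ hx0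
      _ = z.1 := mul_one _)
  rw [h3, Complex.ofReal_one, one_mul] at h1
  refine latticeCharFun_toTorus_ne_one h.measurable h.aperiodic
    (fun i => abs_le.mpr ⟨ht1 i, ht2 i⟩) ?_ h1
  rintro h4
  have hrt' : r ≤ stepForm P X z.2 := hrt
  rw [h4] at hrt'
  have h6 : stepForm P X 0 = 0 := by simp [stepForm, quadForm]
  linarith

omit h in
lemma one_sub_mul_latticeCharFun_ne_zero {ε : ℝ} (hε : 0 < ε) (hε1 : ε ≤ 1) (t : Torus2) :
    1 - (1 - ε : ℝ) * latticeCharFun P X t ≠ 0 := by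
  intro h0
  have h1 := congrArg norm (sub_eq_zero.mp h0)
  rw [norm_one, norm_mul, Complex.norm_real, Real.norm_of_nonneg (by linarith)] at h1
  have := norm_latticeCharFun_le (P := P) X t
  nlinarith

/-- Logarithmic asymptotics of the resolvent `∑ (1-ε)^k P(Z_k = p)` as `ε → 0`. -/
lemma IsCenteredAperiodic.resolvent_asymptotics (p : Lattice2) {η : ℝ} (hη : 0 < η) :
    ∃ C ε₀ : ℝ, 0 < ε₀ ∧ ε₀ < 1 ∧ ∀ ε : ℝ, 0 < ε → ε ≤ ε₀ →
      ‖∫ t, mFourier (-p) t / (1 - (1 - ε : ℝ) * latticeCharFun P X t) ∂torusHaar -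
        (greenConst P X * Real.log (1 / ε) : ℝ)‖ ≤ η * Real.log (1 / ε) + C := by
  set κ := greenConst P X with hκ
  have hκ0 : 0 < κ := h.greenConst_pos
  -- The near part has error `6η'` relative to a main term of size `κ log(1/ε)`; this choice makes
  -- it at most `η log(1/ε)`.
  set η' := min (1 / 4) (η / (6 * κ)) with hη'
  have hη'0 : 0 < η' := lt_min (by norm_num) (by positivity)
  obtain ⟨r, hr, hrcube, hnear⟩ := h.exists_near p hη'0 (min_le_left _ _)
  obtain ⟨m, hm, hfar⟩ := h.exists_far hr
  obtain ⟨hA, hdet⟩ := h.form_pos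
  have h6 : 6 * η' * κ ≤ η := by
    have : η' ≤ η / (6 * κ) := min_le_right _ _
    rw [le_div_iff₀ (by positivity)] at this
    linarith
  refine ⟨(η + κ) * (|Real.log r| + |Real.log (1 + r)|) + m⁻¹, η', hη'0,
    (min_le_left _ _).trans_lt (by norm_num), fun ε hε hεη => ?_⟩
  have hε1 : ε ≤ 1 := hεη.trans ((min_le_left _ _).trans (by norm_num))
  set F : (Fin 2 → ℝ) → ℂ := fun t =>
    mFourier (-p) (toTorus t) / (1 - (1 - ε : ℝ) * latticeCharFun P X (toTorus t)) with hF
  have hFcont : Continuous F :=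
    ((mFourier (-p)).continuous.comp continuous_toTorus).div
      (continuous_const.sub (continuous_const.mul
        ((continuous_latticeCharFun h.measurable).comp continuous_toTorus)))
      fun t => one_sub_mul_latticeCharFun_ne_zero hε hε1 _
  set cube : Set (Fin 2 → ℝ) := {x | ∀ i, x i ∈ Set.Ioc (-1 / 2 : ℝ) (-1 / 2 + 1)} with hcube
  set N : Set (Fin 2 → ℝ) := {t | stepForm P X t ≤ r} with hN
  have hNm : MeasurableSet N :=
    measurableSet_le (continuous_quadForm _ _ _).measurable measurable_const
  have hcubem : MeasurableSet cube := MeasurableSet.univ_pi' fun i => measurableSet_Ioc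
  have hcubeIcc : cube ⊆ Set.Icc (fun _ => -(1 / 2)) (fun _ => 1 / 2) := fun x hx =>
    ⟨fun i => by have := (hx i).1; simp only; linarith,
      fun i => by have := (hx i).2; simp only; linarith⟩
  have hNcube : N ⊆ cube := fun t ht i => by
    have := abs_lt.mp (hrcube t ht i)
    exact ⟨by linarith, by linarith⟩
  have hFint : IntegrableOn F cube := hFcont.integrableOn_Icc.mono_set hcubeIcc
  -- The ellipse `N` carries the logarithm, and the rest of the cube contributes at most `m⁻¹`.
  have hsplit : ∫ t in cube, F t = (∫ t in N, F t) + ∫ t in cube \ N, F t := by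
    rw [← integral_inter_add_sdiff hNm hFint, Set.inter_eq_self_of_subset_right hNcube]
  have hvol : volume cube = 1 := by
    have : cube = Set.pi Set.univ fun _ => Set.Ioc (-1 / 2 : ℝ) (-1 / 2 + 1) := by
      ext x; simp [hcube]
    rw [this, Real.volume_pi_Ioc]
    simp
  have hfarint : ‖∫ t in cube \ N, F t‖ ≤ m⁻¹ := by
    have hlt : volume (cube \ N) < ⊤ :=
      (measure_mono Set.sdiff_subset).trans_lt (by rw [hvol]; exact ENNReal.one_lt_top)
    refine (norm_setIntegral_le_of_norm_le_const (C := m⁻¹) hlt fun t ht => ?_).trans ?_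
    · have htI := hcubeIcc ht.1
      have h1 := hfar t (fun i => abs_le.mpr ⟨htI.1 i, htI.2 i⟩)
        (not_le.mp ht.2).le (1 - ε) (by linarith) (by linarith)
      rw [hF, norm_div, norm_mFourier_apply, one_div]
      exact inv_anti₀ hm h1
    · have : volume.real (cube \ N) ≤ 1 := by
        refine (measureReal_mono Set.sdiff_subset (by rw [hvol]; exact ENNReal.one_ne_top)).trans ?_
        rw [measureReal_def, hvol]; simp
      exact mul_le_of_le_one_right (by positivity) this
  have hGint : IntegrableOn (fun t => (ε + stepForm P X t)⁻¹) N :=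
    integrableOn_inv_add_quadForm hA hdet hr.le hε
  have hG : ∫ t in N, (ε + stepForm P X t)⁻¹ = κ * Real.log ((ε + r) / ε) := by
    rw [hκ, ← h.pi_div_sqrt_eq]
    exact integral_inv_add_quadForm hA hdet hr.le hε
  have hnearint : ‖(∫ t in N, F t) - ((κ * Real.log ((ε + r) / ε) : ℝ) : ℂ)‖ ≤
      6 * η' * (κ * Real.log ((ε + r) / ε)) := by
    have hGc : Integrable (fun t => (((ε + stepForm P X t)⁻¹ : ℝ) : ℂ)) (volume.restrict N) :=
      hGint.ofReal
    rw [← hG, ← integral_complex_ofReal, ← integral_sub (hFint.mono_set hNcube) hGc,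
      ← integral_const_mul]
    refine norm_integral_le_of_norm_le (hGint.const_mul _) ?_
    filter_upwards [ae_restrict_mem hNm] with t ht
    have := hnear t ht ε hε hεη
    rw [Complex.ofReal_inv]
    exact this
  have hL : 0 ≤ Real.log (1 / ε) := Real.log_nonneg (by rw [le_div_iff₀ hε]; linarith)
  have hlogsplit : Real.log ((ε + r) / ε) = Real.log (1 / ε) + Real.log (ε + r) := by
    rw [Real.log_div (by positivity) hε.ne', one_div, Real.log_inv]; ring
  have hlogb : |Real.log (ε + r)| ≤ |Real.log r| + |Real.log (1 + r)| := by
    rw [abs_le]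
    constructor
    · have h1 := Real.log_le_log hr (by linarith : r ≤ ε + r)
      have h2 := neg_abs_le (Real.log r)
      have h3 := abs_nonneg (Real.log (1 + r))
      linarith
    · have h1 := Real.log_le_log (by positivity) (by linarith : ε + r ≤ 1 + r)
      have h2 := le_abs_self (Real.log (1 + r))
      have h3 := abs_nonneg (Real.log r)
      linarith
  rw [integral_torusHaar_eq]
  change ‖(∫ t in cube, F t) - _‖ ≤ _
  rw [hsplit]
  have hdecomp : ((∫ t in N, F t) + ∫ t in cube \ N, F t) - ((κ * Real.log (1 / ε) : ℝ) : ℂ) =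
      ((∫ t in N, F t) - ((κ * Real.log ((ε + r) / ε) : ℝ) : ℂ)) +
        ((κ * Real.log (ε + r) : ℝ) : ℂ) + ∫ t in cube \ N, F t := by
    rw [hlogsplit]; push_cast; ring
  rw [hdecomp]
  refine (norm_add₃_le).trans ?_
  rw [Complex.norm_real, norm_mul, Real.norm_of_nonneg hκ0.le, Real.norm_eq_abs]
  have h7 : 6 * η' * (κ * Real.log ((ε + r) / ε)) ≤
      η * (Real.log (1 / ε) + (|Real.log r| + |Real.log (1 + r)|)) := by
    rw [hlogsplit, ← mul_assoc]
    have h8 : Real.log (1 / ε) + Real.log (ε + r) ≤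
        Real.log (1 / ε) + (|Real.log r| + |Real.log (1 + r)|) := by
      linarith [le_abs_self (Real.log (ε + r))]
    have h9 : 0 ≤ Real.log (1 / ε) + (|Real.log r| + |Real.log (1 + r)|) := by positivity
    calc 6 * η' * κ * (Real.log (1 / ε) + Real.log (ε + r))
        ≤ 6 * η' * κ * (Real.log (1 / ε) + (|Real.log r| + |Real.log (1 + r)|)) :=
          mul_le_mul_of_nonneg_left h8 (by positivity)
      _ ≤ _ := mul_le_mul_of_nonneg_right h6 h9
  have h8 : κ * |Real.log (ε + r)| ≤ κ * (|Real.log r| + |Real.log (1 + r)|) :=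
    mul_le_mul_of_nonneg_left hlogb hκ0.le
  linarith

end Resolvent

/-! ### From Abel sums to partial sums -/

section Tauberian

/-- The difference is head minus tail, and both lie in `[0, C]`. In the head, Bernoulli gives `1 -
x^k ≤ k/n`, so each of the `n` terms is at most `C/n`. In the tail the coefficients are at most
`C/n` and the geometric series sums to `n`. -/
lemma abs_sum_sub_tsum_le {a : ℕ → ℝ} {C : ℝ} (ha0 : ∀ k, 0 ≤ a k) (ha : ∀ k, a k ≤ C / (k + 1))
    {n : ℕ} (hn : 1 ≤ n) :
    |∑ k ∈ Finset.range n, a k - ∑' k, (1 - (n : ℝ)⁻¹) ^ k * a k| ≤ C := by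
  have hC : 0 ≤ C := by have := (ha0 0).trans (ha 0); simpa using this
  have hn0 : (0 : ℝ) < n := by exact_mod_cast hn
  have hn1 : (1 : ℝ) ≤ n := by exact_mod_cast hn
  set x : ℝ := 1 - (n : ℝ)⁻¹ with hx
  have hinv : (n : ℝ)⁻¹ ≤ 1 := inv_le_one_of_one_le₀ hn1
  have hx0 : 0 ≤ x := by linarith
  have hx1 : x < 1 := by have : 0 < (n : ℝ)⁻¹ := by positivity
                         linarith
  have haC : ∀ k, a k ≤ C := fun k => (ha k).trans (div_le_self hC (by simp))
  have hgeo := summable_geometric_of_lt_one hx0 hx1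
  have hsum : Summable fun k => x ^ k * a k :=
    Summable.of_nonneg_of_le (fun k => mul_nonneg (pow_nonneg hx0 k) (ha0 k))
      (fun k => mul_le_mul_of_nonneg_left (haC k) (pow_nonneg hx0 k)) (hgeo.mul_right C)
  rw [← hsum.sum_add_tsum_nat_add n, ← sub_sub, ← Finset.sum_sub_distrib]
  have h1 : 0 ≤ ∑ k ∈ Finset.range n, (a k - x ^ k * a k) :=
    Finset.sum_nonneg fun k _ => by
      nlinarith [ha0 k, pow_le_one₀ (n := k) hx0 hx1.le]
  have h2 : ∑ k ∈ Finset.range n, (a k - x ^ k * a k) ≤ C := by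
    have hk : ∀ k ∈ Finset.range n, a k - x ^ k * a k ≤ C * (n : ℝ)⁻¹ := by
      intro k _
      have hB := one_add_mul_le_pow (a := -(n : ℝ)⁻¹) (by linarith) k
      have hB' : 1 - x ^ k ≤ k * (n : ℝ)⁻¹ := by
        rw [hx, sub_eq_add_neg 1 (n : ℝ)⁻¹]; linarith
      have hka : a k * k ≤ C := by
        refine (mul_le_mul_of_nonneg_right (ha k) (Nat.cast_nonneg k)).trans ?_
        rw [div_mul_eq_mul_div]
        refine div_le_of_le_mul₀ (by positivity) hC ?_
        nlinarith
      calc a k - x ^ k * a k = a k * (1 - x ^ k) := by ring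
        _ ≤ a k * (k * (n : ℝ)⁻¹) := mul_le_mul_of_nonneg_left hB' (ha0 k)
        _ = a k * k * (n : ℝ)⁻¹ := by ring
        _ ≤ C * (n : ℝ)⁻¹ := mul_le_mul_of_nonneg_right hka (by positivity)
    refine (Finset.sum_le_sum hk).trans (le_of_eq ?_)
    rw [Finset.sum_const, Finset.card_range, nsmul_eq_mul]
    field_simp
  have hsum' : Summable fun k => x ^ (k + n) * a (k + n) :=
    (summable_nat_add_iff n).mpr hsum
  have h3 : 0 ≤ ∑' k, x ^ (k + n) * a (k + n) :=
    tsum_nonneg fun k => mul_nonneg (pow_nonneg hx0 _) (ha0 _)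
  have h4 : ∑' k, x ^ (k + n) * a (k + n) ≤ C := by
    have hk : ∀ k, x ^ (k + n) * a (k + n) ≤ x ^ k * (C * (n : ℝ)⁻¹) := by
      intro k
      refine mul_le_mul ?_ ?_ (ha0 _) (pow_nonneg hx0 _)
      · exact pow_le_pow_of_le_one hx0 hx1.le (by omega)
      · refine (ha _).trans ?_
        rw [div_eq_mul_inv]
        refine mul_le_mul_of_nonneg_left (inv_anti₀ hn0 ?_) hC
        push_cast; linarith [Nat.cast_nonneg (α := ℝ) k]
    refine (hsum'.tsum_le_tsum hk (hgeo.mul_right _)).trans (le_of_eq ?_)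
    rw [tsum_mul_right, tsum_geometric_of_lt_one hx0 hx1, hx]
    field_simp
    ring
  rw [abs_le]
  constructor <;> linarith

/-- The term `a k` occurs in `n - k` of the inner sums, hence is missing `k` times. -/
lemma mul_sum_range_sub (a : ℕ → ℝ) (n : ℕ) :
    n * ∑ k ∈ Finset.range n, a k - ∑ u ∈ Finset.range n, ∑ k ∈ Finset.range (u + 1), a k =
      ∑ k ∈ Finset.range n, k * a k := by
  induction n with
  | zero => simp
  | succ n ih =>
    rw [Finset.sum_range_succ a n, Finset.sum_range_succ (fun k => k * a k) n, ← ih,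
      Finset.sum_range_succ (fun u => ∑ k ∈ Finset.range (u + 1), a k) n,
      Finset.sum_range_succ a n]
    push_cast
    ring

lemma tendsto_of_forall_abs_sub_le {f g : ℕ → ℝ} {l : ℝ} (hg : Tendsto g atTop atTop)
    (h : ∀ η > 0, ∃ C : ℝ, ∀ᶠ n in atTop, |f n - l * g n| ≤ η * g n + C) :
    Tendsto (fun n => f n / g n) atTop (𝓝 l) := by
  rw [Metric.tendsto_nhds]
  intro ε hε
  obtain ⟨C, hC⟩ := h (ε / 2) (by positivity)
  filter_upwards [hC, hg.eventually_gt_atTop (max 0 (2 * C / ε))] with n hn hgn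
  have hg0 : 0 < g n := (le_max_left _ _).trans_lt hgn
  have hg1 : 2 * C / ε < g n := (le_max_right _ _).trans_lt hgn
  rw [Real.dist_eq]
  have h1 : f n / g n - l = (f n - l * g n) / g n := by field_simp
  rw [h1, abs_div, abs_of_pos hg0, div_lt_iff₀ hg0]
  rw [div_lt_iff₀ hε] at hg1
  linarith

end Tauberian

/-! ### Growth of the Green function and of the mean count -/

section Green

variable {Ω : Type*} [MeasurableSpace Ω] {P : Measure Ω} [IsProbabilityMeasure P]
  {ζ : ℕ → Ω → Lattice2}

/-- The probability `P(Z_k = q)`, in the Fourier representation. -/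
def hitProb (P : Measure Ω) (X : Ω → Lattice2) (k : ℕ) (q : Lattice2) : ℝ :=
  (∫ t, mFourier (-q) t * latticeCharFun P X t ^ k ∂torusHaar).re

lemma IsIIDSteps.prob_increment (h : IsIIDSteps P ζ) (u k : ℕ) (q : Lattice2) :
    P.real {ω | increment (fun i => ζ i ω) u (u + k) = q} = hitProb P (ζ 0) k q := by
  rw [hitProb, ← h.prob_increment_eq u k q, Complex.ofReal_re]

lemma IsIIDSteps.hitProb_nonneg (h : IsIIDSteps P ζ) (k : ℕ) (q : Lattice2) :
    0 ≤ hitProb P (ζ 0) k q := by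
  rw [← h.prob_increment 0]; exact measureReal_nonneg

lemma IsIIDSteps.exists_hitProb_le (h : IsIIDSteps P ζ) (hX : IsCenteredAperiodic P (ζ 0)) :
    ∃ C : ℝ, 0 < C ∧ ∀ k q, hitProb P (ζ 0) k q ≤ C / (k + 1) := by
  obtain ⟨C, hC, hb⟩ := exists_integral_norm_latticeCharFun_pow_le hX.measurable
    (integrable_coord hX.measurable hX.moment) hX.centered hX.aperiodic
  refine ⟨C, hC, fun k q => ?_⟩
  rw [← h.prob_increment 0]
  exact (h.prob_increment_le 0 k q).trans (hb k)

/-- Inversion term by term, then a geometric series under the integral; the norms are dominated by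
`(1-ε)^k`. -/
lemma IsIIDSteps.tsum_hitProb (h : IsIIDSteps P ζ) (p : Lattice2) {ε : ℝ} (hε : 0 < ε)
    (hε1 : ε ≤ 1) :
    ((∑' k, (1 - ε) ^ k * hitProb P (ζ 0) k p : ℝ) : ℂ) =
      ∫ t, mFourier (-p) t / (1 - (1 - ε : ℝ) * latticeCharFun P (ζ 0) t) ∂torusHaar := by
  set Φ := latticeCharFun P (ζ 0) with hΦ
  have hΦc : Continuous Φ := continuous_latticeCharFun (h.measurable 0)
  set x : ℝ := 1 - ε with hx
  have hx0 : 0 ≤ x := by linarith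
  have hx1 : x < 1 := by linarith
  set F : ℕ → Torus2 → ℂ := fun k t => (x : ℂ) ^ k * (mFourier (-p) t * Φ t ^ k) with hF
  have hFc : ∀ k, Continuous (F k) := fun k =>
    continuous_const.mul ((mFourier (-p)).continuous.mul (hΦc.pow k))
  have hFn : ∀ k t, ‖F k t‖ ≤ x ^ k := by
    intro k t
    rw [hF, norm_mul, norm_mul, norm_pow, norm_pow, norm_mFourier_apply, one_mul,
      Complex.norm_real, Real.norm_of_nonneg hx0]
    exact mul_le_of_le_one_right (pow_nonneg hx0 k)
      (pow_le_one₀ (norm_nonneg _) (norm_latticeCharFun_le _ _))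
  have hsum : HasSum (fun k => ∫ t, F k t ∂torusHaar) (∫ t, ∑' k, F k t ∂torusHaar) := by
    refine hasSum_integral_of_summable_integral_norm
      (fun k => integrable_of_continuous_torusHaar (hFc k)) ?_
    refine Summable.of_nonneg_of_le (fun k => integral_nonneg fun t => norm_nonneg _)
      (fun k => ?_) (summable_geometric_of_lt_one hx0 hx1)
    refine (integral_mono ?_ (integrable_const (x ^ k)) (hFn k)).trans (by simp)
    exact (integrable_of_continuous_torusHaar (hFc k)).norm
  have hpt : ∀ t, ∑' k, F k t = mFourier (-p) t / (1 - (x : ℂ) * Φ t) := by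
    intro t
    have h1 : ∀ k, F k t = mFourier (-p) t * ((x : ℂ) * Φ t) ^ k := fun k => by
      rw [hF]; ring
    simp_rw [h1]
    rw [tsum_mul_left, tsum_geometric_of_norm_lt_one, div_eq_mul_inv]
    rw [norm_mul, Complex.norm_real, Real.norm_of_nonneg hx0]
    exact (mul_le_of_le_one_right hx0 (norm_latticeCharFun_le _ _)).trans_lt hx1
  have hcoef : ∀ k, ∫ t, F k t ∂torusHaar = ((x ^ k * hitProb P (ζ 0) k p : ℝ) : ℂ) := by
    intro k
    rw [hF, integral_const_mul, ← h.prob_increment 0, Complex.ofReal_mul, h.prob_increment_eq]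
    push_cast; rfl
  simp_rw [hpt] at hsum
  rw [← hsum.tsum_eq, Complex.ofReal_tsum]
  simp_rw [hcoef]

/-- The sums `∑_{k<n} P(Z_k = p)` grow like `log n / (2π √(det Σ))`. -/
lemma IsIIDSteps.tendsto_green (h : IsIIDSteps P ζ) (hX : IsCenteredAperiodic P (ζ 0))
    (p : Lattice2) :
    Tendsto (fun n : ℕ => (∑ k ∈ Finset.range n, hitProb P (ζ 0) k p) / Real.log n) atTop
      (𝓝 (greenConst P (ζ 0))) := by
  obtain ⟨C, hC, hb⟩ := h.exists_hitProb_le hX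
  refine tendsto_of_forall_abs_sub_le (Real.tendsto_log_atTop.comp tendsto_natCast_atTop_atTop)
    fun η hη => ?_
  obtain ⟨C', ε₀, hε₀, hε₀1, hres⟩ := hX.resolvent_asymptotics p hη
  refine ⟨C + C', ?_⟩
  have hev : ∀ᶠ n : ℕ in atTop, (n : ℝ)⁻¹ < ε₀ :=
    (tendsto_inv_atTop_zero.comp tendsto_natCast_atTop_atTop).eventually_lt_const hε₀
  filter_upwards [hev, eventually_ge_atTop 1] with n hn hn1
  have hn0 : (0 : ℝ) < n := by exact_mod_cast hn1
  have h1 := abs_sum_sub_tsum_le (fun k => h.hitProb_nonneg k p) (fun k => hb k p) hn1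
  -- The choice `ε = 1/n` turns `log(1/ε)` into `log n`.
  have h2 := hres (n : ℝ)⁻¹ (by positivity) hn.le
  rw [← h.tsum_hitProb p (by positivity) (hn.le.trans hε₀1.le), ← Complex.ofReal_sub,
    Complex.norm_real, Real.norm_eq_abs, one_div, inv_inv] at h2
  have h3 := abs_sub_le (∑ k ∈ Finset.range n, hitProb P (ζ 0) k p)
    (∑' k, (1 - (n : ℝ)⁻¹) ^ k * hitProb P (ζ 0) k p) (greenConst P (ζ 0) * Real.log n)
  linarith

/-- The expected number of pairs in a time interval of length `n` with difference `p`. -/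
def meanCount (P : Measure Ω) (X : Ω → Lattice2) (n : ℕ) (p : Lattice2) : ℝ :=
  ∑ u ∈ Finset.range n, (∑ k ∈ Finset.range (u + 1), hitProb P X k p +
    ∑ k ∈ Finset.range (u + 1), hitProb P X k (-p) - hitProb P X 0 (-p))

/-- Summing the Green function over `u < n` costs, compared with `n` times its last value, only `∑ k
P(Z_k = p) ≤ Cn`, which is `o(n log n)`. The frequencies `p` and `-p` contribute equally, whence the
factor 2. -/
lemma IsIIDSteps.tendsto_meanCount (h : IsIIDSteps P ζ) (hX : IsCenteredAperiodic P (ζ 0))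
    (p : Lattice2) :
    Tendsto (fun n : ℕ => meanCount P (ζ 0) n p / (n * Real.log n)) atTop
      (𝓝 (2 * greenConst P (ζ 0))) := by
  obtain ⟨C, hC, hb⟩ := h.exists_hitProb_le hX
  have hlog : Tendsto (fun n : ℕ => Real.log n) atTop atTop :=
    Real.tendsto_log_atTop.comp tendsto_natCast_atTop_atTop
  have hlog0 : ∀ᶠ n : ℕ in atTop, 0 < Real.log n := hlog.eventually_gt_atTop 0
  have hinv : Tendsto (fun n : ℕ => C / Real.log n) atTop (𝓝 0) := hlog.const_div_atTop C
  have key : ∀ p, Tendsto (fun n : ℕ => (∑ u ∈ Finset.range n, ∑ k ∈ Finset.range (u + 1),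
      hitProb P (ζ 0) k p) / (n * Real.log n)) atTop (𝓝 (greenConst P (ζ 0))) := by
    intro p
    have h1 : Tendsto (fun n : ℕ => (∑ k ∈ Finset.range n, k * hitProb P (ζ 0) k p) /
        (n * Real.log n)) atTop (𝓝 0) := by
      refine squeeze_zero' ?_ ?_ hinv
      · filter_upwards [hlog0] with n hn
        exact div_nonneg (Finset.sum_nonneg fun k _ => mul_nonneg (Nat.cast_nonneg _)
          (h.hitProb_nonneg k p)) (by positivity)
      · filter_upwards [hlog0, eventually_ge_atTop 1] with n hn hn1
        have hn0 : (0 : ℝ) < n := by exact_mod_cast hn1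
        have h2 : ∑ k ∈ Finset.range n, k * hitProb P (ζ 0) k p ≤ n * C := by
          refine (Finset.sum_le_sum (g := fun _ => C) fun k _ => ?_).trans (by simp)
          refine (mul_le_mul_of_nonneg_left (hb k p) (Nat.cast_nonneg k)).trans ?_
          rw [← mul_div_assoc]
          exact div_le_of_le_mul₀ (by positivity) hC.le (by nlinarith)
        rw [div_le_div_iff₀ (by positivity) hn]
        nlinarith
    have h3 := (h.tendsto_green hX p).sub h1
    rw [sub_zero] at h3
    refine h3.congr' ?_
    filter_upwards [hlog0, eventually_ge_atTop 1] with n hn hn1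
    have hn0 : (0 : ℝ) < n := by exact_mod_cast hn1
    rw [← mul_sum_range_sub]
    field_simp
    ring
  have hconst : Tendsto (fun n : ℕ => hitProb P (ζ 0) 0 (-p) / Real.log n) atTop (𝓝 0) :=
    hlog.const_div_atTop _
  have h4 := ((key p).add (key (-p))).sub hconst
  rw [sub_zero, ← two_mul] at h4
  refine h4.congr' ?_
  filter_upwards [hlog0, eventually_ge_atTop 1] with n hn hn1
  have hn0 : (0 : ℝ) < n := by exact_mod_cast hn1
  rw [meanCount, Finset.sum_sub_distrib, Finset.sum_add_distrib, Finset.sum_const,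
    Finset.card_range, nsmul_eq_mul]
  field_simp

end Green

/-! ### Counts in a block and across a cut -/

section Counting

lemma crossCount_eq_sum (z : ℕ → Lattice2) (I J : Finset ℕ) (p : Lattice2) :
    (crossCount z I J p : ℝ) =
      ∑ u ∈ I, ∑ v ∈ J, if walk z u - walk z v = p then (1 : ℝ) else 0 := by
  rw [crossCount, Finset.card_filter, ← Finset.sum_product']
  push_cast
  rfl

lemma crossCount_mono (z : ℕ → Lattice2) {I I' J J' : Finset ℕ} (hI : I ⊆ I') (hJ : J ⊆ J')
    (p : Lattice2) : crossCount z I J p ≤ crossCount z I' J' p :=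
  Finset.card_le_card (Finset.filter_subset_filter _ (Finset.product_subset_product hI hJ))

lemma walk_sub_walk_eq_iff (z : ℕ → Lattice2) {u v : ℕ} (h : u ≤ v) (p : Lattice2) :
    walk z u - walk z v = p ↔ increment z u v = -p := by
  rw [← walk_sub_walk z h, ← neg_sub, neg_eq_iff_eq_neg]

/-- The number of pairs `u ∈ [x, m)`, `v ∈ [m, y)` with `Z_v - Z_u = q`. -/
def bridgeCount (z : ℕ → Lattice2) (x m y : ℕ) (q : Lattice2) : ℝ :=
  ∑ u ∈ Finset.Ico x m, ∑ v ∈ Finset.Ico m y, if increment z u v = q then (1 : ℝ) else 0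

/-- The number of pairs `u, v ∈ [x, y)` with `Z_u - Z_v = p`. -/
def blockCount (z : ℕ → Lattice2) (x y : ℕ) (p : Lattice2) : ℝ :=
  crossCount z (Finset.Ico x y) (Finset.Ico x y) p

lemma crossCount_Ico_left (z : ℕ → Lattice2) (x m y : ℕ) (p : Lattice2) :
    (crossCount z (Finset.Ico x m) (Finset.Ico m y) p : ℝ) = bridgeCount z x m y (-p) := by
  rw [crossCount_eq_sum, bridgeCount]
  refine Finset.sum_congr rfl fun u hu => Finset.sum_congr rfl fun v hv => ?_
  rw [Finset.mem_Ico] at hu hv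
  simp_rw [walk_sub_walk_eq_iff z (show u ≤ v by omega)]

lemma crossCount_Ico_right (z : ℕ → Lattice2) (x m y : ℕ) (p : Lattice2) :
    (crossCount z (Finset.Ico m y) (Finset.Ico x m) p : ℝ) = bridgeCount z x m y p := by
  rw [crossCount_eq_sum, bridgeCount, Finset.sum_comm]
  refine Finset.sum_congr rfl fun u hu => Finset.sum_congr rfl fun v hv => ?_
  rw [Finset.mem_Ico] at hu hv
  rw [walk_sub_walk z (show u ≤ v by omega)]

lemma blockCount_split (z : ℕ → Lattice2) {x m y : ℕ} (hxm : x ≤ m) (hmy : m ≤ y) (p : Lattice2) :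
    blockCount z x y p = blockCount z x m p + blockCount z m y p +
      (bridgeCount z x m y p + bridgeCount z x m y (-p)) := by
  rw [← crossCount_Ico_left, ← crossCount_Ico_right]
  simp only [blockCount, crossCount_eq_sum]
  rw [← Finset.sum_Ico_consecutive _ hxm hmy]
  have h : ∀ u, ∑ v ∈ Finset.Ico x y, (if walk z u - walk z v = p then (1 : ℝ) else 0) =
      ∑ v ∈ Finset.Ico x m, (if walk z u - walk z v = p then (1 : ℝ) else 0) +
      ∑ v ∈ Finset.Ico m y, (if walk z u - walk z v = p then (1 : ℝ) else 0) :=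
    fun u => (Finset.sum_Ico_consecutive _ hxm hmy).symm
  simp_rw [h, Finset.sum_add_distrib]
  ring

/-- Both times are indexed by their distance to the cut, the left one running backwards from `m -
1`. -/
lemma bridgeCount_eq_sum_range (z : ℕ → Lattice2) {m r : ℕ} (hr : r ≤ m) (s : ℕ) (q : Lattice2) :
    bridgeCount z (m - r) m (m + s) q = ∑ i ∈ Finset.range r, ∑ j ∈ Finset.range s,
      if increment z (m - 1 - i) (m + j) = q then (1 : ℝ) else 0 := by
  have h1 : ∀ f : ℕ → ℝ, ∑ u ∈ Finset.Ico (m - r) m, f u =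
      ∑ i ∈ Finset.range r, f (m - 1 - i) := by
    intro f
    rw [Finset.sum_Ico_eq_sum_range, show m - (m - r) = r by omega,
      ← Finset.sum_range_reflect]
    refine Finset.sum_congr rfl fun i hi => ?_
    rw [Finset.mem_range] at hi
    congr 1
    omega
  rw [bridgeCount, h1]
  refine Finset.sum_congr rfl fun i _ => ?_
  rw [Finset.sum_Ico_eq_sum_range, show m + s - m = s by omega]

end Counting

/-! ### Square root weights -/

section Weights

/-- The weight `(k+1)^{-1/2}`. -/
def sqrtWeight (k : ℕ) : ℝ := (√((k : ℝ) + 1))⁻¹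

lemma sqrtWeight_nonneg (k : ℕ) : 0 ≤ sqrtWeight k := by unfold sqrtWeight; positivity

lemma sqrtWeight_sq (k : ℕ) : sqrtWeight k ^ 2 = ((k : ℝ) + 1)⁻¹ := by
  rw [sqrtWeight, inv_pow, Real.sq_sqrt (by positivity)]

/-- The minimum is at most the geometric mean. This trades a bound depending on both lengths for a
product, so that the later sums factor. -/
lemma min_inv_le_sqrtWeight_mul {x : ℝ} {i j : ℕ} (hx : 0 ≤ x) (hi : x ≤ ((i : ℝ) + 1)⁻¹)
    (hj : x ≤ ((j : ℝ) + 1)⁻¹) : x ≤ sqrtWeight i * sqrtWeight j := by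
  refine (pow_le_pow_iff_left₀ hx (mul_nonneg (sqrtWeight_nonneg i) (sqrtWeight_nonneg j))
    two_ne_zero).mp ?_
  rw [mul_pow, sqrtWeight_sq, sqrtWeight_sq, sq]
  exact mul_le_mul hi hj hx (by positivity)

lemma sum_sqrtWeight_le (n : ℕ) : ∑ k ∈ Finset.range n, sqrtWeight k ≤ 2 * √n := by
  induction n with
  | zero => simp
  | succ n ih =>
    rw [Finset.sum_range_succ]
    have h1 : sqrtWeight n ≤ 2 * (√((n : ℝ) + 1) - √n) := by
      have h2 : √((n : ℝ) + 1) ^ 2 = n + 1 := Real.sq_sqrt (by positivity)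
      have h3 : √(n : ℝ) ^ 2 = n := Real.sq_sqrt (by positivity)
      have h4 : √(n : ℝ) ≤ √((n : ℝ) + 1) := Real.sqrt_le_sqrt (by linarith)
      have h5 : 0 < √((n : ℝ) + 1) := Real.sqrt_pos.mpr (by positivity)
      rw [sqrtWeight, inv_le_iff_one_le_mul₀ h5]
      nlinarith [sq_nonneg (√((n : ℝ) + 1) - √n)]
    push_cast
    linarith

/-- The double sum that controls one side of a pair of bridges. -/
def pairWeight (n : ℕ) : ℝ := ∑ i ∈ Finset.range n, ∑ j ∈ Finset.range n,
  sqrtWeight (max i j - min i j) * sqrtWeight (min i j)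

/-- On `i ≤ j` the summand is `w(i) w(j - i)`, with `w` the weight `sqrtWeight`: a convolution,
bounded by `(∑ w)² ≤ 4n`. The other half is symmetric, and counting the diagonal twice is harmless.
-/
lemma pairWeight_le (n : ℕ) : pairWeight n ≤ 8 * n := by
  have hw := sqrtWeight_nonneg
  have hS0 : 0 ≤ ∑ k ∈ Finset.range n, sqrtWeight k := Finset.sum_nonneg fun k _ => hw k
  have hpt : ∀ i j : ℕ, sqrtWeight (max i j - min i j) * sqrtWeight (min i j) ≤
      (if i ≤ j then sqrtWeight i * sqrtWeight (j - i) else 0) +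
      (if j ≤ i then sqrtWeight j * sqrtWeight (i - j) else 0) := by
    intro i j
    rcases le_total i j with h | h
    · rw [max_eq_right h, min_eq_left h, if_pos h, mul_comm]
      refine le_add_of_nonneg_right ?_
      split_ifs
      · exact mul_nonneg (hw _) (hw _)
      · exact le_rfl
    · rw [max_eq_left h, min_eq_right h, if_pos h, mul_comm]
      refine le_add_of_nonneg_left ?_
      split_ifs
      · exact mul_nonneg (hw _) (hw _)
      · exact le_rfl
  have hhalf : ∑ i ∈ Finset.range n, ∑ j ∈ Finset.range n,
      (if i ≤ j then sqrtWeight i * sqrtWeight (j - i) else 0) ≤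
      (∑ k ∈ Finset.range n, sqrtWeight k) ^ 2 := by
    rw [sq, Finset.sum_mul]
    refine Finset.sum_le_sum fun i hi => ?_
    rw [← Finset.sum_filter, ← Finset.mul_sum]
    refine mul_le_mul_of_nonneg_left ?_ (hw i)
    have hf : (Finset.range n).filter (fun j => i ≤ j) = Finset.Ico i n := by
      ext j; simp only [Finset.mem_filter, Finset.mem_range, Finset.mem_Ico]; tauto
    rw [hf, Finset.sum_Ico_eq_sum_range]
    simp only [Nat.add_sub_cancel_left]
    exact Finset.sum_le_sum_of_subset_of_nonneg
      (Finset.range_subset_range.mpr (Nat.sub_le n i)) fun k _ _ => hw k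
  have hS : (∑ k ∈ Finset.range n, sqrtWeight k) ^ 2 ≤ 4 * n := by
    refine (pow_le_pow_left₀ hS0 (sum_sqrtWeight_le n) 2).trans (le_of_eq ?_)
    rw [mul_pow, Real.sq_sqrt (Nat.cast_nonneg n)]; norm_num
  calc pairWeight n ≤ ∑ i ∈ Finset.range n, ∑ j ∈ Finset.range n,
        ((if i ≤ j then sqrtWeight i * sqrtWeight (j - i) else 0) +
        (if j ≤ i then sqrtWeight j * sqrtWeight (i - j) else 0)) :=
        Finset.sum_le_sum fun i _ => Finset.sum_le_sum fun j _ => hpt i j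
    _ = (∑ i ∈ Finset.range n, ∑ j ∈ Finset.range n,
          (if i ≤ j then sqrtWeight i * sqrtWeight (j - i) else 0)) +
        ∑ i ∈ Finset.range n, ∑ j ∈ Finset.range n,
          (if i ≤ j then sqrtWeight i * sqrtWeight (j - i) else 0) := by
        simp_rw [Finset.sum_add_distrib]
        congr 1
        exact Finset.sum_comm
    _ ≤ 8 * n := by linarith

end Weights

/-! ### Second moment of the count across a cut -/

section SecondMoment

variable {Ω : Type*} [MeasurableSpace Ω] {P : Measure Ω} [IsProbabilityMeasure P]
  {ζ : ℕ → Ω → Lattice2}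

/-- Conditionally on `Y`, the independent variable `X` must hit one prescribed point. -/
lemma prob_eq_comp_le {β : Type*} [MeasurableSpace β] [Countable β] [MeasurableSingletonClass β]
    {X : Ω → Lattice2} {Y : Ω → β} (hX : Measurable X) (hY : Measurable Y) (hXY : IndepFun X Y P)
    {s : ℝ} (hs : ∀ l, P.real {ω | X ω = l} ≤ s) (f : β → Lattice2) (D : Set β) :
    P.real {ω | X ω = f (Y ω) ∧ Y ω ∈ D} ≤ s * P.real {ω | Y ω ∈ D} := by
  have hs0 : 0 ≤ s := measureReal_nonneg.trans (hs 0)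
  have hmap := (indepFun_iff_map_prod_eq_prod_map_map hX.aemeasurable hY.aemeasurable).mp hXY
  have hPX : IsProbabilityMeasure (P.map X) := Measure.isProbabilityMeasure_map hX.aemeasurable
  have hPY : IsProbabilityMeasure (P.map Y) := Measure.isProbabilityMeasure_map hY.aemeasurable
  set S : Set (Lattice2 × β) := {z | z.1 = f z.2 ∧ z.2 ∈ D} with hS
  have hSm : MeasurableSet S := S.to_countable.measurableSet
  have hDm : MeasurableSet D := D.to_countable.measurableSet
  have h1 : P {ω | X ω = f (Y ω) ∧ Y ω ∈ D} = ∫⁻ y, P.map X ((fun x => (x, y)) ⁻¹' S) ∂P.map Y := by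
    rw [← Measure.prod_apply_symm hSm, ← hmap, Measure.map_apply (hX.prodMk hY) hSm]
    rfl
  have h2 : ∀ y, P.map X ((fun x => (x, y)) ⁻¹' S) ≤ D.indicator (fun _ => ENNReal.ofReal s) y := by
    intro y
    by_cases hy : y ∈ D
    · rw [Set.indicator_of_mem hy]
      have : (fun x => (x, y)) ⁻¹' S = {f y} := by
        ext x; simp [hS, hy]
      rw [this, Measure.map_apply hX (measurableSet_singleton _)]
      exact (ENNReal.le_ofReal_iff_toReal_le (measure_ne_top _ _) hs0).mpr (hs (f y))
    · rw [Set.indicator_of_notMem hy]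
      have : (fun x => (x, y)) ⁻¹' S = ∅ := by
        ext x; simp [hS, hy]
      rw [this, measure_empty]
  have h3 : P {ω | X ω = f (Y ω) ∧ Y ω ∈ D} ≤ ENNReal.ofReal s * P {ω | Y ω ∈ D} := by
    rw [h1]
    refine (lintegral_mono h2).trans (le_of_eq ?_)
    rw [lintegral_indicator_const hDm, Measure.map_apply hY hDm]
    rfl
  have h4 := ENNReal.toReal_mono (ENNReal.mul_ne_top ENNReal.ofReal_ne_top (measure_ne_top _ _)) h3
  rwa [ENNReal.toReal_mul, ENNReal.toReal_ofReal hs0] at h4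

lemma IsIIDSteps.indepFun_increment (h : IsIIDSteps P ζ) {u₀ u₁ v₀ v₁ : ℕ} (h2 : u₁ ≤ v₀) :
    IndepFun (fun ω => increment (fun i => ζ i ω) u₀ u₁)
      (fun ω => increment (fun i => ζ i ω) v₀ v₁) P :=
  indepFun_of_measurable_of_indep
    (h.indep_iSup (S := {i | i < u₁}) (T := {i | v₀ ≤ i})
      (Set.disjoint_left.mpr fun i (hi : i < u₁) (hi' : v₀ ≤ i) => by omega))
    (measurable_increment_iSup _ fun i _ hi => hi) (measurable_increment_iSup _ fun i hi _ => hi)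

lemma IsIIDSteps.indepFun_increment_middle (h : IsIIDSteps P ζ) {u₀ u₁ v₀ v₁ : ℕ} :
    IndepFun (fun ω => increment (fun i => ζ i ω) u₁ v₀)
      (fun ω => (increment (fun i => ζ i ω) u₀ u₁, increment (fun i => ζ i ω) v₀ v₁)) P :=
  indepFun_of_measurable_of_indep
    (h.indep_iSup (S := {i | u₁ ≤ i ∧ i < v₀}) (T := {i | i < u₁ ∨ v₀ ≤ i})
      (Set.disjoint_left.mpr fun i (hi : u₁ ≤ i ∧ i < v₀) (hi' : i < u₁ ∨ v₀ ≤ i) => by omega))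
    (measurable_increment_iSup _ fun i hi hi' => ⟨hi, hi'⟩)
    ((measurable_increment_iSup _ fun i _ hi => Or.inl hi).prodMk
      (measurable_increment_iSup _ fun i hi _ => Or.inr hi))

lemma IsIIDSteps.prob_increment_le_of_le (h : IsIIDSteps P ζ) {K : ℝ}
    (hK : ∀ k q, hitProb P (ζ 0) k q ≤ K / (k + 1)) {u v : ℕ} (huv : u ≤ v) (q : Lattice2) :
    P.real {ω | increment (fun i => ζ i ω) u v = q} ≤ K / ((v - u : ℕ) + 1) := by
  have := h.prob_increment u (v - u) q
  rw [show u + (v - u) = v by omega] at this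
  rw [this]
  exact hK _ _

/-- The middle increment is prescribed by the outer two, which are independent of it. As `σ` is an
involution, the outer relation prescribes either outer increment from the other; both bounds hold,
and their geometric mean is kept. -/
lemma IsIIDSteps.prob_three_increments_le (h : IsIIDSteps P ζ) {K : ℝ} (hK0 : 0 < K)
    (hK : ∀ k q, hitProb P (ζ 0) k q ≤ K / (k + 1)) {u₀ u₁ v₀ v₁ : ℕ} (h0 : u₀ ≤ u₁)
    (h1 : u₁ ≤ v₀) (h2 : v₀ ≤ v₁) {σ : Lattice2 → Lattice2} (hσ : ∀ l, σ (σ l) = l)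
    (f : Lattice2 × Lattice2 → Lattice2) :
    P.real {ω | increment (fun i => ζ i ω) u₁ v₀ =
        f (increment (fun i => ζ i ω) u₀ u₁, increment (fun i => ζ i ω) v₀ v₁) ∧
        increment (fun i => ζ i ω) u₀ u₁ = σ (increment (fun i => ζ i ω) v₀ v₁)} ≤
      K / ((v₀ - u₁ : ℕ) + 1) * (K * (sqrtWeight (u₁ - u₀) * sqrtWeight (v₁ - v₀))) := by
  have hA := h.measurable_increment u₀ u₁
  have hC := h.measurable_increment v₀ v₁
  have hstep := prob_eq_comp_le (h.measurable_increment u₁ v₀) (hA.prodMk hC)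
    h.indepFun_increment_middle (h.prob_increment_le_of_le hK h1) f {z | z.1 = σ z.2}
  refine hstep.trans (mul_le_mul_of_nonneg_left ?_ (by positivity))
  have hind := h.indepFun_increment (u₀ := u₀) (v₁ := v₁) h1
  have e1 : P.real {ω | increment (fun i => ζ i ω) u₀ u₁ = σ (increment (fun i => ζ i ω) v₀ v₁)} ≤
      K / ((u₁ - u₀ : ℕ) + 1) := by
    simpa using prob_eq_comp_le hA hC hind (h.prob_increment_le_of_le hK h0) σ Set.univ
  have e2 : P.real {ω | increment (fun i => ζ i ω) u₀ u₁ = σ (increment (fun i => ζ i ω) v₀ v₁)} ≤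
      K / ((v₁ - v₀ : ℕ) + 1) := by
    have h3 : {ω | increment (fun i => ζ i ω) u₀ u₁ = σ (increment (fun i => ζ i ω) v₀ v₁)} =
        {ω | increment (fun i => ζ i ω) v₀ v₁ = σ (increment (fun i => ζ i ω) u₀ u₁)} := by
      ext ω
      constructor
      · intro (hω : _ = _); change _ = _; rw [hω, hσ]
      · intro (hω : _ = _); change _ = _; rw [hω, hσ]
    rw [h3]
    simpa using prob_eq_comp_le hC hA hind.symm (h.prob_increment_le_of_le hK h2) σ Set.univ
  change P.real {ω | increment (fun i => ζ i ω) u₀ u₁ =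
    σ (increment (fun i => ζ i ω) v₀ v₁)} ≤ _
  rw [mul_comm K, ← div_le_iff₀ hK0]
  refine min_inv_le_sqrtWeight_mul (div_nonneg measureReal_nonneg hK0.le) ?_ ?_
  · rw [div_le_iff₀ hK0]; exact e1.trans (le_of_eq (by ring))
  · rw [div_le_iff₀ hK0]; exact e2.trans (le_of_eq (by ring))

/-- Cut at the four times. If the intervals interlace (`v ≤ v'`), equality of the two sums makes the
outer increments equal. If they are nested (`v' ≤ v`), the outer increments are opposite. -/
lemma IsIIDSteps.prob_two_bridges_le_of_le (h : IsIIDSteps P ζ) {K : ℝ} (hK0 : 0 < K)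
    (hK : ∀ k q, hitProb P (ζ 0) k q ≤ K / (k + 1)) {u u' v v' : ℕ} (huu : u ≤ u')
    (hv : u' ≤ v) (hv' : u' ≤ v') (q : Lattice2) :
    P.real {ω | increment (fun i => ζ i ω) u v = q ∧ increment (fun i => ζ i ω) u' v' = q} ≤
      K / ((min v v' - u' : ℕ) + 1) *
        (K * (sqrtWeight (u' - u) * sqrtWeight (max v v' - min v v'))) := by
  rcases le_total v v' with hvv | hvv
  · rw [min_eq_left hvv, max_eq_right hvv]
    refine le_trans (measureReal_mono ?_) (h.prob_three_increments_le hK0 hK huu hv hvv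
      (σ := id) (fun _ => rfl) fun z => q - z.1)
    rintro ω ⟨e1, e2⟩
    rw [← increment_add _ huu hv] at e1
    rw [← increment_add _ hv hvv] at e2
    refine ⟨eq_sub_of_add_eq' e1, ?_⟩
    have e3 := e1.trans e2.symm
    rw [add_comm] at e3
    exact add_left_cancel e3
  · rw [min_eq_right hvv, max_eq_left hvv]
    refine le_trans (measureReal_mono ?_) (h.prob_three_increments_le hK0 hK huu hv' hvv
      (σ := Neg.neg) neg_neg fun _ => q)
    rintro ω ⟨e1, e2⟩
    refine ⟨e2, ?_⟩
    rw [← increment_add _ huu hv, ← increment_add _ hv' hvv, e2] at e1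
    rw [eq_neg_iff_add_eq_zero]
    have e3 : (increment (fun i => ζ i ω) u u' + increment (fun i => ζ i ω) v' v) + q = 0 + q := by
      rw [zero_add]; nth_rewrite 2 [← e1]; abel
    exact add_right_cancel e3

/-- The form of the bound is chosen to be a product of a function of the left distances and a
function of the right distances. -/
lemma IsIIDSteps.prob_two_bridges_le (h : IsIIDSteps P ζ) {K : ℝ} (hK0 : 0 < K)
    (hK : ∀ k q, hitProb P (ζ 0) k q ≤ K / (k + 1)) {m i i' : ℕ} (hi : i < m) (hi' : i' < m)
    (j j' : ℕ) (q : Lattice2) :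
    P.real {ω | increment (fun i => ζ i ω) (m - 1 - i) (m + j) = q ∧
        increment (fun i => ζ i ω) (m - 1 - i') (m + j') = q} ≤
      K ^ 2 * ((sqrtWeight (max i i' - min i i') * sqrtWeight (min i i')) *
        (sqrtWeight (max j j' - min j j') * sqrtWeight (min j j'))) := by
  wlog hii : i' ≤ i generalizing i i' j j'
  · have := this hi' hi j' j (le_of_not_ge hii)
    rw [max_comm i' i, min_comm i' i, max_comm j' j, min_comm j' j] at this
    refine le_trans (le_of_eq ?_) this
    congr 1
    ext ω
    exact and_comm
  refine (h.prob_two_bridges_le_of_le hK0 hK (show m - 1 - i ≤ m - 1 - i' by omega)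
    (by omega) (by omega) q).trans ?_
  rw [max_eq_left hii, min_eq_right hii]
  have e1 : m - 1 - i' - (m - 1 - i) = i - i' := by omega
  have e2 : max (m + j) (m + j') - min (m + j) (m + j') = max j j' - min j j' := by omega
  have e3 : min (m + j) (m + j') - (m - 1 - i') = min j j' + i' + 1 := by omega
  rw [e1, e2, e3]
  -- The middle increment crosses the cut, so it is longer than its part on either side, and the
  -- geometric mean separates the sides.
  have h3 : ((min j j' + i' + 1 : ℕ) + 1 : ℝ)⁻¹ ≤ sqrtWeight i' * sqrtWeight (min j j') := by
    refine min_inv_le_sqrtWeight_mul (by positivity) ?_ ?_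
    · refine inv_anti₀ (by positivity) ?_
      exact_mod_cast (by omega : i' + 1 ≤ min j j' + i' + 1 + 1)
    · refine inv_anti₀ (by positivity) ?_
      exact_mod_cast (by omega : min j j' + 1 ≤ min j j' + i' + 1 + 1)
  have hw := sqrtWeight_nonneg
  calc K / ((min j j' + i' + 1 : ℕ) + 1) *
        (K * (sqrtWeight (i - i') * sqrtWeight (max j j' - min j j')))
      = ((min j j' + i' + 1 : ℕ) + 1 : ℝ)⁻¹ *
        (K ^ 2 * (sqrtWeight (i - i') * sqrtWeight (max j j' - min j j'))) := by ring
    _ ≤ (sqrtWeight i' * sqrtWeight (min j j')) *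
        (K ^ 2 * (sqrtWeight (i - i') * sqrtWeight (max j j' - min j j'))) :=
        mul_le_mul_of_nonneg_right h3
          (mul_nonneg (sq_nonneg K) (mul_nonneg (hw _) (hw _)))
    _ = _ := by ring

lemma integral_ite_eq {S : Ω → Prop} [DecidablePred S] (hS : MeasurableSet {ω | S ω}) :
    ∫ ω, (if S ω then (1 : ℝ) else 0) ∂P = P.real {ω | S ω} := by
  rw [← integral_indicator_one hS]
  congr 1 with ω
  simp [Set.indicator]

lemma integrable_ite {S : Ω → Prop} [DecidablePred S] (hS : MeasurableSet {ω | S ω}) :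
    Integrable (fun ω => if S ω then (1 : ℝ) else 0) P := by
  refine Integrable.of_bound (C := 1) ?_ (ae_of_all _ fun ω => by split_ifs <;> simp)
  exact (Measurable.ite hS measurable_const measurable_const).aestronglyMeasurable

lemma IsIIDSteps.measurableSet_increment_eq (h : IsIIDSteps P ζ) (u v : ℕ) (q : Lattice2) :
    MeasurableSet {ω | increment (fun i => ζ i ω) u v = q} :=
  h.measurable_increment u v (measurableSet_singleton q)

/-- The second moment of the number of bridges over a time `m`. -/
lemma IsIIDSteps.integral_bridgeCount_sq_le (h : IsIIDSteps P ζ) {K : ℝ} (hK0 : 0 < K)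
    (hK : ∀ k q, hitProb P (ζ 0) k q ≤ K / (k + 1)) {m r : ℕ} (hr : r ≤ m) (s : ℕ)
    (q : Lattice2) :
    ∫ ω, bridgeCount (fun i => ζ i ω) (m - r) m (m + s) q ^ 2 ∂P ≤ 64 * K ^ 2 * r * s := by
  set E : ℕ → ℕ → Ω → Prop := fun i j ω => increment (fun i => ζ i ω) (m - 1 - i) (m + j) = q
    with hE
  have hm : ∀ i j, MeasurableSet {ω | E i j ω} := fun i j => h.measurableSet_increment_eq _ _ q
  classical
  have h1 : ∀ ω, bridgeCount (fun i => ζ i ω) (m - r) m (m + s) q ^ 2 =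
      ∑ i ∈ Finset.range r, ∑ i' ∈ Finset.range r, ∑ j ∈ Finset.range s, ∑ j' ∈ Finset.range s,
        if E i j ω ∧ E i' j' ω then (1 : ℝ) else 0 := by
    intro ω
    rw [bridgeCount_eq_sum_range _ hr, sq, Finset.sum_mul_sum]
    refine Finset.sum_congr rfl fun i _ => Finset.sum_congr rfl fun i' _ => ?_
    rw [Finset.sum_mul_sum]
    refine Finset.sum_congr rfl fun j _ => Finset.sum_congr rfl fun j' _ => ?_
    by_cases e1 : E i j ω <;> by_cases e2 : E i' j' ω <;> simp [hE] at e1 e2 ⊢ <;> simp [e1, e2]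
  have hint : ∀ i i' j j', Integrable
      (fun ω => if E i j ω ∧ E i' j' ω then (1 : ℝ) else 0) P := fun i i' j j' =>
    integrable_ite ((hm i j).inter (hm i' j'))
  have h2 : ∫ ω, bridgeCount (fun i => ζ i ω) (m - r) m (m + s) q ^ 2 ∂P =
      ∑ i ∈ Finset.range r, ∑ i' ∈ Finset.range r, ∑ j ∈ Finset.range s, ∑ j' ∈ Finset.range s,
        P.real {ω | E i j ω ∧ E i' j' ω} := by
    simp_rw [h1]
    rw [integral_finsetSum _ fun i _ => integrable_finsetSum _ fun i' _ => integrable_finsetSum _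
      fun j _ => integrable_finsetSum _ fun j' _ => hint i i' j j']
    refine Finset.sum_congr rfl fun i _ => ?_
    rw [integral_finsetSum _ fun i' _ => integrable_finsetSum _
      fun j _ => integrable_finsetSum _ fun j' _ => hint i i' j j']
    refine Finset.sum_congr rfl fun i' _ => ?_
    rw [integral_finsetSum _ fun j _ => integrable_finsetSum _ fun j' _ => hint i i' j j']
    refine Finset.sum_congr rfl fun j _ => ?_
    rw [integral_finsetSum _ fun j' _ => hint i i' j j']
    refine Finset.sum_congr rfl fun j' _ => ?_
    exact integral_ite_eq ((hm i j).inter (hm i' j'))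
  rw [h2]
  have h3 : ∑ i ∈ Finset.range r, ∑ i' ∈ Finset.range r, ∑ j ∈ Finset.range s,
      ∑ j' ∈ Finset.range s, P.real {ω | E i j ω ∧ E i' j' ω} ≤
      K ^ 2 * (pairWeight r * pairWeight s) := by
    rw [pairWeight, pairWeight, Finset.sum_mul, Finset.mul_sum]
    refine Finset.sum_le_sum fun i hi => ?_
    rw [Finset.sum_mul, Finset.mul_sum]
    refine Finset.sum_le_sum fun i' hi' => ?_
    rw [Finset.mul_sum, Finset.mul_sum]
    refine Finset.sum_le_sum fun j _ => ?_
    rw [Finset.mul_sum, Finset.mul_sum]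
    refine Finset.sum_le_sum fun j' _ => ?_
    rw [Finset.mem_range] at hi hi'
    exact h.prob_two_bridges_le hK0 hK (by omega) (by omega) j j' q
  refine h3.trans ?_
  have hp0 : ∀ n, 0 ≤ pairWeight n := fun n => Finset.sum_nonneg fun _ _ =>
    Finset.sum_nonneg fun _ _ => mul_nonneg (sqrtWeight_nonneg _) (sqrtWeight_nonneg _)
  calc K ^ 2 * (pairWeight r * pairWeight s) ≤ K ^ 2 * ((8 * r) * (8 * s)) := by
        refine mul_le_mul_of_nonneg_left ?_ (sq_nonneg K)
        exact mul_le_mul (pairWeight_le r) (pairWeight_le s) (hp0 s) (by positivity)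
    _ = _ := by ring

end SecondMoment

/-! ### Expected counts in a block -/

section Mean

lemma walk_sub_walk_eq_increment (z : ℕ → Lattice2) (u v : ℕ) :
    walk z u - walk z v = increment z v u - increment z u v := by
  rcases le_total u v with h | h
  · rw [← walk_sub_walk z h, increment, Finset.Ico_eq_empty_of_le h]; simp
  · rw [← walk_sub_walk z h, increment, Finset.Ico_eq_empty_of_le h]; simp

/-- Enlarging the square by one adds a row with `a 0, …, a n` and a column with `b 1, …, b n`; `b 0`
is subtracted because the diagonal belongs to `a`. -/
lemma sum_range_toeplitz (a b : ℕ → ℝ) (n : ℕ) :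
    ∑ i ∈ Finset.range n, ∑ j ∈ Finset.range n, (if j ≤ i then a (i - j) else b (j - i)) =
      ∑ u ∈ Finset.range n, (∑ k ∈ Finset.range (u + 1), a k +
        ∑ k ∈ Finset.range (u + 1), b k - b 0) := by
  induction n with
  | zero => simp
  | succ n ih =>
    rw [Finset.sum_range_succ _ n, Finset.sum_range_succ (fun u => _ - b 0) n, ← ih]
    have h1 : ∀ i, ∑ j ∈ Finset.range (n + 1), (if j ≤ i then a (i - j) else b (j - i)) =
        ∑ j ∈ Finset.range n, (if j ≤ i then a (i - j) else b (j - i)) +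
          (if n ≤ i then a (i - n) else b (n - i)) := fun i => Finset.sum_range_succ _ n
    have h2 : ∑ j ∈ Finset.range (n + 1), (if j ≤ n then a (n - j) else b (j - n)) =
        ∑ k ∈ Finset.range (n + 1), a k := by
      rw [← Finset.sum_range_reflect a]
      refine Finset.sum_congr rfl fun j hj => ?_
      rw [Finset.mem_range] at hj
      rw [if_pos (by omega), Nat.add_sub_cancel]
    have h3 : ∑ i ∈ Finset.range n, (if n ≤ i then a (i - n) else b (n - i)) =
        ∑ k ∈ Finset.range (n + 1), b k - b 0 := by
      rw [Finset.sum_range_succ', add_sub_cancel_right, ← Finset.sum_range_reflect]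
      refine Finset.sum_congr rfl fun j hj => ?_
      rw [Finset.mem_range] at hj
      rw [if_neg (by omega)]
      congr 1
      omega
    rw [h2, Finset.sum_congr rfl fun i _ => h1 i, Finset.sum_add_distrib, h3]
    ring

variable {Ω : Type*} [MeasurableSpace Ω] {P : Measure Ω} [IsProbabilityMeasure P]
  {ζ : ℕ → Ω → Lattice2}

/-- Differences of positions within a block involve only the steps of that block, so counts of
disjoint blocks are independent. -/
lemma measurableSet_walk_sub_iSup (S : Set ℕ) {x y u v : ℕ} (hS : ∀ i, x ≤ i → i < y → i ∈ S)
    (hu : u ∈ Finset.Ico x y) (hv : v ∈ Finset.Ico x y) (p : Lattice2) :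
    MeasurableSet[⨆ i ∈ S, MeasurableSpace.comap (ζ i) inferInstance]
      {ω | walk (fun i => ζ i ω) u - walk (fun i => ζ i ω) v = p} := by
  simp_rw [walk_sub_walk_eq_increment]
  rw [Finset.mem_Ico] at hu hv
  refine measurableSet_eq_fun (Measurable.sub (measurable_increment_iSup S fun i hi hi' =>
    hS i (by omega) (by omega)) (measurable_increment_iSup S fun i hi hi' =>
    hS i (by omega) (by omega))) measurable_const

lemma measurable_blockCount_iSup (S : Set ℕ) {x y : ℕ} (hS : ∀ i, x ≤ i → i < y → i ∈ S)
    (p : Lattice2) :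
    Measurable[⨆ i ∈ S, MeasurableSpace.comap (ζ i) inferInstance]
      (fun ω => blockCount (fun i => ζ i ω) x y p) := by
  simp_rw [blockCount, crossCount_eq_sum]
  refine Finset.measurable_fun_sum _ fun u hu => Finset.measurable_fun_sum _ fun v hv => ?_
  exact Measurable.ite (measurableSet_walk_sub_iSup S hS hu hv p) measurable_const measurable_const

lemma IsIIDSteps.iSup_le (h : IsIIDSteps P ζ) (S : Set ℕ) :
    ⨆ i ∈ S, MeasurableSpace.comap (ζ i) inferInstance ≤ ‹MeasurableSpace Ω› :=
  iSup₂_le fun i _ => (h.measurable i).comap_le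

lemma IsIIDSteps.measurableSet_walk_sub (h : IsIIDSteps P ζ) (u v : ℕ) (p : Lattice2) :
    MeasurableSet {ω | walk (fun i => ζ i ω) u - walk (fun i => ζ i ω) v = p} :=
  h.iSup_le Set.univ _ (measurableSet_walk_sub_iSup (ζ := ζ) Set.univ (x := 0) (y := u + v + 1)
    (fun _ _ _ => Set.mem_univ _) (by simp) (by simp) p)

lemma IsIIDSteps.prob_walk_sub (h : IsIIDSteps P ζ) (u v : ℕ) (p : Lattice2) :
    P.real {ω | walk (fun i => ζ i ω) u - walk (fun i => ζ i ω) v = p} =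
      if v ≤ u then hitProb P (ζ 0) (u - v) p else hitProb P (ζ 0) (v - u) (-p) := by
  split_ifs with hvu
  · rw [← h.prob_increment v, show v + (u - v) = u by omega]
    simp_rw [walk_sub_walk _ hvu]
  · rw [← h.prob_increment u, show u + (v - u) = v by omega]
    simp_rw [walk_sub_walk_eq_iff _ (show u ≤ v by omega)]

lemma IsIIDSteps.integral_blockCount (h : IsIIDSteps P ζ) (x n : ℕ) (p : Lattice2) :
    ∫ ω, blockCount (fun i => ζ i ω) x (x + n) p ∂P = meanCount P (ζ 0) n p := by
  simp_rw [blockCount, crossCount_eq_sum]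
  rw [integral_finsetSum _ fun u _ => integrable_finsetSum _ fun v _ =>
    integrable_ite (h.measurableSet_walk_sub u v p)]
  have h1 : ∀ u, ∫ ω, ∑ v ∈ Finset.Ico x (x + n),
      (if walk (fun i => ζ i ω) u - walk (fun i => ζ i ω) v = p then (1 : ℝ) else 0) ∂P =
      ∑ v ∈ Finset.Ico x (x + n),
      if v ≤ u then hitProb P (ζ 0) (u - v) p else hitProb P (ζ 0) (v - u) (-p) := by
    intro u
    rw [integral_finsetSum _ fun v _ => integrable_ite (h.measurableSet_walk_sub u v p)]
    refine Finset.sum_congr rfl fun v _ => ?_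
    rw [integral_ite_eq (h.measurableSet_walk_sub u v p), h.prob_walk_sub]
  simp_rw [h1]
  rw [meanCount, ← sum_range_toeplitz (fun k => hitProb P (ζ 0) k p)
    (fun k => hitProb P (ζ 0) k (-p)), Finset.sum_Ico_eq_sum_range]
  simp only [Nat.add_sub_cancel_left]
  refine Finset.sum_congr rfl fun i _ => ?_
  rw [Finset.sum_Ico_eq_sum_range]
  simp only [Nat.add_sub_cancel_left, Nat.add_sub_add_left, add_le_add_iff_left]

end Mean

/-! ### Quadratic bound for the variance -/

section Variance

variable {Ω : Type*} [MeasurableSpace Ω] {P : Measure Ω} [IsProbabilityMeasure P]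
  {ζ : ℕ → Ω → Lattice2}

lemma memLp_two_ite {S : Ω → Prop} [DecidablePred S] (hS : MeasurableSet {ω | S ω}) :
    MemLp (fun ω => if S ω then (1 : ℝ) else 0) 2 P :=
  MemLp.of_bound (Measurable.ite hS measurable_const measurable_const).aestronglyMeasurable 1
    (ae_of_all _ fun ω => by split_ifs <;> simp)

lemma IsIIDSteps.memLp_blockCount (h : IsIIDSteps P ζ) (x y : ℕ) (p : Lattice2) :
    MemLp (fun ω => blockCount (fun i => ζ i ω) x y p) 2 P := by
  simp_rw [blockCount, crossCount_eq_sum]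
  exact memLp_finsetSum _ fun u _ => memLp_finsetSum _ fun v _ =>
    memLp_two_ite (h.measurableSet_walk_sub u v p)

lemma IsIIDSteps.memLp_bridgeCount (h : IsIIDSteps P ζ) (x m y : ℕ) (q : Lattice2) :
    MemLp (fun ω => bridgeCount (fun i => ζ i ω) x m y q) 2 P := by
  unfold bridgeCount
  exact memLp_finsetSum _ fun u _ => memLp_finsetSum _ fun v _ =>
    memLp_two_ite (h.measurableSet_increment_eq u v q)

/-- From `2xy ≤ x²/5 + 5y²`. The factor on the main term must be below 2: halving a block halves the
sum of squared lengths, so a factor 2 would leave no contraction in the induction. -/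
lemma variance_add_le {X Y : Ω → ℝ} (hX : MemLp X 2 P) (hY : MemLp Y 2 P) :
    Var[fun ω => X ω + Y ω; P] ≤ 6 / 5 * Var[X; P] + 6 * Var[Y; P] := by
  have hXY : MemLp (fun ω => X ω + Y ω) 2 P := hX.add hY
  rw [variance_eq_integral hXY.aestronglyMeasurable.aemeasurable,
    variance_eq_integral hX.aestronglyMeasurable.aemeasurable,
    variance_eq_integral hY.aestronglyMeasurable.aemeasurable,
    integral_add (hX.integrable (by norm_num)) (hY.integrable (by norm_num))]
  have hX' : MemLp (fun ω => X ω - ∫ ω, X ω ∂P) 2 P := hX.sub (memLp_const _)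
  have hY' : MemLp (fun ω => Y ω - ∫ ω, Y ω ∂P) 2 P := hY.sub (memLp_const _)
  rw [← integral_const_mul, ← integral_const_mul,
    ← integral_add (hX'.integrable_sq.const_mul _) (hY'.integrable_sq.const_mul _)]
  refine integral_mono ?_ ?_ fun ω => ?_
  · exact (hXY.sub (memLp_const _)).integrable_sq
  · exact (hX'.integrable_sq.const_mul _).add (hY'.integrable_sq.const_mul _)
  · simp only
    nlinarith [sq_nonneg ((X ω - ∫ ω, X ω ∂P) - 5 * (Y ω - ∫ ω, Y ω ∂P))]

lemma IsIIDSteps.variance_bridgeCount_add_le (h : IsIIDSteps P ζ) {K : ℝ} (hK0 : 0 < K)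
    (hK : ∀ k q, hitProb P (ζ 0) k q ≤ K / (k + 1)) (x a b : ℕ) (p : Lattice2) :
    Var[fun ω => bridgeCount (fun i => ζ i ω) x (x + a) (x + a + b) p +
      bridgeCount (fun i => ζ i ω) x (x + a) (x + a + b) (-p); P] ≤ 256 * K ^ 2 * (a * b) := by
  have hL : ∀ q, MemLp (fun ω => bridgeCount (fun i => ζ i ω) x (x + a) (x + a + b) q) 2 P :=
    fun q => h.memLp_bridgeCount _ _ _ q
  have hsum := (hL p).add (hL (-p))
  refine (variance_le_expectation_sq hsum.aestronglyMeasurable).trans ?_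
  have hb : ∀ q, ∫ ω, bridgeCount (fun i => ζ i ω) x (x + a) (x + a + b) q ^ 2 ∂P ≤
      64 * K ^ 2 * a * b := by
    intro q
    have := h.integral_bridgeCount_sq_le hK0 hK (m := x + a) (r := a) (by omega) b q
    rwa [show x + a - a = x by omega] at this
  have h1 : ∫ ω, (2 * bridgeCount (fun i => ζ i ω) x (x + a) (x + a + b) p ^ 2 +
      2 * bridgeCount (fun i => ζ i ω) x (x + a) (x + a + b) (-p) ^ 2) ∂P ≤
      256 * K ^ 2 * (a * b) := by
    rw [integral_add ((hL p).integrable_sq.const_mul _) ((hL (-p)).integrable_sq.const_mul _),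
      integral_const_mul, integral_const_mul]
    linarith [hb p, hb (-p)]
  refine le_trans (integral_mono hsum.integrable_sq
    (((hL p).integrable_sq.const_mul 2).add ((hL (-p)).integrable_sq.const_mul 2)) fun ω => ?_) h1
  simp only [Pi.pow_apply, Pi.add_apply]
  nlinarith [sq_nonneg (bridgeCount (fun i => ζ i ω) x (x + a) (x + a + b) p -
    bridgeCount (fun i => ζ i ω) x (x + a) (x + a + b) (-p))]

/-- The variance of the number of self-intersections in time `n` is `O(n²)`. -/
lemma IsIIDSteps.variance_blockCount_le (h : IsIIDSteps P ζ) {K : ℝ} (hK0 : 0 < K)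
    (hK : ∀ k q, hitProb P (ζ 0) k q ≤ K / (k + 1)) (p : Lattice2) (n : ℕ) :
    ∀ x, Var[fun ω => blockCount (fun i => ζ i ω) x (x + n) p; P] ≤ 1536 * K ^ 2 * n ^ 2 := by
  induction n using Nat.strong_induction_on with
  | _ n ih =>
  intro x
  rcases Nat.lt_or_ge n 2 with hn | hn
  -- With at most one time in the block the count is deterministic.
  · have hconst : ∃ c : ℝ, ∀ ω, blockCount (fun i => ζ i ω) x (x + n) p = c := by
      interval_cases n
      · exact ⟨0, fun ω => by simp [blockCount, crossCount_eq_sum]⟩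
      · exact ⟨if 0 = p then 1 else 0, fun ω => by
          rw [blockCount, crossCount_eq_sum, Nat.Ico_succ_singleton, Finset.sum_singleton,
            Finset.sum_singleton, sub_self]⟩
    obtain ⟨c, hc⟩ := hconst
    simp_rw [hc]
    have h0 : Var[fun _ : Ω => c; P] = 0 := by
      rw [variance_eq_integral aemeasurable_const]; simp
    rw [h0]
    positivity
  set a := n / 2 with ha
  set b := n - a with hb
  have hab : a + b = n := by omega
  have hindep : IndepFun (fun ω => blockCount (fun i => ζ i ω) x (x + a) p)
      (fun ω => blockCount (fun i => ζ i ω) (x + a) (x + a + b) p) P :=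
    indepFun_of_measurable_of_indep
      (h.indep_iSup (S := {i | i < x + a}) (T := {i | x + a ≤ i})
        (Set.disjoint_left.mpr fun i (hi : i < x + a) (hi' : x + a ≤ i) => by omega))
      (measurable_blockCount_iSup _ (fun i _ hi => hi) p)
      (measurable_blockCount_iSup _ (fun i hi _ => hi) p)
  have hLa := h.memLp_blockCount x (x + a) p
  have hLb := h.memLp_blockCount (x + a) (x + a + b) p
  have hvar := hindep.variance_add hLa hLb
  have hsplit : (fun ω => blockCount (fun i => ζ i ω) x (x + n) p) = fun ω =>
      (blockCount (fun i => ζ i ω) x (x + a) p + blockCount (fun i => ζ i ω) (x + a) (x + a + b) p) +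
      (bridgeCount (fun i => ζ i ω) x (x + a) (x + a + b) p +
        bridgeCount (fun i => ζ i ω) x (x + a) (x + a + b) (-p)) := by
    funext ω
    rw [← hab, ← add_assoc x a b]
    exact blockCount_split _ (by omega) (by omega) p
  rw [hsplit]
  refine (variance_add_le (hLa.add hLb) ((h.memLp_bridgeCount _ _ _ p).add
    (h.memLp_bridgeCount _ _ _ (-p)))).trans ?_
  have h1 := ih a (by omega) x
  have h2 := ih b (by omega) (x + a)
  have h3 := h.variance_bridgeCount_add_le hK0 hK x a b p
  have h4 : Var[(fun ω => blockCount (fun i => ζ i ω) x (x + a) p) +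
      (fun ω => blockCount (fun i => ζ i ω) (x + a) (x + a + b) p); P] ≤
      1536 * K ^ 2 * a ^ 2 + 1536 * K ^ 2 * b ^ 2 := by
    rw [hvar]; linarith
  have h5 : Var[(fun ω => bridgeCount (fun i => ζ i ω) x (x + a) (x + a + b) p) +
      (fun ω => bridgeCount (fun i => ζ i ω) x (x + a) (x + a + b) (-p)); P] ≤
      256 * K ^ 2 * (a * b) := h3
  have habR : (a : ℝ) + b = n := by exact_mod_cast hab
  have hba : (b : ℝ) - a ≤ 1 := by
    have : b ≤ a + 1 := by omega
    have : (b : ℝ) ≤ a + 1 := by exact_mod_cast this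
    linarith
  have hba0 : (0 : ℝ) ≤ b - a := by
    have : a ≤ b := by omega
    have : (a : ℝ) ≤ b := by exact_mod_cast this
    linarith
  have hn2 : (2 : ℝ) ≤ n := by exact_mod_cast hn
  -- The sum is `(n² + (b - a)²)/2` with `b - a ≤ 1 ≤ n/2`, since `n ≥ 2`.
  have h6 : (a : ℝ) ^ 2 + b ^ 2 ≤ 5 / 8 * n ^ 2 := by
    rw [← habR] at hn2 ⊢
    nlinarith
  have h7 : (a : ℝ) * b ≤ n ^ 2 / 4 := by
    rw [← habR]; nlinarith [sq_nonneg ((a : ℝ) - b)]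
  have hK2 : 0 ≤ K ^ 2 := sq_nonneg K
  -- The induction closes exactly: `6/5 · 5/8 = 3/4`, and the cut contributes `6 · 256 / 4 = 1536 /
  -- 4`.
  calc _ ≤ 6 / 5 * (1536 * K ^ 2 * a ^ 2 + 1536 * K ^ 2 * b ^ 2) +
        6 * (256 * K ^ 2 * (a * b)) := by
        exact add_le_add (mul_le_mul_of_nonneg_left h4 (by norm_num))
          (mul_le_mul_of_nonneg_left h5 (by norm_num))
    _ = K ^ 2 * (6 / 5 * 1536 * ((a : ℝ) ^ 2 + b ^ 2) + 1536 * ((a : ℝ) * b)) := by ring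
    _ ≤ K ^ 2 * (6 / 5 * 1536 * (5 / 8 * n ^ 2) + 1536 * (n ^ 2 / 4)) := by gcongr
    _ = 1536 * K ^ 2 * n ^ 2 := by ring

end Variance

/-! ### Almost sure convergence at dyadic scales -/

section StrongLaw

variable {Ω : Type*} [MeasurableSpace Ω] {P : Measure Ω} [IsProbabilityMeasure P]
  {ζ : ℕ → Ω → Lattice2}

/-- Almost sure convergence of normalized random variables with summable variances. -/
lemma ae_tendsto_of_summable_variance {X : ℕ → Ω → ℝ} (hX : ∀ j, MemLp (X j) 2 P) {c : ℕ → ℝ}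
    (hsum : Summable fun j => Var[X j; P] / c j ^ 2) {L : ℝ}
    (hmean : Tendsto (fun j => (∫ ω, X j ω ∂P) / c j) atTop (𝓝 L)) :
    ∀ᵐ ω ∂P, Tendsto (fun j => X j ω / c j) atTop (𝓝 L) := by
  set Y : ℕ → Ω → ℝ := fun j ω => ((X j ω - ∫ ω, X j ω ∂P) / c j) ^ 2 with hY
  have hYint : ∀ j, Integrable (Y j) P := fun j => by
    have : MemLp (fun ω => X j ω - ∫ ω, X j ω ∂P) 2 P := (hX j).sub (memLp_const _)
    simp_rw [hY, div_pow]
    exact this.integrable_sq.div_const _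
  have hYval : ∀ j, ∫ ω, Y j ω ∂P = Var[X j; P] / c j ^ 2 := fun j => by
    rw [variance_eq_integral (hX j).aestronglyMeasurable.aemeasurable]
    simp_rw [hY, div_pow]
    rw [integral_div]
  -- The squared deviations have summable expectations, so almost surely they are summable and tend
  -- to 0.
  have hlint : ∫⁻ ω, ∑' j, ENNReal.ofReal (Y j ω) ∂P ≠ ⊤ := by
    rw [lintegral_tsum fun j => (hYint j).aemeasurable.ennreal_ofReal]
    have : ∀ j, ∫⁻ ω, ENNReal.ofReal (Y j ω) ∂P = ENNReal.ofReal (Var[X j; P] / c j ^ 2) := by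
      intro j
      rw [← ofReal_integral_eq_lintegral_ofReal (hYint j) (ae_of_all _ fun ω => sq_nonneg _), hYval]
    simp_rw [this]
    exact hsum.tsum_ofReal_ne_top
  have hae : ∀ᵐ ω ∂P, ∑' j, ENNReal.ofReal (Y j ω) < ⊤ :=
    ae_lt_top' (AEMeasurable.tsum fun j => (hYint j).aemeasurable.ennreal_ofReal) hlint
  filter_upwards [hae] with ω hω
  have h1 := ENNReal.tendsto_atTop_zero_of_tsum_ne_top hω.ne
  have h2 : Tendsto (fun j => Y j ω) atTop (𝓝 0) := by
    have h3 := (ENNReal.tendsto_toReal ENNReal.zero_ne_top).comp h1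
    refine (h3.congr fun j => ?_)
    exact ENNReal.toReal_ofReal (sq_nonneg _)
  have h4 : Tendsto (fun j => (X j ω - ∫ ω, X j ω ∂P) / c j) atTop (𝓝 0) := by
    rw [tendsto_zero_iff_abs_tendsto_zero]
    have h5 := h2.sqrt
    rw [Real.sqrt_zero] at h5
    exact h5.congr fun j => Real.sqrt_sq_eq_abs _
  have h6 := h4.add hmean
  rw [zero_add] at h6
  refine h6.congr fun j => ?_
  ring

lemma tendsto_dyadic_log_ratio {d : ℕ} (hd : 0 < d) :
    Tendsto (fun j : ℕ => ((d * 2 ^ j : ℕ) * Real.log (d * 2 ^ j : ℕ)) / ((j : ℝ) * 2 ^ j)) atTop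
      (𝓝 (d * Real.log 2)) := by
  have h1 : Tendsto (fun j : ℕ => d * (Real.log d / (j : ℝ) + Real.log 2)) atTop
      (𝓝 (d * (0 + Real.log 2))) :=
    ((tendsto_const_div_atTop_nhds_zero_nat (Real.log d)).add tendsto_const_nhds).const_mul _
  rw [zero_add] at h1
  refine h1.congr' ?_
  filter_upwards [eventually_gt_atTop 0] with j hj
  have hj0 : (j : ℝ) ≠ 0 := by exact_mod_cast hj.ne'
  have hd0 : (d : ℝ) ≠ 0 := by exact_mod_cast hd.ne'
  push_cast
  rw [Real.log_mul hd0 (by positivity), Real.log_pow]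
  field_simp

/-- Variances of order `4^j` against `(j 2^j)²` leave `1/j²`, which is summable. The triples `(a, b,
p)` are countably many, so one null set suffices. -/
lemma IsIIDSteps.ae_tendsto_dyadic (h : IsIIDSteps P ζ) (hX : IsCenteredAperiodic P (ζ 0)) :
    ∀ᵐ ω ∂P, ∀ (a b : ℕ) (p : Lattice2), a ≤ b →
      Tendsto (fun j : ℕ => blockCount (fun i => ζ i ω) (a * 2 ^ j) (b * 2 ^ j) p / ((j : ℝ) * 2 ^ j))
        atTop (𝓝 (2 * greenConst P (ζ 0) * Real.log 2 * ((b : ℝ) - a))) := by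
  obtain ⟨K, hK0, hK⟩ := h.exists_hitProb_le hX
  rw [ae_all_iff]; intro a
  rw [ae_all_iff]; intro b
  rw [ae_all_iff]; intro p
  by_cases hab : a ≤ b
  swap
  · exact ae_of_all _ fun ω h' => absurd h' hab
  obtain ⟨d, rfl⟩ := Nat.exists_eq_add_of_le hab
  rcases Nat.eq_zero_or_pos d with rfl | hd
  · refine ae_of_all _ fun ω _ => ?_
    simp [blockCount, crossCount_eq_sum]
  have hmul : ∀ j, (a + d) * 2 ^ j = a * 2 ^ j + d * 2 ^ j := fun j => by ring
  have key : ∀ᵐ ω ∂P, Tendsto (fun j : ℕ => blockCount (fun i => ζ i ω) (a * 2 ^ j)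
      ((a + d) * 2 ^ j) p / ((j : ℝ) * 2 ^ j)) atTop
      (𝓝 (2 * greenConst P (ζ 0) * (d * Real.log 2))) := by
    refine ae_tendsto_of_summable_variance
      (X := fun j ω => blockCount (fun i => ζ i ω) (a * 2 ^ j) ((a + d) * 2 ^ j) p)
      (fun j => h.memLp_blockCount _ _ p) ?_ ?_
    · have hs : Summable fun j : ℕ => 1536 * K ^ 2 * d ^ 2 * (1 / (j : ℝ) ^ 2) :=
        (Real.summable_one_div_nat_pow.mpr one_lt_two).mul_left _
      refine Summable.of_nonneg_of_le (fun j => div_nonneg (variance_nonneg _ _) (sq_nonneg _))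
        (fun j => ?_) hs
      have h1 := h.variance_blockCount_le hK0 hK p (d * 2 ^ j) (a * 2 ^ j)
      rw [← hmul] at h1
      refine (div_le_div_of_nonneg_right h1 (sq_nonneg _)).trans (le_of_eq ?_)
      push_cast
      rw [mul_pow, mul_pow, mul_one_div, ← mul_assoc]
      exact mul_div_mul_right _ _ (by positivity)
    · have h1 := ((h.tendsto_meanCount hX p).comp (f := fun j : ℕ => d * 2 ^ j) (x := atTop) ?_).mul
        (tendsto_dyadic_log_ratio hd)
      · refine h1.congr' ?_
        filter_upwards [eventually_gt_atTop 1] with j hj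
        simp only [Function.comp_apply]
        rw [hmul, h.integral_blockCount]
        have h2 : 1 < d * 2 ^ j := by
          calc 1 < 2 ^ j := Nat.one_lt_two_pow (by omega)
            _ ≤ d * 2 ^ j := Nat.le_mul_of_pos_left _ hd
        have h3 : (1 : ℝ) < (d * 2 ^ j : ℕ) := by exact_mod_cast h2
        have h4 : Real.log (d * 2 ^ j : ℕ) ≠ 0 := (Real.log_pos h3).ne'
        have h5 : ((d * 2 ^ j : ℕ) : ℝ) ≠ 0 := by positivity
        field_simp
      · exact (tendsto_pow_atTop_atTop_of_one_lt one_lt_two).const_mul_atTop' hd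
  filter_upwards [key] with ω hω _
  convert hω using 2
  push_cast
  ring

end StrongLaw

/-! ### From dyadic scales to all scales -/

section Interpolation

/-- Monotonicity encloses `V x y` between its values on the largest inner and smallest outer grid
intervals; each end moves by at most `s`. -/
lemma abs_sub_le_of_dyadic {V : ℕ → ℕ → ℝ} (hV0 : ∀ x y, 0 ≤ V x y)
    (hV : ∀ x x' y y', x' ≤ x → y ≤ y' → V x y ≤ V x' y') {c e : ℝ} (hc : 0 ≤ c) (he : 0 ≤ e)
    {s M : ℕ} (hs : 0 < s)
    (hd : ∀ a b, a ≤ b → b ≤ M → |V (a * s) (b * s) - c * (((b : ℝ) - a) * s)| ≤ e)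
    {x y : ℕ} (hxy : x ≤ y) (hM : y / s + 1 ≤ M) :
    |V x y - c * ((y : ℝ) - x)| ≤ 2 * c * s + e := by
  have hs' : (0 : ℝ) < s := by exact_mod_cast hs
  have hx1 : x / s * s ≤ x := Nat.div_mul_le_self x s
  have hx2 : x < (x / s + 1) * s := by
    rw [add_mul, one_mul]; exact Nat.lt_div_mul_add hs
  have hy1 : y / s * s ≤ y := Nat.div_mul_le_self y s
  have hy2 : y < (y / s + 1) * s := by
    rw [add_mul, one_mul]; exact Nat.lt_div_mul_add hs
  have hle : x / s ≤ y / s := Nat.div_le_div_right hxy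
  have hx1' : ((x / s : ℕ) : ℝ) * s ≤ x := by exact_mod_cast hx1
  have hx2' : (x : ℝ) < (((x / s : ℕ) : ℝ) + 1) * s := by exact_mod_cast hx2
  have hy1' : ((y / s : ℕ) : ℝ) * s ≤ y := by exact_mod_cast hy1
  have hy2' : (y : ℝ) < (((y / s : ℕ) : ℝ) + 1) * s := by exact_mod_cast hy2
  rw [abs_le]
  constructor
  · by_cases hab : x / s + 1 ≤ y / s
    · have h1 := (abs_le.mp (hd (x / s + 1) (y / s) hab (by omega))).1
      have h2 := hV _ _ _ _ hx2.le hy1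
      push_cast at h1
      have h3 : c * ((y : ℝ) - x - 2 * s) ≤
          c * (((y / s : ℕ) - (((x / s : ℕ) : ℝ) + 1)) * s) :=
        mul_le_mul_of_nonneg_left (by nlinarith) hc
      linarith
    -- No inner grid interval exists; then `y - x` is below the allowed error and `V ≥ 0` suffices.
    · have h4 : y / s = x / s := by omega
      rw [h4] at hy2'
      have h5 : c * ((y : ℝ) - x) ≤ c * (2 * s) :=
        mul_le_mul_of_nonneg_left (by nlinarith) hc
      linarith [hV0 x y]
  · have h1 := (abs_le.mp (hd (x / s) (y / s + 1) (by omega) hM)).2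
    have h2 := hV _ _ _ _ hx1 hy2.le
    push_cast at h1
    have h3 : c * (((((y / s : ℕ) : ℝ) + 1) - ((x / s : ℕ) : ℝ)) * s) ≤
        c * ((y : ℝ) - x + 2 * s) :=
      mul_le_mul_of_nonneg_left (by nlinarith) hc
    linarith

/-- From dyadic scales to all scales, for a monotone function of intervals. -/
lemma tendsto_of_dyadic {V : ℕ → ℕ → ℝ} (hV0 : ∀ x y, 0 ≤ V x y)
    (hV : ∀ x x' y y', x' ≤ x → y ≤ y' → V x y ≤ V x' y') {c : ℝ} (hc : 0 ≤ c)
    (hd : ∀ a b : ℕ, a ≤ b → Tendsto (fun j : ℕ => V (a * 2 ^ j) (b * 2 ^ j) / ((j : ℝ) * 2 ^ j))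
      atTop (𝓝 (c * Real.log 2 * ((b : ℝ) - a))))
    {x y : ℕ → ℕ} (hxy : ∀ n, x n ≤ y n) {A B : ℝ}
    (hx : Tendsto (fun n => (x n : ℝ) / n) atTop (𝓝 A))
    (hy : Tendsto (fun n => (y n : ℝ) / n) atTop (𝓝 B)) :
    Tendsto (fun n : ℕ => V (x n) (y n) / (n * Real.log n)) atTop (𝓝 (c * (B - A))) := by
  have hlog : Tendsto (fun n : ℕ => Real.log n) atTop atTop :=
    Real.tendsto_log_atTop.comp tendsto_natCast_atTop_atTop
  have hl2 : 0 < Real.log 2 := Real.log_pos one_lt_two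
  have hl2' : 1 / 2 < Real.log 2 := by linarith [Real.log_two_gt_d9]
  rw [Metric.tendsto_nhds]
  intro ε hε
  -- `R` is the fineness of the grid: its mesh `2^j` will satisfy `R 2^j ≤ n < 2R 2^j`, and rounding
  -- costs a relative error `(2c + 2)/R`.
  obtain ⟨R, hR⟩ := exists_nat_gt ((2 * c + 2) / (ε / 2))
  have hR0 : 0 < R := by
    have : (0 : ℝ) < R := lt_of_le_of_lt (by positivity) hR
    exact_mod_cast this
  have hR0' : (0 : ℝ) < R := by exact_mod_cast hR0
  have hRε : (2 * c + 2) / R < ε / 2 := by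
    rw [div_lt_iff₀ (by positivity)] at hR
    rw [div_lt_iff₀ hR0']
    linarith
  obtain ⟨B', hB'⟩ := exists_nat_gt (max B 0)
  -- A bound, independent of `n`, for the grid indices in use: only finitely many dyadic limits are
  -- needed, so they hold uniformly.
  set M := B' * (2 * R) + 1 with hM
  set j : ℕ → ℕ := fun n => Nat.log 2 (n / R) with hj
  have hjtop : Tendsto j atTop atTop := by
    refine tendsto_atTop.mpr fun J => ?_
    filter_upwards [eventually_ge_atTop (2 ^ J * R)] with n hn
    exact Nat.le_log_of_pow_le (by norm_num) ((Nat.le_div_iff_mul_le hR0).mpr hn)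
  have hjlo : ∀ n, R ≤ n → R * 2 ^ j n ≤ n := by
    intro n hn
    have : 2 ^ j n ≤ n / R := Nat.pow_log_le_self 2 (Nat.div_pos hn hR0).ne'
    calc R * 2 ^ j n ≤ R * (n / R) := Nat.mul_le_mul_left _ this
      _ ≤ n := Nat.mul_div_le n R
  have hjhi : ∀ n, n < 2 * R * 2 ^ j n := by
    intro n
    have h1 : n / R < 2 ^ (j n + 1) := Nat.lt_pow_succ_log_self (by norm_num) _
    have h2 := (Nat.div_lt_iff_lt_mul hR0).mp h1
    calc n < 2 ^ (j n + 1) * R := h2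
      _ = 2 * R * 2 ^ j n := by ring
  have hev : ∀ᶠ i : ℕ in atTop, ∀ b ∈ Finset.range (M + 1), ∀ a ∈ Finset.range (b + 1),
      |V (a * 2 ^ i) (b * 2 ^ i) - c * Real.log 2 * i * (((b : ℝ) - a) * (2 ^ i : ℕ))| ≤
        (i : ℝ) * 2 ^ i := by
    rw [Filter.eventually_all_finset]
    intro b _
    rw [Filter.eventually_all_finset]
    intro a ha
    have h1 := (Metric.tendsto_nhds.mp (hd a b (by simpa [Nat.lt_succ_iff] using ha))) 1 one_pos
    filter_upwards [h1, eventually_gt_atTop 0] with i hi hi0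
    have hi0' : (0 : ℝ) < i := by exact_mod_cast hi0
    have hpos : (0 : ℝ) < (i : ℝ) * 2 ^ i := by positivity
    rw [Real.dist_eq] at hi
    have h2 : V (a * 2 ^ i) (b * 2 ^ i) - c * Real.log 2 * i * (((b : ℝ) - a) * (2 ^ i : ℕ)) =
        (V (a * 2 ^ i) (b * 2 ^ i) / ((i : ℝ) * 2 ^ i) - c * Real.log 2 * ((b : ℝ) - a)) *
          ((i : ℝ) * 2 ^ i) := by
      push_cast
      field_simp
    rw [h2, abs_mul, abs_of_pos hpos]
    exact mul_le_of_le_one_left hpos.le hi.le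
  have hratio : Tendsto (fun n : ℕ => (j n : ℝ) * Real.log 2 / Real.log n) atTop (𝓝 1) := by
    have hlow : Tendsto (fun n : ℕ => 1 - Real.log (2 * R) / Real.log n) atTop (𝓝 1) := by
      have := (hlog.const_div_atTop (Real.log (2 * R))).const_sub 1
      simpa using this
    refine tendsto_of_tendsto_of_tendsto_of_le_of_le' hlow tendsto_const_nhds ?_ ?_
    · filter_upwards [hlog.eventually_gt_atTop 0, eventually_gt_atTop 0] with n hn hn0
      have hn0' : (0 : ℝ) < n := by exact_mod_cast hn0
      have h1 : (n : ℝ) ≤ 2 * R * 2 ^ j n := by exact_mod_cast (hjhi n).le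
      have h2 := Real.log_le_log hn0' h1
      rw [Real.log_mul (by positivity) (by positivity), Real.log_pow] at h2
      rw [le_div_iff₀ hn, sub_mul, one_mul, div_mul_cancel₀ _ hn.ne']
      linarith
    · filter_upwards [hlog.eventually_gt_atTop 0, eventually_ge_atTop R] with n hn hnR
      have h1 : 2 ^ j n ≤ n := le_trans (Nat.le_mul_of_pos_left _ hR0) (hjlo n hnR)
      have h1' : (2 : ℝ) ^ j n ≤ n := by exact_mod_cast h1
      have h2 := Real.log_le_log (by positivity) h1'
      rw [Real.log_pow] at h2
      rw [div_le_one hn]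
      exact h2
  have hmain : Tendsto (fun n : ℕ => c * ((y n : ℝ) / n - (x n : ℝ) / n) *
      ((j n : ℝ) * Real.log 2 / Real.log n)) atTop (𝓝 (c * (B - A))) := by
    have := ((hy.sub hx).const_mul c).mul hratio
    simpa using this
  have hyB : ∀ᶠ n : ℕ in atTop, (y n : ℝ) / n < B' :=
    hy.eventually_lt_const ((le_max_left _ _).trans_lt hB')
  filter_upwards [(Metric.tendsto_nhds.mp hmain) (ε / 2) (by positivity), hjtop.eventually hev,
    hlog.eventually_gt_atTop 0, eventually_ge_atTop R, hyB] with n h1 h2 hn hnR hyn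
  have hn0 : 0 < n := lt_of_lt_of_le hR0 hnR
  have hn0' : (0 : ℝ) < n := by exact_mod_cast hn0
  have hyM : y n / 2 ^ j n + 1 ≤ M := by
    rw [div_lt_iff₀ hn0'] at hyn
    have h3 : y n < B' * n := by exact_mod_cast hyn
    have h4 : y n < B' * (2 * R) * 2 ^ j n := by
      calc y n < B' * n := h3
        _ ≤ B' * (2 * R * 2 ^ j n) := Nat.mul_le_mul_left _ (hjhi n).le
        _ = B' * (2 * R) * 2 ^ j n := by ring
    have h5 := (Nat.div_lt_iff_lt_mul (by positivity)).mpr h4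
    omega
  have h3 := abs_sub_le_of_dyadic hV0 hV (c := c * Real.log 2 * j n) (e := (j n : ℝ) * 2 ^ j n)
    (by positivity) (by positivity) (s := 2 ^ j n) (M := M) (by positivity)
    (fun a b hab hbM => h2 b (by simp; omega) a (by simp; omega)) (hxy n) hyM
  have hbound : 2 * (c * Real.log 2 * j n) * (2 ^ j n : ℕ) + (j n : ℝ) * 2 ^ j n ≤
      (2 * c + 2) / R * (n * Real.log n) := by
    have e1 : (R : ℝ) * 2 ^ j n ≤ n := by exact_mod_cast hjlo n hnR
    have e2 : (j n : ℝ) * Real.log 2 ≤ Real.log n := by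
      have h1 : 2 ^ j n ≤ n := le_trans (Nat.le_mul_of_pos_left _ hR0) (hjlo n hnR)
      have h1' : (2 : ℝ) ^ j n ≤ n := by exact_mod_cast h1
      have h2 := Real.log_le_log (by positivity) h1'
      rwa [Real.log_pow] at h2
    have e3 : (R : ℝ) * 2 ^ j n * ((j n : ℝ) * Real.log 2) ≤ n * Real.log n :=
      mul_le_mul e1 e2 (by positivity) hn0'.le
    rw [div_mul_eq_mul_div, le_div_iff₀ hR0']
    push_cast
    -- Since `log 2 > 1/2`, the error term without `log 2` is absorbed by the summand 2 of `2c + 2`.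
    have e4 : (2 * (c * Real.log 2 * j n) * 2 ^ j n + (j n : ℝ) * 2 ^ j n) * R ≤
        (2 * c + 2) * (R * 2 ^ j n * ((j n : ℝ) * Real.log 2)) := by
      have : 0 ≤ (R : ℝ) * 2 ^ j n * j n := by positivity
      nlinarith
    exact e4.trans (mul_le_mul_of_nonneg_left e3 (by positivity))
  rw [Real.dist_eq] at h1 ⊢
  have h5 : |V (x n) (y n) / (n * Real.log n) - c * ((y n : ℝ) / n - (x n : ℝ) / n) *
      ((j n : ℝ) * Real.log 2 / Real.log n)| ≤ (2 * c + 2) / R := by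
    have e1 : V (x n) (y n) / (n * Real.log n) - c * ((y n : ℝ) / n - (x n : ℝ) / n) *
        ((j n : ℝ) * Real.log 2 / Real.log n) =
        (V (x n) (y n) - c * Real.log 2 * j n * ((y n : ℝ) - x n)) / (n * Real.log n) := by
      field_simp
    have hpos : 0 < n * Real.log n := by positivity
    rw [e1, abs_div, abs_of_pos hpos, div_le_iff₀ hpos]
    exact h3.trans hbound
  have h6 := abs_sub_le (V (x n) (y n) / (n * Real.log n)) (c * ((y n : ℝ) / n - (x n : ℝ) / n) *
      ((j n : ℝ) * Real.log 2 / Real.log n)) (c * (B - A))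
  linarith

end Interpolation

/-! ### Consequences for a fixed path -/

section Paths

/-- The self-intersection counts of the blocks `[x_n, y_n)` with `x_n ∼ A n` and `y_n ∼ B n` are
asymptotic to `c (B - A) n log n`. -/
def HasBlockAsymptotics (z : ℕ → Lattice2) (c : ℝ) : Prop :=
  ∀ (p : Lattice2) (x y : ℕ → ℕ) (A B : ℝ), (∀ n, x n ≤ y n) →
    Tendsto (fun n => (x n : ℝ) / n) atTop (𝓝 A) → Tendsto (fun n => (y n : ℝ) / n) atTop (𝓝 B) →
    Tendsto (fun n : ℕ => blockCount z (x n) (y n) p / (n * Real.log n)) atTop (𝓝 (c * (B - A)))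

/-- The only probabilistic input of the final theorem apart from the mean; everything after it holds
for each single path with this property. -/
lemma IsIIDSteps.ae_hasBlockAsymptotics {Ω : Type*} [MeasurableSpace Ω] {P : Measure Ω}
    [IsProbabilityMeasure P] {ζ : ℕ → Ω → Lattice2} (h : IsIIDSteps P ζ)
    (hX : IsCenteredAperiodic P (ζ 0)) :
    ∀ᵐ ω ∂P, HasBlockAsymptotics (fun i => ζ i ω) (2 * greenConst P (ζ 0)) := by
  filter_upwards [h.ae_tendsto_dyadic hX] with ω hω p x y A B hxy hA hB
  have := hX.greenConst_pos
  refine tendsto_of_dyadic (V := fun x y => blockCount (fun i => ζ i ω) x y p)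
    (fun x y => Nat.cast_nonneg _) (fun x x' y y' hx hy => ?_) (by positivity)
    (fun a b hab => hω a b p hab) hxy hA hB
  have hsub : Finset.Ico x y ⊆ Finset.Ico x' y' := Finset.Ico_subset_Ico hx hy
  exact Nat.cast_le.mpr (crossCount_mono _ hsub hsub p)

lemma tendsto_floor_mul_div {A : ℝ} (hA : 0 ≤ A) :
    Tendsto (fun n : ℕ => (⌊(n : ℝ) * A⌋₊ : ℝ) / n) atTop (𝓝 A) := by
  have h := (tendsto_nat_floor_mul_div_atTop hA).comp tendsto_natCast_atTop_atTop
  refine h.congr fun n => ?_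
  simp only [Function.comp_apply]
  rw [mul_comm]

lemma tendsto_add_one_div {x : ℕ → ℕ} {A : ℝ} (hx : Tendsto (fun n => (x n : ℝ) / n) atTop (𝓝 A)) :
    Tendsto (fun n => ((x n + 1 : ℕ) : ℝ) / n) atTop (𝓝 A) := by
  have h := hx.add (tendsto_one_div_atTop_nhds_zero_nat (𝕜 := ℝ))
  rw [add_zero] at h
  refine h.congr fun n => ?_
  push_cast
  rw [add_div]

lemma tendsto_self_div : Tendsto (fun n : ℕ => ((n + 1 : ℕ) : ℝ) / n) atTop (𝓝 1) := by
  refine tendsto_add_one_div (x := id) ?_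
  refine tendsto_const_nhds.congr' ?_
  filter_upwards [eventually_gt_atTop 0] with n hn
  exact (div_self (by exact_mod_cast hn.ne')).symm

lemma tendsto_log_nat : Tendsto (fun n : ℕ => Real.log n) atTop atTop :=
  Real.tendsto_log_atTop.comp tendsto_natCast_atTop_atTop

lemma floor_mul_le_self {A : ℝ} (hA1 : A ≤ 1) (n : ℕ) : ⌊(n : ℝ) * A⌋₊ ≤ n := by
  refine Nat.floor_le_of_le ?_
  exact mul_le_of_le_one_right (Nat.cast_nonneg n) hA1

/-- The number of intersections between the times before and after `⌊n A⌋`. -/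
def splitCount (z : ℕ → Lattice2) (n : ℕ) (A : ℝ) (p : Lattice2) : ℝ :=
  (crossCount z (Finset.Icc 0 ⌊(n : ℝ) * A⌋₊) (Finset.Icc ⌊(n : ℝ) * A⌋₊ n) p : ℝ) +
    crossCount z (Finset.Icc ⌊(n : ℝ) * A⌋₊ n) (Finset.Icc 0 ⌊(n : ℝ) * A⌋₊) p

lemma sum_indicator_le_card (z : ℕ → Lattice2) (J : Finset ℕ) (l p : Lattice2) :
    (∑ v ∈ J, if l - walk z v = p then (1 : ℝ) else 0) ≤ J.card ∧
      (∑ v ∈ J, if walk z v - l = p then (1 : ℝ) else 0) ≤ J.card := by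
  constructor
  · refine (Finset.sum_le_sum (g := fun _ => (1 : ℝ)) fun v _ => ?_).trans (by simp)
    split_ifs <;> norm_num
  · refine (Finset.sum_le_sum (g := fun _ => (1 : ℝ)) fun v _ => ?_).trans (by simp)
    split_ifs <;> norm_num

/-- The closed blocks share the time `y`, whose own pairs number at most `n + 1`, negligible against
`n log n`. -/
lemma crossCount_Icc_le (z : ℕ → Lattice2) (y n : ℕ) (p : Lattice2) :
    (crossCount z (Finset.Icc 0 y) (Finset.Icc y n) p : ℝ) ≤
      bridgeCount z 0 y (n + 1) (-p) + (n + 1) ∧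
    (crossCount z (Finset.Icc y n) (Finset.Icc 0 y) p : ℝ) ≤
      bridgeCount z 0 y (n + 1) p + (n + 1) := by
  have e1 : Finset.Icc y n = Finset.Ico y (n + 1) := rfl
  have e2 : Finset.Icc 0 y = Finset.Ico 0 (y + 1) := rfl
  have hcard : ((Finset.Ico y (n + 1)).card : ℝ) ≤ n + 1 := by
    rw [Nat.card_Ico]; exact_mod_cast Nat.sub_le (n + 1) y
  rw [← crossCount_Ico_left, ← crossCount_Ico_right, e1, e2]
  constructor
  · rw [crossCount_eq_sum, crossCount_eq_sum, Finset.sum_Ico_succ_top (Nat.zero_le y)]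
    have := (sum_indicator_le_card z (Finset.Ico y (n + 1)) (walk z y) p).1
    linarith
  · rw [crossCount_eq_sum, crossCount_eq_sum, Finset.sum_comm,
      Finset.sum_comm (s := Finset.Ico y (n + 1)) (t := Finset.Ico 0 y),
      Finset.sum_Ico_succ_top (Nat.zero_le y)]
    have := (sum_indicator_le_card z (Finset.Ico y (n + 1)) (walk z y) p).2
    linarith

variable {z : ℕ → Lattice2} {c : ℝ} (hz : HasBlockAsymptotics z c)
include hz

/-- No direct estimate of cross terms is needed: they are the count of the whole block minus those
of its two parts, and the limits `c`, `cA`, `c(1 - A)` cancel. -/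
lemma HasBlockAsymptotics.tendsto_splitCount {A : ℝ} (hA0 : 0 ≤ A) (hA1 : A ≤ 1) (p : Lattice2) :
    Tendsto (fun n : ℕ => splitCount z n A p / (n * Real.log n)) atTop (𝓝 0) := by
  set y : ℕ → ℕ := fun n => ⌊(n : ℝ) * A⌋₊ with hy
  have hyA : Tendsto (fun n => (y n : ℝ) / n) atTop (𝓝 A) := tendsto_floor_mul_div hA0
  have hyn : ∀ n, y n ≤ n + 1 := fun n => (floor_mul_le_self hA1 n).trans (Nat.le_succ n)
  have h0 : Tendsto (fun n : ℕ => ((0 : ℕ) : ℝ) / n) atTop (𝓝 0) := by simp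
  have t1 := hz p (fun _ => 0) (fun n => n + 1) 0 1 (fun n => Nat.zero_le _) h0 tendsto_self_div
  have t2 := hz p (fun _ => 0) y 0 A (fun n => Nat.zero_le _) h0 hyA
  have t3 := hz p y (fun n => n + 1) A 1 hyn hyA tendsto_self_div
  have t4 : Tendsto (fun n : ℕ => 2 * (((n + 1 : ℕ) : ℝ) / n) / Real.log n) atTop (𝓝 0) :=
    (tendsto_self_div.const_mul 2).div_atTop tendsto_log_nat
  have t5 := ((t1.sub t2).sub t3).add t4
  rw [show c * (1 - 0) - c * (A - 0) - c * (1 - A) + 0 = 0 by ring] at t5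
  refine squeeze_zero' ?_ ?_ t5
  · filter_upwards [tendsto_log_nat.eventually_gt_atTop 0] with n hn
    unfold splitCount
    positivity
  · filter_upwards [tendsto_log_nat.eventually_gt_atTop 0, eventually_gt_atTop 0] with n hn hn0
    have hn0' : (0 : ℝ) < n := by exact_mod_cast hn0
    have hs := blockCount_split z (Nat.zero_le (y n)) (hyn n) p
    have hb : splitCount z n A p ≤ blockCount z 0 (n + 1) p - blockCount z 0 (y n) p -
        blockCount z (y n) (n + 1) p + 2 * ((n + 1 : ℕ) : ℝ) := by
      obtain ⟨b1, b2⟩ := crossCount_Icc_le z (y n) n p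
      unfold splitCount
      push_cast
      linarith
    refine (div_le_div_of_nonneg_right hb (by positivity)).trans (le_of_eq ?_)
    field_simp

lemma HasBlockAsymptotics.isLittleO_splitCount {A : ℝ} (hA0 : 0 ≤ A) (hA1 : A ≤ 1)
    (p : Lattice2) :
    (fun n : ℕ => splitCount z n A p) =o[atTop] fun n : ℕ => (n : ℝ) * Real.log n := by
  refine (isLittleO_iff_tendsto' ?_).mpr (hz.tendsto_splitCount hA0 hA1 p)
  filter_upwards [tendsto_log_nat.eventually_gt_atTop 0, eventually_gt_atTop 0] with n hn hn0 h0
  have hn0' : (0 : ℝ) < n := by exact_mod_cast hn0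
  exact absurd h0 (by positivity)

omit hz in
lemma timeBlock_subset_left {A B C : ℝ} (hBC : B ≤ C) (n : ℕ) :
    timeBlock n A B ⊆ Finset.Icc 0 ⌊(n : ℝ) * C⌋₊ :=
  Finset.Icc_subset_Icc (Nat.zero_le _)
    (Nat.floor_mono (mul_le_mul_of_nonneg_left hBC (Nat.cast_nonneg n)))

omit hz in
lemma timeBlock_subset_right {A B C : ℝ} (hCA : C ≤ A) (hB : B ≤ 1) (n : ℕ) :
    timeBlock n A B ⊆ Finset.Icc ⌊(n : ℝ) * C⌋₊ n :=
  Finset.Icc_subset_Icc (Nat.floor_mono (mul_le_mul_of_nonneg_left hCA (Nat.cast_nonneg n)))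
    (floor_mul_le_self hB n)

lemma HasBlockAsymptotics.isLittleO_crossIntegral {A B C D : ℝ} (hB : 0 ≤ B) (hBC : B ≤ C)
    (hCD : C ≤ D) (hD : D ≤ 1) (p : Lattice2) :
    (fun n : ℕ => crossIntegral z (timeBlock n A B) (timeBlock n C D) p) =o[atTop]
      fun n : ℕ => (n : ℝ) * Real.log n := by
  refine IsBigO.trans_isLittleO (IsBigO.of_bound 1 (Eventually.of_forall fun n => ?_))
    (hz.isLittleO_splitCount hB (hBC.trans (hCD.trans hD)) p)
  rw [crossIntegral_eq_crossCount, Complex.norm_natCast, one_mul]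
  refine le_trans ?_ (le_abs_self _)
  refine le_trans ?_ (le_add_of_nonneg_right (Nat.cast_nonneg _))
  exact Nat.cast_le.mpr
    (crossCount_mono z (timeBlock_subset_left le_rfl n) (timeBlock_subset_right hBC hD n) p)

lemma HasBlockAsymptotics.isLittleO_adjacent {A : ℝ} (hA0 : 0 ≤ A) (hA1 : A ≤ 1) (p : Lattice2) :
    (fun n : ℕ =>
      (crossCount z (Finset.Icc 1 ⌊(n : ℝ) * A⌋₊) (timeBlock n A 1) p : ℝ) +
      (crossCount z (timeBlock n A 1) (Finset.Icc 1 ⌊(n : ℝ) * A⌋₊) p : ℝ))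
      =o[atTop] fun n : ℕ => (n : ℝ) * Real.log n := by
  refine IsBigO.trans_isLittleO (IsBigO.of_bound 1 (Eventually.of_forall fun n => ?_))
    (hz.isLittleO_splitCount hA0 hA1 p)
  rw [one_mul, Real.norm_of_nonneg (by positivity)]
  refine le_trans ?_ (le_abs_self _)
  have h1 : Finset.Icc 1 ⌊(n : ℝ) * A⌋₊ ⊆ Finset.Icc 0 ⌊(n : ℝ) * A⌋₊ :=
    Finset.Icc_subset_Icc (Nat.zero_le _) le_rfl
  have h2 := timeBlock_subset_right (le_refl A) (le_refl 1) n
  exact add_le_add (Nat.cast_le.mpr (crossCount_mono z h1 h2 p))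
    (Nat.cast_le.mpr (crossCount_mono z h2 h1 p))

lemma HasBlockAsymptotics.tendsto_timeBlock {A B : ℝ} (hA : 0 ≤ A) (hAB : A ≤ B) (p : Lattice2) :
    Tendsto (fun n : ℕ => (crossCount z (timeBlock n A B) (timeBlock n A B) p : ℝ) /
      (n * Real.log n)) atTop (𝓝 (c * (B - A))) :=
  hz p (fun n => ⌊(n : ℝ) * A⌋₊) (fun n => ⌊(n : ℝ) * B⌋₊ + 1) A B
    (fun n => (Nat.floor_mono (mul_le_mul_of_nonneg_left hAB (Nat.cast_nonneg n))).trans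
      (Nat.le_succ _))
    (tendsto_floor_mul_div hA) (tendsto_add_one_div (tendsto_floor_mul_div (hA.trans hAB)))

lemma HasBlockAsymptotics.tendsto_final_block (hc : 0 < c) {A : ℝ} (hA0 : 0 ≤ A) (hA1 : A < 1)
    (p : Lattice2) :
    Tendsto (fun n : ℕ => (crossCount z (timeBlock n A 1) (timeBlock n A 1) p : ℝ) /
      (c * (n * (1 - A)) * Real.log n)) atTop (𝓝 1) := by
  have hA : 0 < 1 - A := by linarith
  have h := (hz.tendsto_timeBlock hA0 hA1.le p).div_const (c * (1 - A))
  rw [div_self (by positivity)] at h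
  refine h.congr fun n => ?_
  rw [div_div]
  congr 1
  ring

omit hz in
lemma selfCount_shiftBy (z : ℕ → Lattice2) (b m : ℕ) (p : Lattice2) :
    (selfCount (shiftBy b z) m p : ℝ) = blockCount z b (b + m) p := by
  have hw : ∀ u, walk (shiftBy b z) u = walk z (b + u) - walk z b := by
    intro u
    rw [walk_sub_walk z (Nat.le_add_right b u), increment, Finset.sum_Ico_eq_sum_range,
      Nat.add_sub_cancel_left]
    rfl
  rw [selfCount, blockCount, crossCount_eq_sum, crossCount_eq_sum, Finset.sum_Ico_eq_sum_range,
    Nat.add_sub_cancel_left]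
  refine Finset.sum_congr rfl fun u _ => ?_
  rw [Finset.sum_Ico_eq_sum_range, Nat.add_sub_cancel_left]
  refine Finset.sum_congr rfl fun v _ => ?_
  rw [hw, hw, sub_sub_sub_cancel_right]

omit hz in
lemma tendsto_mul_log_div {m : ℕ → ℕ} {B : ℝ} (hB : 0 < B)
    (hm : Tendsto (fun n => (m n : ℝ) / n) atTop (𝓝 B)) :
    Tendsto (fun n : ℕ => (m n * Real.log (m n)) / (n * Real.log n)) atTop (𝓝 B) := by
  have h1 : Tendsto (fun n : ℕ => Real.log ((m n : ℝ) / n) / Real.log n) atTop (𝓝 0) :=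
    (hm.log hB.ne').div_atTop tendsto_log_nat
  have h2 := hm.mul (h1.const_add 1)
  rw [add_zero, mul_one] at h2
  refine h2.congr' ?_
  filter_upwards [hm.eventually_const_lt hB, tendsto_log_nat.eventually_gt_atTop 0,
    eventually_gt_atTop 0] with n hmn hn hn0
  have hn0' : (0 : ℝ) < n := by exact_mod_cast hn0
  have hm0 : (m n : ℝ) ≠ 0 := by
    intro h0
    rw [h0, zero_div] at hmn
    exact lt_irrefl _ hmn
  rw [Real.log_div hm0 hn0'.ne']
  field_simp
  ring

lemma HasBlockAsymptotics.tendsto_selfCount_shiftBy (hc : 0 < c) {A : ℝ} (hA0 : 0 ≤ A)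
    (hA1 : A < 1) (p : Lattice2) :
    Tendsto (fun n : ℕ =>
      (selfCount (shiftBy ⌊(n : ℝ) * A⌋₊ z) ⌊(n : ℝ) * (1 - A)⌋₊ p : ℝ) /
        (c * (⌊(n : ℝ) * (1 - A)⌋₊ : ℝ) * Real.log (⌊(n : ℝ) * (1 - A)⌋₊ : ℝ)))
      atTop (𝓝 1) := by
  have hA : 0 < 1 - A := by linarith
  have hm := tendsto_floor_mul_div hA.le
  have hx := tendsto_floor_mul_div hA0
  have hy : Tendsto (fun n : ℕ => ((⌊(n : ℝ) * A⌋₊ + ⌊(n : ℝ) * (1 - A)⌋₊ : ℕ) : ℝ) / n) atTop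
      (𝓝 1) := by
    have := hx.add hm
    rw [add_sub_cancel] at this
    refine this.congr fun n => ?_
    push_cast
    rw [add_div]
  have h1 := hz p _ _ A 1 (fun n => Nat.le_add_right _ _) hx hy
  have h2 := (tendsto_mul_log_div hA hm).const_mul c
  have h3 := h1.div h2 (by positivity)
  rw [div_self (by positivity)] at h3
  refine h3.congr' ?_
  filter_upwards [tendsto_log_nat.eventually_gt_atTop 0, eventually_gt_atTop 0] with n hn hn0
  have hn0' : (0 : ℝ) < n := by exact_mod_cast hn0
  have hne : (n : ℝ) * Real.log n ≠ 0 := by positivity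
  rw [selfCount_shiftBy, Pi.div_apply, ← mul_div_assoc, div_div_div_cancel_right₀ hne, mul_assoc]

end Paths

/-! ### Weak convergence to a point mass -/

section Spectral

variable {ι : Type*}

/-- The nonnegative trigonometric polynomial `|∑ w_i e^{2πi⟨l_i, t⟩}|²`. -/
def sqTrigPoly (I : Finset ι) (w : ι → ℝ) (l : ι → Lattice2) (t : Torus2) : ℝ :=
  ‖∑ i ∈ I, (w i : ℂ) * mFourier (l i) t‖ ^ 2

lemma continuous_sqTrigPoly (I : Finset ι) (w : ι → ℝ) (l : ι → Lattice2) :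
    Continuous (sqTrigPoly I w l) := by
  unfold sqTrigPoly
  exact (continuous_finsetSum _ fun i _ => continuous_const.mul (mFourier (l i)).continuous).norm.pow 2

lemma sqTrigPoly_eq_sum (I : Finset ι) (w : ι → ℝ) (l : ι → Lattice2) (t : Torus2) :
    (sqTrigPoly I w l t : ℂ) =
      ∑ i ∈ I, ∑ j ∈ I, ((w i * w j : ℝ) : ℂ) * mFourier (-(l i - l j)) t := by
  have h1 : (sqTrigPoly I w l t : ℂ) = (starRingEnd ℂ) (∑ i ∈ I, (w i : ℂ) * mFourier (l i) t) *
      ∑ j ∈ I, (w j : ℂ) * mFourier (l j) t := by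
    rw [sqTrigPoly, mul_comm, Complex.mul_conj, Complex.normSq_eq_norm_sq]
  rw [h1, map_sum, Finset.sum_mul_sum]
  refine Finset.sum_congr rfl fun i _ => Finset.sum_congr rfl fun j _ => ?_
  rw [map_mul, Complex.conj_ofReal, ← mFourier_neg, neg_sub, sub_eq_add_neg, mFourier_add]
  push_cast
  ring

/-- Integration against a nonnegative trigonometric polynomial. -/
def trigFunctional (I : Finset ι) (w : ι → ℝ) (l : ι → Lattice2) (g : C(Torus2, ℂ)) : ℂ :=
  ∫ t, g t * (sqTrigPoly I w l t : ℂ) ∂torusHaar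

lemma integrable_trigFunctional (I : Finset ι) (w : ι → ℝ) (l : ι → Lattice2) (g : C(Torus2, ℂ)) :
    Integrable (fun t => g t * (sqTrigPoly I w l t : ℂ)) torusHaar :=
  integrable_of_continuous_torusHaar
    (g.continuous.mul (Complex.continuous_ofReal.comp (continuous_sqTrigPoly I w l)))

lemma trigFunctional_add (I : Finset ι) (w : ι → ℝ) (l : ι → Lattice2) (g g' : C(Torus2, ℂ)) :
    trigFunctional I w l (g + g') = trigFunctional I w l g + trigFunctional I w l g' := by
  unfold trigFunctional
  rw [← integral_add (integrable_trigFunctional I w l g) (integrable_trigFunctional I w l g')]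
  congr 1 with t
  rw [ContinuousMap.add_apply, add_mul]

lemma trigFunctional_smul (I : Finset ι) (w : ι → ℝ) (l : ι → Lattice2) (a : ℂ)
    (g : C(Torus2, ℂ)) : trigFunctional I w l (a • g) = a * trigFunctional I w l g := by
  unfold trigFunctional
  rw [← integral_const_mul]
  congr 1 with t
  rw [ContinuousMap.smul_apply, smul_eq_mul, mul_assoc]

/-- Positivity of the density: the norm of the functional is its value at the constant 1, which the
zeroth Fourier coefficient controls. -/
lemma norm_trigFunctional_le (I : Finset ι) (w : ι → ℝ) (l : ι → Lattice2) (g : C(Torus2, ℂ)) :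
    ‖trigFunctional I w l g‖ ≤ ‖g‖ * ‖trigFunctional I w l 1‖ := by
  have hnn : ∀ t, 0 ≤ sqTrigPoly I w l t := fun t => sq_nonneg _
  have hint : Integrable (sqTrigPoly I w l) torusHaar :=
    (continuous_sqTrigPoly I w l).integrable_of_hasCompactSupport
      (HasCompactSupport.of_compactSpace _)
  have h1 : ‖trigFunctional I w l 1‖ = ∫ t, sqTrigPoly I w l t ∂torusHaar := by
    have : trigFunctional I w l 1 = ((∫ t, sqTrigPoly I w l t ∂torusHaar : ℝ) : ℂ) := by
      rw [trigFunctional, ← integral_complex_ofReal]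
      congr 1 with t
      rw [ContinuousMap.one_apply, one_mul]
    rw [this, Complex.norm_real, Real.norm_of_nonneg (integral_nonneg hnn)]
  rw [h1, ← integral_const_mul]
  refine norm_integral_le_of_norm_le (hint.const_mul _) (ae_of_all _ fun t => ?_)
  rw [norm_mul, Complex.norm_real, Real.norm_of_nonneg (hnn t)]
  exact mul_le_mul_of_nonneg_right (g.norm_coe_le_norm t) (hnn t)

lemma trigFunctional_eq_sum (I : Finset ι) (w : ι → ℝ) (l : ι → Lattice2) (g : C(Torus2, ℂ)) :
    trigFunctional I w l g =
      ∑ i ∈ I, ∑ j ∈ I, ((w i * w j : ℝ) : ℂ) * mFourierCoeff g (l i - l j) := by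
  have h1 : ∀ t, g t * (sqTrigPoly I w l t : ℂ) =
      ∑ i ∈ I, ∑ j ∈ I, ((w i * w j : ℝ) : ℂ) * (mFourier (-(l i - l j)) t * g t) := by
    intro t
    rw [sqTrigPoly_eq_sum, Finset.mul_sum]
    refine Finset.sum_congr rfl fun i _ => ?_
    rw [Finset.mul_sum]
    refine Finset.sum_congr rfl fun j _ => ?_
    ring
  have hint : ∀ i j, Integrable
      (fun t => ((w i * w j : ℝ) : ℂ) * (mFourier (-(l i - l j)) t * g t)) torusHaar :=
    fun i j => integrable_of_continuous_torusHaar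
      (continuous_const.mul ((mFourier _).continuous.mul g.continuous))
  rw [trigFunctional]
  simp_rw [h1]
  rw [integral_finsetSum _ fun i _ => integrable_finsetSum _ fun j _ => hint i j]
  refine Finset.sum_congr rfl fun i _ => ?_
  rw [integral_finsetSum _ fun j _ => hint i j]
  refine Finset.sum_congr rfl fun j _ => ?_
  rw [integral_const_mul, mFourierCoeff_eq_integral_torusHaar]

lemma mFourierCoeff_mFourier (p l : Lattice2) :
    mFourierCoeff (mFourier p) l = if l = p then 1 else 0 := by
  rw [mFourierCoeff_eq_integral_torusHaar]
  simp_rw [← mFourier_add]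
  rw [integral_mFourier]
  simp_rw [neg_add_eq_zero]

/-- Weak convergence of measures with densities `sqTrigPoly` to a point mass at `0`. -/
lemma tendsto_trigFunctional {I : ℕ → Finset ι} {w : ι → ℝ} {l : ι → Lattice2} {r : ℕ → ℝ} {S : ℝ}
    (h : ∀ p : Lattice2, Tendsto (fun n => (r n : ℂ) * trigFunctional (I n) w l (mFourier p)) atTop
      (𝓝 (S : ℂ))) (g : C(Torus2, ℂ)) :
    Tendsto (fun n => (r n : ℂ) * trigFunctional (I n) w l g) atTop (𝓝 (S * g 0)) := by
  have hspan : ∀ g ∈ Submodule.span ℂ (Set.range (mFourier (d := Fin 2))),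
      Tendsto (fun n => (r n : ℂ) * trigFunctional (I n) w l g) atTop (𝓝 (S * g 0)) := by
    intro g hg
    induction hg using Submodule.span_induction with
    | mem g hg =>
      obtain ⟨p, rfl⟩ := hg
      have h0 : mFourier p (0 : Torus2) = 1 := by simp [mFourier]
      rw [h0, mul_one]
      exact h p
    | zero => simp [trigFunctional]
    | add g g' _ _ hg hg' =>
      simp_rw [trigFunctional_add, ContinuousMap.add_apply, mul_add]
      exact hg.add hg'
    | smul a g _ hg =>
      have := hg.const_mul a
      simp_rw [trigFunctional_smul, ContinuousMap.smul_apply, smul_eq_mul]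
      convert this using 1
      · funext n; ring
      · congr 1; ring
  -- The hypothesis at `p = 0` bounds the total masses, so convergence extends from trigonometric
  -- polynomials to their uniform closure, which is everything.
  have hbd : ∀ᶠ n in atTop, ‖(r n : ℂ) * trigFunctional (I n) w l 1‖ < |S| + 1 := by
    have h1 := (h 0).norm
    rw [mFourier_zero, Complex.norm_real, Real.norm_eq_abs] at h1
    exact h1.eventually_lt_const (by linarith)
  rw [Metric.tendsto_nhds]
  intro ε hε
  set δ := ε / (4 * (|S| + 1)) with hδ
  have hS : 0 < |S| + 1 := by positivity
  have hδ0 : 0 < δ := by positivity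
  have hmem : g ∈ (Submodule.span ℂ (Set.range (mFourier (d := Fin 2)))).topologicalClosure := by
    rw [span_mFourier_closure_eq_top]; exact Submodule.mem_top
  obtain ⟨g', hg', hdist⟩ := Metric.mem_closure_iff.mp hmem δ hδ0
  rw [dist_eq_norm] at hdist
  filter_upwards [hbd, Metric.tendsto_nhds.mp (hspan g' hg') (ε / 2) (by positivity)] with n h1 h2
  have hsplit : (r n : ℂ) * trigFunctional (I n) w l g - S * g 0 =
      (r n : ℂ) * trigFunctional (I n) w l (g - g') +
      ((r n : ℂ) * trigFunctional (I n) w l g' - S * g' 0) - S * (g - g') 0 := by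
    have : trigFunctional (I n) w l g =
        trigFunctional (I n) w l (g - g') + trigFunctional (I n) w l g' := by
      rw [← trigFunctional_add, sub_add_cancel]
    rw [this, ContinuousMap.sub_apply]
    ring
  rw [dist_eq_norm] at h2 ⊢
  rw [hsplit]
  have h3 : ‖(r n : ℂ) * trigFunctional (I n) w l (g - g')‖ ≤ δ * (|S| + 1) := by
    rw [norm_mul] at h1 ⊢
    calc ‖(r n : ℂ)‖ * ‖trigFunctional (I n) w l (g - g')‖
        ≤ ‖(r n : ℂ)‖ * (‖g - g'‖ * ‖trigFunctional (I n) w l 1‖) :=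
          mul_le_mul_of_nonneg_left (norm_trigFunctional_le _ _ _ _) (norm_nonneg _)
      _ = ‖g - g'‖ * (‖(r n : ℂ)‖ * ‖trigFunctional (I n) w l 1‖) := by ring
      _ ≤ δ * (|S| + 1) := mul_le_mul hdist.le h1.le (by positivity) hδ0.le
  have h4 : ‖(S : ℂ) * (g - g') 0‖ ≤ δ * (|S| + 1) := by
    rw [norm_mul, Complex.norm_real, Real.norm_eq_abs, mul_comm]
    exact mul_le_mul (((g - g').norm_coe_le_norm 0).trans hdist.le) (by linarith) (abs_nonneg _)
      hδ0.le
  have h5 : δ * (|S| + 1) = ε / 4 := by rw [hδ]; field_simp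
  rw [h5] at h3 h4
  have h6 := norm_sub_le ((r n : ℂ) * trigFunctional (I n) w l (g - g') +
      ((r n : ℂ) * trigFunctional (I n) w l g' - S * g' 0)) (S * (g - g') 0)
  have h7 := norm_add_le ((r n : ℂ) * trigFunctional (I n) w l (g - g'))
      ((r n : ℂ) * trigFunctional (I n) w l g' - S * g' 0)
  linarith

end Spectral

/-! ### Block sums along the path for an action of the lattice -/

section Action

variable {E : Type*} [MeasurableSpace E] [AddAction Lattice2 E] [MeasurableConstVAdd Lattice2 E]
  {μ : Measure E} [IsProbabilityMeasure μ] [VAddInvariantMeasure Lattice2 E μ] {f : E → ℝ}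
  {φ : C(Torus2, ℝ)}

lemma integral_vadd_mul_vadd (f : E → ℝ) (l l' : Lattice2) :
    ∫ x, f (l +ᵥ x) * f (l' +ᵥ x) ∂μ = ∫ x, f ((l - l') +ᵥ x) * f x ∂μ := by
  have h := (measurePreserving_vadd l' μ).integral_comp (measurableEmbedding_const_vadd l')
    (fun x => f ((l - l') +ᵥ x) * f x)
  rw [← h]
  congr 1 with x
  rw [vadd_vadd, sub_add_cancel]

/-- The spectral isometry for finite combinations: by invariance the correlations depend on `l i - l
j` only, and are the Fourier coefficients of the density. -/
lemma integral_sum_vadd_sq {ι : Type*} (hf : MemLp f 2 μ) (hφ : IsContSpectralDensity μ f φ)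
    (I : Finset ι) (w : ι → ℝ) (l : ι → Lattice2) :
    ((∫ x, (∑ i ∈ I, w i * f (l i +ᵥ x)) ^ 2 ∂μ : ℝ) : ℂ) =
      trigFunctional I w l ((ContinuousMap.mk Complex.ofReal Complex.continuous_ofReal).comp φ) := by
  have hL : ∀ l : Lattice2, MemLp (fun x => f (l +ᵥ x)) 2 μ := fun l =>
    hf.comp_measurePreserving (measurePreserving_vadd l μ)
  have hint : ∀ i j, Integrable (fun x => (w i * w j) * (f (l i +ᵥ x) * f (l j +ᵥ x))) μ :=
    fun i j => ((hL (l i)).integrable_mul (hL (l j))).const_mul _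
  have h1 : ∀ x, (∑ i ∈ I, w i * f (l i +ᵥ x)) ^ 2 =
      ∑ i ∈ I, ∑ j ∈ I, (w i * w j) * (f (l i +ᵥ x) * f (l j +ᵥ x)) := by
    intro x
    rw [sq, Finset.sum_mul_sum]
    refine Finset.sum_congr rfl fun i _ => Finset.sum_congr rfl fun j _ => ?_
    ring
  simp_rw [h1]
  rw [integral_finsetSum _ fun i _ => integrable_finsetSum _ fun j _ => hint i j,
    trigFunctional_eq_sum, Complex.ofReal_sum]
  refine Finset.sum_congr rfl fun i _ => ?_
  rw [integral_finsetSum _ fun j _ => hint i j, Complex.ofReal_sum]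
  refine Finset.sum_congr rfl fun j _ => ?_
  rw [integral_const_mul, integral_vadd_mul_vadd, Complex.ofReal_mul, ← hφ (l i - l j)]
  rfl

variable {z : ℕ → Lattice2} {c : ℝ}

/-- Off the diagonal the two blocks lie on either side of the right end of the earlier one, so
`splitCount` at that cut dominates. -/
lemma HasBlockAsymptotics.tendsto_crossCount_blocks (hz : HasBlockAsymptotics z c) {s : ℕ}
    {t : Fin (s + 1) → ℝ} (ht : StrictMono t) (ht0 : t 0 = 0) (ht1 : t (Fin.last s) = 1)
    (p : Lattice2) (i j : Fin s) :
    Tendsto (fun n : ℕ => (crossCount z (timeBlock n (t i.castSucc) (t i.succ))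
      (timeBlock n (t j.castSucc) (t j.succ)) p : ℝ) / (n * Real.log n)) atTop
      (𝓝 (if i = j then c * (t i.succ - t i.castSucc) else 0)) := by
  have hnn : ∀ k, 0 ≤ t k := fun k => ht0 ▸ ht.monotone (Fin.zero_le k)
  have hle1 : ∀ k, t k ≤ 1 := fun k => ht1 ▸ ht.monotone (Fin.le_last k)
  split_ifs with hij
  · subst hij
    exact hz.tendsto_timeBlock (hnn _) (ht.monotone (Fin.castSucc_lt_succ).le) p
  · have hlt : ∀ a b : Fin s, a < b → t a.succ ≤ t b.castSucc := fun a b hab =>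
      ht.monotone (Fin.succ_le_castSucc_iff.mpr hab)
    have hlog : ∀ᶠ n : ℕ in atTop, 0 < Real.log n := tendsto_log_nat.eventually_gt_atTop 0
    rcases lt_or_gt_of_ne hij with h | h
    · refine squeeze_zero' (hlog.mono fun n hn => by positivity) (hlog.mono fun n hn => ?_)
        (hz.tendsto_splitCount (hnn i.succ) (hle1 i.succ) p)
      refine div_le_div_of_nonneg_right ?_ (by positivity)
      refine le_trans ?_ (le_add_of_nonneg_right (Nat.cast_nonneg _))
      exact Nat.cast_le.mpr (crossCount_mono z (timeBlock_subset_left le_rfl n)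
        (timeBlock_subset_right (hlt i j h) (hle1 _) n) p)
    · refine squeeze_zero' (hlog.mono fun n hn => by positivity) (hlog.mono fun n hn => ?_)
        (hz.tendsto_splitCount (hnn j.succ) (hle1 j.succ) p)
      refine div_le_div_of_nonneg_right ?_ (by positivity)
      refine le_trans ?_ (le_add_of_nonneg_left (Nat.cast_nonneg _))
      exact Nat.cast_le.mpr (crossCount_mono z (timeBlock_subset_right (hlt j i h) (hle1 _) n)
        (timeBlock_subset_left le_rfl n) p)

/-- The asymptotic variance of weighted block sums along the path. -/
lemma HasBlockAsymptotics.tendsto_integral_blockSum_sq (hz : HasBlockAsymptotics z c) (hc : 0 < c)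
    (hf : MemLp f 2 μ) (hφ : IsContSpectralDensity μ f φ) {s : ℕ} (a : Fin s → ℝ)
    {t : Fin (s + 1) → ℝ} (ht : StrictMono t) (ht0 : t 0 = 0) (ht1 : t (Fin.last s) = 1) :
    Tendsto (fun n : ℕ => (c * n * Real.log n)⁻¹ * ∫ x, (blockSum z f a t n x) ^ 2 ∂μ) atTop
      (𝓝 (φ 0 * ∑ j : Fin s, a j ^ 2 * (t j.succ - t j.castSucc))) := by
  set B : ℕ → Fin s → Finset ℕ := fun n j => timeBlock n (t j.castSucc) (t j.succ) with hB
  -- Indices carry their block, because consecutive blocks share an end point and that time must be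
  -- counted with both weights.
  set I : ℕ → Finset (Σ _ : Fin s, ℕ) := fun n => Finset.univ.sigma (B n) with hI
  set w : (Σ _ : Fin s, ℕ) → ℝ := fun i => a i.1 with hw
  set l : (Σ _ : Fin s, ℕ) → Lattice2 := fun i => walk z i.2 with hl
  set S : ℝ := ∑ j : Fin s, a j ^ 2 * (t j.succ - t j.castSucc) with hS
  have hblock : ∀ n x, blockSum z f a t n x = ∑ i ∈ I n, w i * f (l i +ᵥ x) := by
    intro n x
    rw [blockSum, hI, Finset.sum_sigma]
    exact Finset.sum_congr rfl fun j _ => Finset.mul_sum _ _ _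
  have hcoef : ∀ n p, trigFunctional (I n) w l (mFourier p) =
      ((∑ i : Fin s, ∑ j : Fin s, a i * a j * (crossCount z (B n i) (B n j) p : ℝ) : ℝ) : ℂ) := by
    intro n p
    rw [trigFunctional_eq_sum, hI, Finset.sum_sigma, Complex.ofReal_sum]
    refine Finset.sum_congr rfl fun i _ => ?_
    simp_rw [Finset.sum_sigma]
    rw [Finset.sum_comm, Complex.ofReal_sum]
    refine Finset.sum_congr rfl fun j _ => ?_
    rw [crossCount_eq_sum, Complex.ofReal_mul, Complex.ofReal_sum, Finset.mul_sum]
    refine Finset.sum_congr rfl fun k _ => ?_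
    rw [Complex.ofReal_sum, Finset.mul_sum]
    refine Finset.sum_congr rfl fun k' _ => ?_
    simp only [mFourierCoeff_mFourier, hw, hl]
    split_ifs <;> simp
  have hlim : ∀ p : Lattice2, Tendsto (fun n : ℕ => (((c * n * Real.log n)⁻¹ : ℝ) : ℂ) *
      trigFunctional (I n) w l (mFourier p)) atTop (𝓝 (S : ℂ)) := by
    intro p
    have h1 : Tendsto (fun n : ℕ => c⁻¹ * ∑ i : Fin s, ∑ j : Fin s,
        a i * a j * ((crossCount z (B n i) (B n j) p : ℝ) / (n * Real.log n))) atTop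
        (𝓝 (c⁻¹ * ∑ i : Fin s, ∑ j : Fin s,
          a i * a j * (if i = j then c * (t i.succ - t i.castSucc) else 0))) :=
      (tendsto_finsetSum _ fun i _ => tendsto_finsetSum _ fun j _ =>
        (hz.tendsto_crossCount_blocks ht ht0 ht1 p i j).const_mul _).const_mul _
    -- Only diagonal blocks survive, and the limit does not depend on `p`: this identifies the weak
    -- limit as a point mass at 0.
    have h2 : c⁻¹ * ∑ i : Fin s, ∑ j : Fin s,
        a i * a j * (if i = j then c * (t i.succ - t i.castSucc) else 0) = S := by
      simp only [mul_ite, mul_zero, Finset.sum_ite_eq, Finset.mem_univ, if_true]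
      rw [hS, Finset.mul_sum]
      refine Finset.sum_congr rfl fun i _ => ?_
      field_simp
    rw [h2] at h1
    have h3 := (Complex.continuous_ofReal.tendsto S).comp h1
    refine h3.congr fun n => ?_
    simp only [Function.comp_apply]
    rw [hcoef, ← Complex.ofReal_mul]
    congr 1
    rw [Finset.mul_sum, Finset.mul_sum]
    refine Finset.sum_congr rfl fun i _ => ?_
    rw [Finset.mul_sum, Finset.mul_sum]
    refine Finset.sum_congr rfl fun j _ => ?_
    rw [mul_inv, mul_inv, div_eq_mul_inv, mul_inv]
    ring
  have hfin := tendsto_trigFunctional hlim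
    ((ContinuousMap.mk Complex.ofReal Complex.continuous_ofReal).comp φ)
  have hre := (Complex.continuous_re.tendsto _).comp hfin
  have hval : ((S : ℂ) * ((ContinuousMap.mk Complex.ofReal Complex.continuous_ofReal).comp φ) 0).re =
      φ 0 * S := by
    rw [ContinuousMap.comp_apply, ContinuousMap.coe_mk, ← Complex.ofReal_mul, Complex.ofReal_re,
      mul_comm]
  rw [hval] at hre
  refine hre.congr fun n => ?_
  simp only [Function.comp_apply]
  rw [← integral_sum_vadd_sq hf hφ (I n) w l, ← Complex.ofReal_mul, Complex.ofReal_re]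
  simp_rw [hblock]

end Action

end

/-! ### The main theorem -/

theorem proposition1p5 {Ω : Type*} [MeasurableSpace Ω] (P : Measure Ω)
    [IsProbabilityMeasure P] (ζ : ℕ → Ω → Lattice2)
    (hmeas : ∀ i, Measurable (ζ i)) (hindep : iIndepFun ζ P)
    (hident : ∀ i, IdentDistrib (ζ i) (ζ 0) P P)
    (hmoment : ∀ i : Fin 2, Integrable (fun ω => (ζ 0 ω i : ℝ) ^ 2) P)
    (hcentered : ∀ i : Fin 2, ∫ ω, (ζ 0 ω i : ℝ) ∂P = 0)
    (haperiodic : Aperiodic P (ζ 0)) :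
    -- the normalizing constant
    ∃ C₀ : ℝ, 0 < C₀ ∧
      (fun n : ℕ => ∫ ω, (selfCount (fun i => ζ i ω) n 0 : ℝ) ∂P) ~[atTop]
        (fun n : ℕ => C₀ * n * Real.log n) ∧
      (StronglyAperiodic P (ζ 0) → C₀ = (Real.pi * √(stepCov P (ζ 0)).det)⁻¹) ∧
      ∀ᵐ ω ∂P,
        -- the integrals count the intersections, and cross terms are negligible
        (∀ (I J : Finset ℕ) (p : Lattice2),
          crossIntegral (fun i => ζ i ω) I J p = (crossCount (fun i => ζ i ω) I J p : ℂ)) ∧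
        (∀ (A B C D : ℝ) (p : Lattice2), 0 < A → A < B → B < C → C < D → D < 1 →
          (fun n : ℕ => crossIntegral (fun i => ζ i ω) (timeBlock n A B) (timeBlock n C D) p)
            =o[atTop] (fun n : ℕ => (n : ℝ) * Real.log n)) ∧
        -- self-intersections of the block `[nA, n]`, and cross terms of adjacent blocks
        (∀ (A : ℝ) (p : Lattice2), 0 < A → A < 1 →
          Tendsto (fun n : ℕ =>
            (selfCount (shiftBy ⌊(n : ℝ) * A⌋₊ (fun i => ζ i ω)) ⌊(n : ℝ) * (1 - A)⌋₊ p : ℝ) /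
              (C₀ * (⌊(n : ℝ) * (1 - A)⌋₊ : ℝ) * Real.log (⌊(n : ℝ) * (1 - A)⌋₊ : ℝ)))
            atTop (𝓝 1) ∧
          Tendsto (fun n : ℕ =>
            (crossCount (fun i => ζ i ω) (timeBlock n A 1) (timeBlock n A 1) p : ℝ) /
              (C₀ * (n * (1 - A)) * Real.log n))
            atTop (𝓝 1) ∧
          (fun n : ℕ =>
            (crossCount (fun i => ζ i ω) (Finset.Icc 1 ⌊(n : ℝ) * A⌋₊) (timeBlock n A 1) p : ℝ) +
            (crossCount (fun i => ζ i ω) (timeBlock n A 1) (Finset.Icc 1 ⌊(n : ℝ) * A⌋₊) p : ℝ))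
            =o[atTop] (fun n : ℕ => (n : ℝ) * Real.log n)) ∧
        -- the variance of weighted block sums, for all systems, functions and partitions
        (∀ (E : Type*) [MeasurableSpace E] [AddAction Lattice2 E]
          [MeasurableConstVAdd Lattice2 E] (μ : Measure E) [IsProbabilityMeasure μ]
          [VAddInvariantMeasure Lattice2 E μ] (f : E → ℝ) (φ : C(Torus2, ℝ)),
          MemLp f 2 μ → IsContSpectralDensity μ f φ →
          ∀ (s : ℕ) (a : Fin s → ℝ) (t : Fin (s + 1) → ℝ),
            StrictMono t → t 0 = 0 → t (Fin.last s) = 1 →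
            Tendsto (fun n : ℕ =>
              (C₀ * n * Real.log n)⁻¹ * ∫ x, (blockSum (fun i => ζ i ω) f a t n x) ^ 2 ∂μ)
              atTop (𝓝 (φ 0 * ∑ j : Fin s, a j ^ 2 * (t j.succ - t j.castSucc)))) := by
  have h : IsIIDSteps P ζ := ⟨hmeas, hindep, hident⟩
  have hX : IsCenteredAperiodic P (ζ 0) := ⟨hmeas 0, hmoment, hcentered, haperiodic⟩
  have hc : 0 < 2 * greenConst P (ζ 0) := by
    have := hX.greenConst_pos
    positivity
  -- Pairs of times are ordered, so the constant is twice that of the Green function.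
  refine ⟨2 * greenConst P (ζ 0), hc, ?_, fun _ => ?_, ?_⟩
  · refine isEquivalent_of_tendsto_one ?_
    have h1 := (h.tendsto_meanCount hX 0).div_const (2 * greenConst P (ζ 0))
    rw [div_self hc.ne'] at h1
    refine h1.congr fun n => ?_
    rw [← h.integral_blockCount 0 n 0, Pi.div_apply, zero_add, div_div]
    congr 1
    · simp only [blockCount, selfCount, Finset.range_eq_Ico]
    · ring
  · rw [greenConst, mul_assoc, mul_inv, ← mul_assoc, mul_inv_cancel₀ two_ne_zero, one_mul]
  · filter_upwards [h.ae_hasBlockAsymptotics hX] with ω hω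
    refine ⟨crossIntegral_eq_crossCount _, ?_, ?_, ?_⟩
    · intro A B C D p hA hAB hBC hCD hD
      exact hω.isLittleO_crossIntegral (hA.trans hAB).le hBC.le hCD.le hD.le p
    · intro A p hA0 hA1
      exact ⟨hω.tendsto_selfCount_shiftBy hc hA0.le hA1 p, hω.tendsto_final_block hc hA0.le hA1 p,
        hω.isLittleO_adjacent hA0.le hA1.le p⟩
    · intro E _ _ _ μ _ _ f φ hf hφ s a t ht ht0 ht1
      exact hω.tendsto_integral_blockSum_sq hc hf hφ a ht ht0 ht1
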